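/- Let $d\ge 3$, let $\mathbb{T}^d=\mathbb{R}^d/\mathbb{Z}^d$ be the flat torus, and let $\varepsilon>0$. Let $\rho_0:[0,1]\times\mathbb{T}^d\to\mathbb{R}$ and $u_0:[0,1]\times\mathbb{T}^d\to\mathbb{R}^d$ be smooth with $$\int_{\mathbb{T}^d}\rho_0(0,x)\,dx=\int_{\mathbb{T}^d}\rho_0(t,x)\,dx,\qquad \operatorname{div}u_0(t)=0\qquad\text{for every }t\in[0,1],$$ and set $$E:=\{t\in[0,1]\ :\ \partial_t\rho_0(t)+\operatorname{div}(\rho_0(t)u_0(t))=0 \text{ on } \mathbb{T}^d\}.$$ Then there exist $\rho:[0,1]\times\mathbb{T}^d\to\mathbb{R}$ and $u:[0,1]\times\mathbb{T}^d\to\mathbb{R}^d$ such that (a) $\rho\in C([0,1];L^1(\mathbb{T}^d))$ and $u\in C([0,1]\times\mathbb{T}^d)\cap\bigcap_{1\le p<d-1}C([0,1];W^{1,p}(\mathbb{T}^d))$; (b) $(\rho,u)$ is a weak solution of the continuity equation, that is, $\partial_t\rho+\operatorname{div}(\rho u)=0$ and $\operatorname{div}u=0$ in the sense of distributions on $(0,1)\times\mathbb{T}^d$;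 (c) for every $t\in E$, $\rho(t)=\rho_0(t)$ (in $L^1(\mathbb{T}^d)$) and $u(t)=u_0(t)$; (d) $\max_{t\in[0,1]}\|\rho(t)-\rho_0(t)\|_{L^1(\mathbb{T}^d)}\le\varepsilon$. Likewise there exist $\rho$ and $u$ which satisfy (a), (b), (c) and, instead of (d), (d') $\|u-u_0\|_{C^0([0,1]\times\mathbb{T}^d)}\le\varepsilon$. -/

import Mathlib

open MeasureTheory Set
open scoped ContDiff ENNReal

namespace ContinuityEq

/-- The flat torus `ℝ^d / ℤ^d`; its `volume` is the product Haar measure, of total mass one. -/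
abbrev Torus (d : ℕ) : Type := UnitAddTorus (Fin d)

/-- The space `ℝ^d` with its Euclidean norm, in which the velocity fields take their values. -/
abbrev Vec (d : ℕ) : Type := EuclideanSpace ℝ (Fin d)

/-- The quotient map `ℝ^d → ℝ^d / ℤ^d`. -/
def proj {d : ℕ} (y : Fin d → ℝ) : Torus d := fun i => (y i : UnitAddCircle)

/-- `f : 𝕋^d → E` is smooth: its periodic lift to `ℝ^d` is smooth. -/
def SmoothTorus {d : ℕ} {E : Type*} [NormedAddCommGroup E] [NormedSpace ℝ E]
    (f : Torus d → E) : Prop :=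
  ContDiff ℝ ∞ (fun y : Fin d → ℝ => f (proj y))

/-- A time-dependent `f` is smooth on `S × 𝕋^d`: its periodic lift is smooth on `S × ℝ^d`
(with one-sided time derivatives at the end points if `S = [0,1]`). -/
def SmoothOn {d : ℕ} {E : Type*} [NormedAddCommGroup E] [NormedSpace ℝ E]
    (S : Set ℝ) (f : ℝ → Torus d → E) : Prop :=
  ContDiffOn ℝ ∞ (fun z : ℝ × (Fin d → ℝ) => f z.1 (proj z.2)) (S ×ˢ univ)

/-- The classical partial derivative `∂_i f (x)`, the derivative of `s ↦ f (x + s e_i)` at `0`. -/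
noncomputable def pderiv {d : ℕ} {E : Type*} [NormedAddCommGroup E] [NormedSpace ℝ E]
    (i : Fin d) (f : Torus d → E) (x : Torus d) : E :=
  deriv (fun s : ℝ => f (x + Pi.single i (s : UnitAddCircle))) 0

/-- The classical divergence `∑ i, ∂_i v_i`. -/
noncomputable def divergence {d : ℕ} (v : Torus d → Vec d) (x : Torus d) : ℝ :=
  ∑ i, pderiv i (fun z => v z i) x

/-- The set of times `t ∈ [0,1]` with `∂_t ρ(t) + div (ρ(t) u(t)) = 0` on all of `𝕋^d`
(the time derivative is one-sided at `t = 0` and `t = 1`). -/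
def exactTimes {d : ℕ} (ρ : ℝ → Torus d → ℝ) (u : ℝ → Torus d → Vec d) : Set ℝ :=
  {t | t ∈ Icc (0 : ℝ) 1 ∧ ∀ x : Torus d,
    derivWithin (fun s => ρ s x) (Icc 0 1) t + divergence (fun z => ρ t z • u t z) x = 0}

/-- `f ∈ C([0,1]; L^p(𝕋^d))`. -/
def ContinuousInLp {d : ℕ} {E : Type*} [NormedAddCommGroup E] [NormedSpace ℝ E]
    (p : ℝ≥0∞) [Fact (1 ≤ p)] (f : ℝ → Torus d → E) : Prop :=
  ∃ F : ℝ → Lp E p (volume : Measure (Torus d)),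
    ContinuousOn F (Icc 0 1) ∧ ∀ t ∈ Icc (0 : ℝ) 1, F t =ᵐ[volume] f t

/-- `g` is the weak partial derivative `∂_i f` on the torus (both functions integrable):
`∫ f ∂_i φ = - ∫ g φ` for all smooth `φ`. -/
def IsWeakPartial {d : ℕ} {E : Type*} [NormedAddCommGroup E] [NormedSpace ℝ E]
    (i : Fin d) (f g : Torus d → E) : Prop :=
  Integrable f ∧ Integrable g ∧
    ∀ φ : Torus d → ℝ, SmoothTorus φ → ∫ x, pderiv i φ x • f x = - ∫ x, φ x • g x

/-- `f ∈ C([0,1]; W^{1,p}(𝕋^d))`: for every `t` the function `f t` and its weak partial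
derivatives are in `L^p`, and they depend on `t` continuously in the norm of `L^p`. -/
def ContinuousInW1p {d : ℕ} {E : Type*} [NormedAddCommGroup E] [NormedSpace ℝ E]
    (p : ℝ≥0∞) [Fact (1 ≤ p)] (f : ℝ → Torus d → E) : Prop :=
  ContinuousInLp p f ∧
    ∀ i : Fin d, ∃ g : ℝ → Torus d → E,
      ContinuousInLp p g ∧ ∀ t ∈ Icc (0 : ℝ) 1, IsWeakPartial i (f t) (g t)

/-- Test functions on `(0,1) × 𝕋^d`: smooth, with compact support in `(0,1) × 𝕋^d`. -/
structure IsTestFunction {d : ℕ} (φ : ℝ → Torus d → ℝ) : Prop where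
  smooth : SmoothOn univ φ
  compact : HasCompactSupport (Function.uncurry φ)
  support : tsupport (Function.uncurry φ) ⊆ Ioo (0 : ℝ) 1 ×ˢ univ

/-- The product of the Lebesgue measure on `(0,1)` and the measure of the torus. -/
noncomputable def spaceTime (d : ℕ) : Measure (ℝ × Torus d) :=
  (volume.restrict (Ioo (0 : ℝ) 1)).prod volume

/-- `(ρ, u)` solves `∂_t ρ + div (ρ u) = 0`, `div u = 0` in the sense of distributions on
`(0,1) × 𝕋^d`; the functions `ρ`, `u` and `ρ u` are required to be integrable there. -/
structure IsWeakSolution {d : ℕ} (ρ : ℝ → Torus d → ℝ) (u : ℝ → Torus d → Vec d) : Prop where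
  integrable_density : Integrable (fun z : ℝ × Torus d => ρ z.1 z.2) (spaceTime d)
  integrable_velocity : Integrable (fun z : ℝ × Torus d => u z.1 z.2) (spaceTime d)
  integrable_flux : Integrable (fun z : ℝ × Torus d => ρ z.1 z.2 • u z.1 z.2) (spaceTime d)
  continuity : ∀ φ : ℝ → Torus d → ℝ, IsTestFunction φ →
    ∫ z : ℝ × Torus d, (ρ z.1 z.2 * deriv (fun s => φ s z.2) z.1
      + ∑ i, ρ z.1 z.2 * u z.1 z.2 i * pderiv i (φ z.1) z.2) ∂(spaceTime d) = 0
  incompressible : ∀ φ : ℝ → Torus d → ℝ, IsTestFunction φ →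
    ∫ z : ℝ × Torus d, (∑ i, u z.1 z.2 i * pderiv i (φ z.1) z.2) ∂(spaceTime d) = 0

/-- The regularity class of the solutions: `ρ ∈ C([0,1]; L^1(𝕋^d))`, and `u` is continuous on
`[0,1] × 𝕋^d` and in `C([0,1]; W^{1,p}(𝕋^d))` for every `1 ≤ p < d - 1`. -/
structure HasRegularity {d : ℕ} (ρ : ℝ → Torus d → ℝ) (u : ℝ → Torus d → Vec d) : Prop where
  density : ContinuousInLp 1 ρ
  velocity : ContinuousOn (fun z : ℝ × Torus d => u z.1 z.2) (Icc 0 1 ×ˢ univ)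
  sobolev : ∀ (p : ℝ≥0∞) [Fact (1 ≤ p)], p < (d : ℝ≥0∞) - 1 → ContinuousInW1p p u

end ContinuityEq

/-!
The proof is by convex integration. A subsolution `IsSub ρ u R` solves the equations up to a
defect, `∂_t ρ + div (ρ u) = div R` and `div u = 0`. The given pair is a subsolution: the defect
is an antidivergence of `∂_t ρ₀ + div (ρ₀ u₀)`, which exists because the total mass is conserved,
and which vanishes at the times where the pair is exact (`exists_initial`). Perturbations `ϑ`, `w`
of density and velocity are added so that the mean of the product `ϑ w` cancels the defect; the
new defect is arbitrarily small in `L¹` (`exists_step`), and the sum of all perturbations gives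
the solution.

**Profiles.** In the direction `e_j`, with another coordinate `m ≠ j`, take a function `q` which
does not depend on `x_j` and is concentrated in a tube of width `1/μ` around a line in the
direction `j`, so on a set of measure `μ^(1-d)`, with `∂_m q` of size one. The velocity profile is
the rotated gradient `∂_m q e_j - ∂_j q e_m = ∂_m q e_j`, the density profile is `A ∂_m q` with `A
∫ (∂_m q)² = 1`, so `A` is of the order `μ^(d-1)`. Uniformly in `μ` the density is bounded in `L¹`
and the velocity in `C⁰`. The gradient of the velocity is of size `μ`, and its `L^p` norm is of
the order `μ^(1 - (d-1)/p)`: it is small for large `μ` exactly if `p < d - 1` (`exists_profile`).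

**One perturbation.** The profile oscillates with frequency `n` and travels with a constant
velocity `c`; density and velocity are derivatives of the potential `n⁻¹ b q(n (x - t c))`. Hence
the velocity is divergence-free and the density has mean zero also with variable amplitudes `a`,
`β`. The operator `∂_t + c · ∇` does not see the fast variable, so what remains is the transport
error `ϑ (u - c)`, the product `ϑ w`, whose mean is `a β e_j` and whose oscillation about it is a
divergence gaining `n⁻¹`, the term `ρ w`, small in `L¹` by concentration, and terms of order `n⁻¹`
(`IsSub.perturb`, `abs_pertError_le`). All `L¹` norms which are multiplied by `n⁻¹` are bounded
uniformly in `μ`, and `∫ |f| |g(n ·)|` is nearly at most `∫ |f| ∫ |g|` for large `n` depending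
only on `f` (`exists_integral_abs_mul_le`). So `n` can be fixed first and `μ` taken large
afterwards (`exists_perturbation_single`). Because `w` is small in `L¹`, several perturbations can
be added successively without controlling their supports (`exists_perturbation`).

**One step.** Functions `b_n` of the velocity with `∑ b_n² = 1` localize to regions where the
velocity is within `h` of a constant `c_n` (`exists_velocity_partition`), where the transport
error is small. The amplitudes `-η χ b_n R_j` and `η⁻¹ χ b_n` cancel `R_j`, smoothed. The cut-off
`χ` in time vanishes where the defect does, so that exact times are never touched. The density is
changed by `O(η ‖R‖_{L¹})` in `L¹` and the velocity by `O(η⁻¹)` in `C⁰`.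

**Iteration.** With defects `r 4⁻ⁿ` and `η = σ 2ⁿ` both series converge geometrically, and `p_n ↑
d - 1` gives all the Sobolev exponents. The total change is `O(σ)` for the density and `O(σ⁻¹)`
for the velocity (`exists_solution`): small `σ` gives the closeness of the densities, large `σ`
that of the velocities.
-/

namespace ContinuityEq

variable {d : ℕ} {E : Type*} [NormedAddCommGroup E] [NormedSpace ℝ E]

/-! ### The quotient map and functions on the torus -/

lemma isOpenQuotientMap_proj : IsOpenQuotientMap (proj : (Fin d → ℝ) → Torus d) :=
  IsOpenQuotientMap.piMap (fun _ => QuotientAddGroup.isOpenQuotientMap_mk)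

lemma continuous_proj : Continuous (proj : (Fin d → ℝ) → Torus d) :=
  isOpenQuotientMap_proj.continuous

lemma proj_surjective : Function.Surjective (proj : (Fin d → ℝ) → Torus d) :=
  isOpenQuotientMap_proj.surjective

@[simp] lemma proj_add (y z : Fin d → ℝ) : proj (y + z) = proj y + proj z := by
  ext i; simp [proj]

@[simp] lemma proj_zero : proj (0 : Fin d → ℝ) = 0 := by
  ext i; simp [proj]

lemma proj_single (i : Fin d) (s : ℝ) :
    proj (Pi.single i s) = Pi.single i (s : UnitAddCircle) := by
  ext k
  by_cases h : k = i
  · subst h; simp [proj]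
  · simp [proj, h]

lemma proj_nsmul (n : ℕ) (y : Fin d → ℝ) : proj (n • y) = n • proj y := by
  ext i; simp [proj]

lemma proj_smul_single (i : Fin d) (s : ℝ) :
    proj (s • Pi.single i (1 : ℝ)) = Pi.single i (s : UnitAddCircle) := by
  rw [← proj_single, ← Pi.single_smul]; simp

lemma continuous_uncurry_of_lift {F : Type*} [TopologicalSpace F] {f : ℝ → Torus d → F}
    (h : Continuous fun z : ℝ × (Fin d → ℝ) => f z.1 (proj z.2)) :
    Continuous (Function.uncurry f) :=
  (IsOpenQuotientMap.id.prodMap isOpenQuotientMap_proj).isQuotientMap.continuous_iff.2 h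

lemma continuous_single (i : Fin d) :
    Continuous fun s : ℝ => (Pi.single i (s : UnitAddCircle) : Torus d) := by
  have h : (fun s : ℝ => (Pi.single i (s : UnitAddCircle) : Torus d)) =
      fun s => proj (s • Pi.single i (1 : ℝ)) := by
    ext1 s; rw [proj_smul_single]
  rw [h]
  exact continuous_proj.comp (by fun_prop)

lemma single_coe_add (i : Fin d) (s r : ℝ) :
    (Pi.single i ((s + r : ℝ) : UnitAddCircle) : Torus d) =
      Pi.single i (s : UnitAddCircle) + Pi.single i (r : UnitAddCircle) := by
  rw [← Pi.single_add]; simp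

/-! ### Differentiation along translations under the integral sign -/

/-- The integral of a derivative along a group of measure-preserving translations vanishes. -/
lemma integral_eq_zero_of_hasDerivAt_add {G : Type*} [AddCommGroup G] [MeasurableSpace G]
    [MeasurableAdd G] {μ : Measure G} [μ.IsAddLeftInvariant] {g : ℝ → G} (g0 : g 0 = 0)
    {H H' : G → E} {b : G → ℝ} (hH : Integrable H μ) (hH' : AEStronglyMeasurable H' μ)
    (hd : ∀ z s, HasDerivAt (fun r => H (z + g r)) (H' (z + g s)) s)
    (hb : Integrable b μ) (hbd : ∀ z, ∀ s ∈ Metric.ball (0 : ℝ) 1, ‖H' (z + g s)‖ ≤ b z) :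
    ∫ z, H' z ∂μ = 0 := by
  have key := (hasDerivAt_integral_of_dominated_loc_of_deriv_le (μ := μ) (𝕜 := ℝ)
    (F := fun r z => H (z + g r)) (F' := fun r z => H' (z + g r)) (x₀ := 0) (bound := b)
    (Metric.ball_mem_nhds (0 : ℝ) one_pos)
    (Filter.Eventually.of_forall fun r => (hH.comp_add_right (g r)).aestronglyMeasurable)
    (by simpa [g0] using hH) (by simpa [g0] using hH')
    (Filter.Eventually.of_forall hbd) hb
    (Filter.Eventually.of_forall fun z s _ => hd z s)).2
  have hc : (fun r => ∫ z, H (z + g r) ∂μ) = fun _ => ∫ z, H z ∂μ := by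
    ext r; exact integral_add_right_eq_self _ _
  rw [hc] at key
  have := key.unique (hasDerivAt_const _ _)
  simpa [g0] using this

/-! ### Partial derivatives on the torus -/

/-- `f'` is the classical partial derivative of `f` in the direction `i`. -/
def HasPartial (i : Fin d) (f f' : Torus d → E) : Prop :=
  ∀ x, HasDerivAt (fun s : ℝ => f (x + Pi.single i (s : UnitAddCircle))) (f' x) 0

namespace HasPartial

variable {i : Fin d} {f f' : Torus d → E}

lemma pderiv_eq (h : HasPartial i f f') : pderiv i f = f' := by
  ext1 x; exact (h x).deriv

lemma hasDerivAt (h : HasPartial i f f') (x : Torus d) (s : ℝ) :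
    HasDerivAt (fun r : ℝ => f (x + Pi.single i (r : UnitAddCircle)))
      (f' (x + Pi.single i (s : UnitAddCircle))) s := by
  have h1 := h (x + Pi.single i (s : UnitAddCircle))
  have h2 : HasDerivAt (fun r : ℝ => r - s) 1 s := (hasDerivAt_id s).sub_const s
  have h3 := HasDerivAt.scomp_of_eq s h1 h2 (by simp)
  simp only [one_smul] at h3
  refine h3.congr_of_eventuallyEq (Filter.Eventually.of_forall fun r => ?_)
  simp only [Function.comp]
  rw [add_assoc, ← single_coe_add]
  simp

lemma add {g g' : Torus d → E} (hf : HasPartial i f f') (hg : HasPartial i g g') :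
    HasPartial i (fun x => f x + g x) (fun x => f' x + g' x) := fun x => (hf x).add (hg x)

lemma mul {f f' g g' : Torus d → ℝ} (hf : HasPartial i f f') (hg : HasPartial i g g') :
    HasPartial i (fun x => f x * g x) (fun x => f' x * g x + f x * g' x) := fun x => by
  simpa using (hf x).fun_mul (hg x)

lemma smul {f f' : Torus d → ℝ} {g g' : Torus d → E} (hf : HasPartial i f f')
    (hg : HasPartial i g g') :
    HasPartial i (fun x => f x • g x) (fun x => f x • g' x + f' x • g x) := fun x => by
  simpa using (hf x).fun_smul (hg x)

lemma const_mul {f f' : Torus d → ℝ} (c : ℝ) (hf : HasPartial i f f') :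
    HasPartial i (fun x => c * f x) (fun x => c * f' x) := fun x => (hf x).const_mul c

lemma const (c : E) : HasPartial i (fun _ => c) (fun _ => 0) := fun _ => hasDerivAt_const _ _

/-- Chain rule for the affine maps `x ↦ n x - a`. -/
lemma comp_nsmul_sub (h : HasPartial i f f') (n : ℕ) (a : Torus d) :
    HasPartial i (fun x => f (n • x - a)) (fun x => (n : ℝ) • f' (n • x - a)) := fun x => by
  have h2 : HasDerivAt (fun r : ℝ => (n : ℝ) * r) (n : ℝ) 0 := by
    simpa using (hasDerivAt_id (0 : ℝ)).const_mul (n : ℝ)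
  have h3 := HasDerivAt.scomp_of_eq 0 (h (n • x - a)) h2 (by simp)
  refine h3.congr_of_eventuallyEq (Filter.Eventually.of_forall fun r => ?_)
  simp only [Function.comp]
  congr 1
  have : (Pi.single i (((n : ℝ) * r : ℝ) : UnitAddCircle) : Torus d) =
      n • Pi.single i (r : UnitAddCircle) := by
    rw [← proj_single, ← proj_single, ← proj_nsmul]
    congr 1
    rw [← Pi.single_smul]; simp
  rw [this, smul_add]; abel

/-- A function with vanishing partial derivatives arises from invariance under translations. -/
lemma of_invariant (h : ∀ x (s : ℝ), f (x + Pi.single i (s : UnitAddCircle)) = f x) :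
    HasPartial i f (fun _ => 0) := fun x => by
  simp_rw [h]; exact hasDerivAt_const _ _

lemma integral_eq_zero (h : HasPartial i f f') (hf : Continuous f)
    (hf' : Continuous f') : ∫ x, f' x = 0 := by
  obtain ⟨C, hC⟩ := isCompact_univ.exists_bound_of_continuousOn hf'.continuousOn
  refine integral_eq_zero_of_hasDerivAt_add
    (g := fun s : ℝ => (Pi.single i (s : UnitAddCircle) : Torus d)) (by simp)
    (hf.integrable_of_hasCompactSupport (HasCompactSupport.of_compactSpace f))
    hf'.aestronglyMeasurable (fun z s => h.hasDerivAt z s) (b := fun _ => C)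
    (integrable_const C) (fun z s _ => hC _ (mem_univ _))

end HasPartial

lemma integrable_of_continuous {F : Type*} [NormedAddCommGroup F] {f : Torus d → F}
    (hf : Continuous f) :
    Integrable f :=
  hf.integrable_of_hasCompactSupport (HasCompactSupport.of_compactSpace f)

/-- Integration by parts on the torus. -/
lemma integral_mul_partial {i : Fin d} {f f' g g' : Torus d → ℝ} (hf : HasPartial i f f')
    (hg : HasPartial i g g') (cf : Continuous f) (cf' : Continuous f') (cg : Continuous g)
    (cg' : Continuous g') : ∫ x, f' x * g x = - ∫ x, f x * g' x := by
  have h := (hf.mul hg).integral_eq_zero (cf.mul cg) ((cf'.mul cg).add (cf.mul cg'))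
  rw [integral_add (f := fun x => f' x * g x) (g := fun x => f x * g' x)
    (integrable_of_continuous (cf'.mul cg))
    (integrable_of_continuous (cf.mul cg'))] at h
  linarith

/-! ### Directional derivatives in space-time -/

/-- The derivative of `f` at `(t, x)` in the space-time direction `v`. -/
noncomputable def dirDeriv (v : ℝ × (Fin d → ℝ)) (f : ℝ → Torus d → E) (t : ℝ) (x : Torus d) : E :=
  deriv (fun s : ℝ => f (t + s * v.1) (x + proj (s • v.2))) 0

lemma smoothOn_univ_iff {f : ℝ → Torus d → E} :
    SmoothOn univ f ↔ ContDiff ℝ ∞ (fun z : ℝ × (Fin d → ℝ) => f z.1 (proj z.2)) := by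
  rw [SmoothOn, univ_prod_univ, contDiffOn_univ]

namespace SmoothOn

variable {f g : ℝ → Torus d → E}

lemma contDiff (hf : SmoothOn univ f) :
    ContDiff ℝ ∞ (fun z : ℝ × (Fin d → ℝ) => f z.1 (proj z.2)) := smoothOn_univ_iff.1 hf

lemma continuous (hf : SmoothOn univ f) : Continuous fun z : ℝ × Torus d => f z.1 z.2 :=
  continuous_uncurry_of_lift hf.contDiff.continuous

lemma continuous_slice (hf : SmoothOn univ f) (t : ℝ) : Continuous (f t) :=
  hf.continuous.comp (Continuous.prodMk_right t)

lemma hasDerivAt_lift (hf : SmoothOn univ f) (v : ℝ × (Fin d → ℝ)) (t : ℝ) (y : Fin d → ℝ) :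
    HasDerivAt (fun s : ℝ => f (t + s * v.1) (proj y + proj (s • v.2)))
      (fderiv ℝ (fun z : ℝ × (Fin d → ℝ) => f z.1 (proj z.2)) (t, y) v) 0 := by
  have h1 : HasFDerivAt (fun z : ℝ × (Fin d → ℝ) => f z.1 (proj z.2))
      (fderiv ℝ (fun z : ℝ × (Fin d → ℝ) => f z.1 (proj z.2)) (t, y)) (t, y) :=
    (hf.contDiff.differentiable (by simp) _).hasFDerivAt
  have h2 : HasDerivAt (fun s : ℝ => (t, y) + s • v) v 0 := by
    simpa using ((hasDerivAt_id (0 : ℝ)).smul_const v).const_add (t, y)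
  have h3 := HasFDerivAt.comp_hasDerivAt_of_eq 0 h1 h2 (by simp)
  refine h3.congr_of_eventuallyEq (Filter.Eventually.of_forall fun r => ?_)
  simp

lemma dirDeriv_lift (hf : SmoothOn univ f) (v : ℝ × (Fin d → ℝ)) (t : ℝ) (y : Fin d → ℝ) :
    dirDeriv v f t (proj y) = fderiv ℝ (fun z : ℝ × (Fin d → ℝ) => f z.1 (proj z.2)) (t, y) v :=
  (hf.hasDerivAt_lift v t y).deriv

lemma dirDeriv (hf : SmoothOn univ f) (v : ℝ × (Fin d → ℝ)) : SmoothOn univ (dirDeriv v f) := by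
  rw [smoothOn_univ_iff]
  simp_rw [hf.dirDeriv_lift]
  have : ContDiff ℝ ∞ (fderiv ℝ (fun z : ℝ × (Fin d → ℝ) => f z.1 (proj z.2))) :=
    hf.contDiff.fderiv_right (by simp)
  exact this.clm_apply contDiff_const

lemma hasDerivAt (hf : SmoothOn univ f) (v : ℝ × (Fin d → ℝ)) (t : ℝ) (x : Torus d) (s : ℝ) :
    HasDerivAt (fun r : ℝ => f (t + r * v.1) (x + proj (r • v.2)))
      (ContinuityEq.dirDeriv v f (t + s * v.1) (x + proj (s • v.2))) s := by
  obtain ⟨y, rfl⟩ := proj_surjective x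
  have h1 := hf.hasDerivAt_lift v (t + s * v.1) (y + s • v.2)
  rw [← hf.dirDeriv_lift] at h1
  have h2 : HasDerivAt (fun r : ℝ => r - s) 1 s := (hasDerivAt_id s).sub_const s
  have h3 := HasDerivAt.scomp_of_eq s h1 h2 (by simp)
  rw [proj_add] at h3
  simp only [one_smul] at h3
  refine h3.congr_of_eventuallyEq (Filter.Eventually.of_forall fun r => ?_)
  simp only [Function.comp]
  congr 1
  · ring
  · rw [add_assoc, ← proj_add (s • v.2), ← add_smul]; simp

lemma hasDerivAt_zero (hf : SmoothOn univ f) (v : ℝ × (Fin d → ℝ)) (t : ℝ) (x : Torus d) :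
    HasDerivAt (fun r : ℝ => f (t + r * v.1) (x + proj (r • v.2)))
      (ContinuityEq.dirDeriv v f t x) 0 := by
  simpa using hf.hasDerivAt v t x 0

lemma hasPartial (hf : SmoothOn univ f) (i : Fin d) (t : ℝ) :
    HasPartial i (f t) (ContinuityEq.dirDeriv (0, Pi.single i 1) f t) := fun x => by
  have := hf.hasDerivAt_zero (0, Pi.single i 1) t x
  simpa [proj_smul_single] using this

lemma pderiv_eq (hf : SmoothOn univ f) (i : Fin d) (t : ℝ) :
    pderiv i (f t) = ContinuityEq.dirDeriv (0, Pi.single i 1) f t :=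
  (hf.hasPartial i t).pderiv_eq

lemma hasDerivAt_time (hf : SmoothOn univ f) (t : ℝ) (x : Torus d) :
    HasDerivAt (fun s => f s x) (ContinuityEq.dirDeriv (1, 0) f t x) t := by
  have := hf.hasDerivAt (1, 0) 0 x t
  simpa using this

lemma add (hf : SmoothOn univ f) (hg : SmoothOn univ g) :
    SmoothOn univ (fun t x => f t x + g t x) :=
  smoothOn_univ_iff.2 (hf.contDiff.add hg.contDiff)

lemma sub (hf : SmoothOn univ f) (hg : SmoothOn univ g) :
    SmoothOn univ (fun t x => f t x - g t x) :=
  smoothOn_univ_iff.2 (hf.contDiff.sub hg.contDiff)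

lemma neg (hf : SmoothOn univ f) : SmoothOn univ (fun t x => -f t x) :=
  smoothOn_univ_iff.2 hf.contDiff.neg

lemma mul {f g : ℝ → Torus d → ℝ} (hf : SmoothOn univ f) (hg : SmoothOn univ g) :
    SmoothOn univ (fun t x => f t x * g t x) :=
  smoothOn_univ_iff.2 (hf.contDiff.mul hg.contDiff)

lemma const (c : E) : SmoothOn univ (fun (_ : ℝ) (_ : Torus d) => c) :=
  smoothOn_univ_iff.2 contDiff_const

lemma const_mul {f : ℝ → Torus d → ℝ} (c : ℝ) (hf : SmoothOn univ f) :
    SmoothOn univ (fun t x => c * f t x) := (const c).mul hf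

lemma comp {F : Type*} [NormedAddCommGroup F] [NormedSpace ℝ F] {φ : E → F}
    (hφ : ContDiff ℝ ∞ φ) (hf : SmoothOn univ f) : SmoothOn univ (fun t x => φ (f t x)) :=
  smoothOn_univ_iff.2 (hφ.comp hf.contDiff)

lemma prod {ι : Type*} {s : Finset ι} {f : ι → ℝ → Torus d → ℝ}
    (h : ∀ k ∈ s, SmoothOn univ (f k)) : SmoothOn univ (fun t x => ∏ k ∈ s, f k t x) :=
  smoothOn_univ_iff.2 (contDiff_prod fun k hk => (h k hk).contDiff)

lemma of_time {χ : ℝ → E} (h : ContDiff ℝ ∞ χ) : SmoothOn univ (fun t (_ : Torus d) => χ t) :=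
  smoothOn_univ_iff.2 (h.comp contDiff_fst)

/-- The function `f (n x - n t c)`, an `n`-fold oscillation travelling with velocity `c`. -/
lemma travelling {f : Torus d → E} (hf : SmoothTorus f) (n : ℕ) (c : Fin d → ℝ) :
    SmoothOn univ (fun t x => f (n • x - proj ((n * t) • c))) := by
  rw [smoothOn_univ_iff]
  have h : (fun z : ℝ × (Fin d → ℝ) => f (n • proj z.2 - proj (((n : ℝ) * z.1) • c))) =
      (fun y => f (proj y)) ∘ fun z => (n • z.2 - ((n : ℝ) * z.1) • c) := by
    ext z
    simp only [Function.comp]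
    congr 1
  rw [h]
  exact ContDiff.comp hf (by fun_prop)

lemma dirDeriv_mul {f g : ℝ → Torus d → ℝ} (hf : SmoothOn univ f) (hg : SmoothOn univ g)
    (v : ℝ × (Fin d → ℝ)) (t : ℝ) (x : Torus d) :
    ContinuityEq.dirDeriv v (fun t x => f t x * g t x) t x =
      ContinuityEq.dirDeriv v f t x * g t x + f t x * ContinuityEq.dirDeriv v g t x := by
  have := ((hf.hasDerivAt_zero v t x).fun_mul (hg.hasDerivAt_zero v t x)).deriv
  simpa [ContinuityEq.dirDeriv] using this

lemma dirDeriv_const_mul {f : ℝ → Torus d → ℝ} (hf : SmoothOn univ f) (c : ℝ)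
    (v : ℝ × (Fin d → ℝ)) (t : ℝ) (x : Torus d) :
    ContinuityEq.dirDeriv v (fun t x => c * f t x) t x = c * ContinuityEq.dirDeriv v f t x :=
  ((hf.hasDerivAt_zero v t x).const_mul c).deriv

lemma dirDeriv_add (hf : SmoothOn univ f) (hg : SmoothOn univ g)
    (v : ℝ × (Fin d → ℝ)) (t : ℝ) (x : Torus d) :
    ContinuityEq.dirDeriv v (fun t x => f t x + g t x) t x =
      ContinuityEq.dirDeriv v f t x + ContinuityEq.dirDeriv v g t x :=
  ((hf.hasDerivAt_zero v t x).add (hg.hasDerivAt_zero v t x)).deriv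

lemma dirDeriv_comm (hf : SmoothOn univ f) (v w : ℝ × (Fin d → ℝ)) (t : ℝ) (x : Torus d) :
    ContinuityEq.dirDeriv v (ContinuityEq.dirDeriv w f) t x =
      ContinuityEq.dirDeriv w (ContinuityEq.dirDeriv v f) t x := by
  obtain ⟨y, rfl⟩ := proj_surjective x
  have h2 : ContDiff ℝ ∞ (fderiv ℝ (fun z : ℝ × (Fin d → ℝ) => f z.1 (proj z.2))) :=
    hf.contDiff.fderiv_right (by simp)
  have key : ∀ v w : ℝ × (Fin d → ℝ), ContinuityEq.dirDeriv v (ContinuityEq.dirDeriv w f) t (proj y)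
      = fderiv ℝ (fderiv ℝ (fun z : ℝ × (Fin d → ℝ) => f z.1 (proj z.2))) (t, y) v w := by
    intro v w
    rw [(hf.dirDeriv w).dirDeriv_lift]
    simp_rw [hf.dirDeriv_lift]
    rw [fderiv_clm_apply (h2.differentiable (by simp) _) (by fun_prop)]
    simp
  rw [key, key]
  exact (hf.contDiff.contDiffAt.isSymmSndFDerivAt (by simp; norm_cast)).eq _ _

lemma dirDeriv_linear (hf : SmoothOn univ f) (v : ℝ × (Fin d → ℝ)) (t : ℝ) (x : Torus d) :
    ContinuityEq.dirDeriv v f t x = v.1 • ContinuityEq.dirDeriv (1, 0) f t x +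
      ∑ i, v.2 i • ContinuityEq.dirDeriv (0, Pi.single i 1) f t x := by
  obtain ⟨y, rfl⟩ := proj_surjective x
  simp_rw [hf.dirDeriv_lift, ← map_smul, ← map_sum, ← map_add]
  congr 1
  ext k
  · simp [Prod.fst_sum]
  · simp [Prod.snd_sum, Finset.sum_apply, Pi.single_apply]

/-- Oscillations travelling with velocity `c` are annihilated by `∂_t + c · ∇`. -/
lemma dirDeriv_travelling {f : Torus d → E} (n : ℕ) (c : Fin d → ℝ) (t : ℝ) (x : Torus d) :
    ContinuityEq.dirDeriv (1, c) (fun t x => f (n • x - proj ((n * t) • c))) t x = 0 := by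
  unfold ContinuityEq.dirDeriv
  have : ∀ s : ℝ, n • (x + proj (s • c)) - proj ((n * (t + s * 1)) • c) =
      n • x - proj ((n * t) • c) := by
    intro s
    have : ((n : ℝ) * (t + s * 1)) • c = (n * t) • c + n • (s • c) := by
      ext k; simp; ring
    rw [this, proj_add, proj_nsmul, smul_add]; abel
  simp only [this]
  exact deriv_const _ _

end SmoothOn

/-! ### Space-time integrals -/

lemma spaceTime_eq : spaceTime d = (volume : Measure (ℝ × Torus d)).restrict (Ioo 0 1 ×ˢ univ) := by
  rw [spaceTime, Measure.volume_eq_prod, ← Measure.prod_restrict, Measure.restrict_univ]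

instance : IsFiniteMeasure (spaceTime d) := by unfold spaceTime; infer_instance

lemma ae_spaceTime_mem : ∀ᵐ z ∂(spaceTime d), z.1 ∈ Ioo (0 : ℝ) 1 := by
  rw [spaceTime_eq]
  filter_upwards [ae_restrict_mem (measurableSet_Ioo.prod MeasurableSet.univ)] with z hz
  exact hz.1

lemma integrable_spaceTime {V : Type*} [NormedAddCommGroup V] {F : ℝ × Torus d → V}
    (hF : Continuous F) :
    Integrable F (spaceTime d) := by
  rw [spaceTime_eq]
  have : IntegrableOn F (Icc (0 : ℝ) 1 ×ˢ univ) (volume : Measure (ℝ × Torus d)) :=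
    hF.continuousOn.integrableOn_compact (isCompact_Icc.prod isCompact_univ)
  exact this.mono_set (prod_mono Ioo_subset_Icc_self le_rfl)

lemma integral_spaceTime {F : ℝ × Torus d → E} (hF : Integrable F (spaceTime d)) :
    ∫ z, F z ∂(spaceTime d) = ∫ t in Ioo (0 : ℝ) 1, ∫ x, F (t, x) :=
  integral_prod _ hF

lemma integral_spaceTime_congr {F G : ℝ × Torus d → ℝ} (hF : Integrable F (spaceTime d))
    (hG : Integrable G (spaceTime d))
    (h : ∀ t ∈ Ioo (0 : ℝ) 1, ∫ x, F (t, x) = ∫ x, G (t, x)) :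
    ∫ z, F z ∂(spaceTime d) = ∫ z, G z ∂(spaceTime d) := by
  rw [integral_spaceTime hF, integral_spaceTime hG]
  exact setIntegral_congr_fun measurableSet_Ioo h

/-! ### Test functions -/

namespace IsTestFunction

variable {φ : ℝ → Torus d → ℝ}

lemma eq_zero (hφ : IsTestFunction φ) {t : ℝ} (ht : t ∉ Ioo (0 : ℝ) 1) (x : Torus d) :
    φ t x = 0 := by
  by_contra h
  exact ht (hφ.support (subset_tsupport _ (show (t, x) ∈ Function.support _ from h))).1

lemma dirDeriv (hφ : IsTestFunction φ) (v : ℝ × (Fin d → ℝ)) :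
    IsTestFunction (dirDeriv v φ) := by
  have hsub : Function.support (Function.uncurry (ContinuityEq.dirDeriv v φ)) ⊆
      tsupport (Function.uncurry φ) := by
    rintro ⟨t, x⟩ h
    by_contra hn
    apply h
    have h1 : (Function.uncurry φ) =ᶠ[nhds (t, x)] 0 := notMem_tsupport_iff_eventuallyEq.1 hn
    have h2 : Continuous fun s : ℝ => (t + s * v.1, x + proj (s • v.2)) :=
      (by fun_prop : Continuous fun s : ℝ => t + s * v.1).prodMk
        (continuous_const.add (continuous_proj.comp (by fun_prop)))
    have h3 : Filter.Tendsto (fun s : ℝ => (t + s * v.1, x + proj (s • v.2))) (nhds 0)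
        (nhds (t, x)) := by
      simpa using h2.tendsto 0
    have h4 : (fun s : ℝ => φ (t + s * v.1) (x + proj (s • v.2))) =ᶠ[nhds 0] fun _ => 0 :=
      h3.eventually h1
    simpa [ContinuityEq.dirDeriv] using h4.deriv_eq
  have hc := closure_minimal hsub (isClosed_tsupport _)
  exact ⟨hφ.smooth.dirDeriv v, hφ.compact.of_isClosed_subset (isClosed_tsupport _) hc,
    hc.trans hφ.support⟩

lemma mul_left (hφ : IsTestFunction φ) {g : ℝ → Torus d → ℝ} (hg : SmoothOn univ g) :
    IsTestFunction (fun t x => g t x * φ t x) := by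
  have hsub : tsupport (Function.uncurry fun t x => g t x * φ t x) ⊆
      tsupport (Function.uncurry φ) := closure_mono (by
    rintro ⟨t, x⟩ h hn
    exact h (by simp only [Function.uncurry] at hn ⊢; rw [hn, mul_zero]))
  exact ⟨hg.mul hφ.smooth, hφ.compact.of_isClosed_subset (isClosed_tsupport _) hsub,
    hsub.trans hφ.support⟩

/-- The space-time integral of a derivative of a test function vanishes. -/
lemma integral_dirDeriv (hφ : IsTestFunction φ) (v : ℝ × (Fin d → ℝ)) :
    ∫ z : ℝ × Torus d, ContinuityEq.dirDeriv v φ z.1 z.2 ∂(spaceTime d) = 0 := by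
  have hd := hφ.dirDeriv v
  rw [spaceTime_eq, setIntegral_eq_integral_of_forall_compl_eq_zero]
  swap
  · rintro ⟨t, x⟩ h
    exact hd.eq_zero (fun ht => h ⟨ht, mem_univ _⟩) x
  have hdc := hd.smooth.continuous
  obtain ⟨C, hC⟩ := hd.compact.exists_bound_of_continuous hdc
  have hC0 : 0 ≤ C := (norm_nonneg _).trans (hC (0, 0))
  have : (volume : Measure (ℝ × Torus d)).IsAddLeftInvariant := by
    rw [Measure.volume_eq_prod]; exact Measure.prod.instIsAddLeftInvariant
  refine integral_eq_zero_of_hasDerivAt_add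
    (g := fun s : ℝ => ((s * v.1, proj (s • v.2)) : ℝ × Torus d)) (by simp)
    (H := fun z => φ z.1 z.2) (H' := fun z => ContinuityEq.dirDeriv v φ z.1 z.2)
    (hφ.smooth.continuous.integrable_of_hasCompactSupport hφ.compact)
    hdc.aestronglyMeasurable
    (fun z s => hφ.smooth.hasDerivAt v z.1 z.2 s)
    (b := (Icc (-|v.1|) (1 + |v.1|) ×ˢ (univ : Set (Torus d))).indicator fun _ => C) ?_ ?_
  · rw [integrable_indicator_iff (measurableSet_Icc.prod MeasurableSet.univ)]
    exact continuousOn_const.integrableOn_compact (isCompact_Icc.prod isCompact_univ)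
  · rintro ⟨t, x⟩ s hs
    rw [mem_ball_zero_iff, Real.norm_eq_abs] at hs
    by_cases ht : (t, x) ∈ (Icc (-|v.1|) (1 + |v.1|) ×ˢ (univ : Set (Torus d)))
    · rw [indicator_of_mem ht]; exact hC _
    · rw [indicator_of_notMem ht]
      have : ContinuityEq.dirDeriv v φ (t + s * v.1) (x + proj (s • v.2)) = 0 := by
        apply hd.eq_zero
        intro h
        apply ht
        have h1 : |s * v.1| ≤ |v.1| := by
          rw [abs_mul]
          nlinarith [abs_nonneg v.1]
        have := abs_le.1 h1
        exact ⟨⟨by linarith [h.1], by linarith [h.2]⟩, mem_univ _⟩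
      simp [this]

/-- Integration by parts in space-time. -/
lemma integral_dirDeriv_mul (hφ : IsTestFunction φ) {g : ℝ → Torus d → ℝ} (hg : SmoothOn univ g)
    (v : ℝ × (Fin d → ℝ)) :
    ∫ z : ℝ × Torus d, ContinuityEq.dirDeriv v g z.1 z.2 * φ z.1 z.2 ∂(spaceTime d) =
      - ∫ z : ℝ × Torus d, g z.1 z.2 * ContinuityEq.dirDeriv v φ z.1 z.2 ∂(spaceTime d) := by
  have h := (hφ.mul_left hg).integral_dirDeriv v
  simp_rw [hg.dirDeriv_mul hφ.smooth] at h
  rw [integral_add (f := fun z : ℝ × Torus d => ContinuityEq.dirDeriv v g z.1 z.2 * φ z.1 z.2)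
    (g := fun z : ℝ × Torus d => g z.1 z.2 * ContinuityEq.dirDeriv v φ z.1 z.2)
    (integrable_spaceTime ((hg.dirDeriv v).continuous.mul hφ.smooth.continuous))
    (integrable_spaceTime (hg.continuous.mul (hφ.smooth.dirDeriv v).continuous))] at h
  linarith

end IsTestFunction

end ContinuityEq

namespace ContinuityEq

variable {d : ℕ}

/-! ### Averages and primitives in one coordinate -/

/-- The average of `f` over the circle through `x` in the direction `i`. -/
noncomputable def avg (i : Fin d) (f : Torus d → ℝ) (x : Torus d) : ℝ :=
  ∫ s in (0 : ℝ)..1, f (x + Pi.single i (s : UnitAddCircle))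

/-- The convolution of `f` with the sawtooth function `1/2 - s` in the direction `i`; this is the
periodic primitive of `f - avg i f` with mean zero. -/
noncomputable def prim (i : Fin d) (f : Torus d → ℝ) (x : Torus d) : ℝ :=
  ∫ s in (0 : ℝ)..1, (1 / 2 - s) * f (x - Pi.single i (s : UnitAddCircle))

section

variable {X : Type*} [TopologicalSpace X]

lemma continuous_avg (i : Fin d) {f : X → Torus d → ℝ}
    (hf : Continuous fun z : X × Torus d => f z.1 z.2) :
    Continuous fun z : X × Torus d => avg i (f z.1) z.2 := by
  unfold avg
  refine intervalIntegral.continuous_parametric_intervalIntegral_of_continuous' ?_ 0 1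
  exact hf.comp ((continuous_fst.comp continuous_fst).prodMk
    ((continuous_snd.comp continuous_fst).add ((continuous_single i).comp continuous_snd)))

lemma continuous_prim (i : Fin d) {f : X → Torus d → ℝ}
    (hf : Continuous fun z : X × Torus d => f z.1 z.2) :
    Continuous fun z : X × Torus d => prim i (f z.1) z.2 := by
  unfold prim
  refine intervalIntegral.continuous_parametric_intervalIntegral_of_continuous' ?_ 0 1
  refine Continuous.mul (by fun_prop) ?_
  exact hf.comp ((continuous_fst.comp continuous_fst).prodMk
    ((continuous_snd.comp continuous_fst).sub ((continuous_single i).comp continuous_snd)))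

end

lemma integral_intervalIntegral_swap {F : ℝ → Torus d → ℝ}
    (hF : Continuous fun z : ℝ × Torus d => F z.1 z.2) :
    ∫ x, ∫ s in (0 : ℝ)..1, F s x = ∫ s in (0 : ℝ)..1, ∫ x, F s x := by
  simp_rw [intervalIntegral.integral_of_le zero_le_one]
  refine (integral_integral_swap (f := F) ?_).symm
  have h : (volume.restrict (Ioc (0 : ℝ) 1)).prod (volume : Measure (Torus d)) =
      (volume : Measure (ℝ × Torus d)).restrict (Ioc 0 1 ×ˢ univ) := by
    rw [Measure.volume_eq_prod, ← Measure.prod_restrict, Measure.restrict_univ]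
  rw [h]
  have : IntegrableOn (fun z : ℝ × Torus d => F z.1 z.2) (Icc (0 : ℝ) 1 ×ˢ univ) :=
    hF.continuousOn.integrableOn_compact (isCompact_Icc.prod isCompact_univ)
  exact this.mono_set (prod_mono Ioc_subset_Icc_self le_rfl)

instance : IsProbabilityMeasure (volume : Measure (Torus d)) :=
  ⟨by rw [volume_pi, Measure.pi_univ]; simp⟩

lemma integral_avg (i : Fin d) {f : Torus d → ℝ} (hf : Continuous f) :
    ∫ x, avg i f x = ∫ x, f x := by
  have h := integral_intervalIntegral_swap (F := fun s x => f (x + Pi.single i (s : UnitAddCircle)))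
    (hf.comp (continuous_snd.add ((continuous_single i).comp continuous_fst)))
  simp_rw [integral_add_right_eq_self (μ := (volume : Measure (Torus d))) f] at h
  simpa [avg] using h

lemma integral_abs_avg_le (i : Fin d) {f : Torus d → ℝ} (hf : Continuous f) :
    ∫ x, |avg i f x| ≤ ∫ x, |f x| := by
  rw [← integral_avg i hf.abs]
  have h1 := continuous_avg (X := Unit) i (f := fun _ => f) (hf.comp continuous_snd)
  have h2 := continuous_avg (X := Unit) i (f := fun _ x => |f x|) (hf.abs.comp continuous_snd)
  refine integral_mono (integrable_of_continuous
    (h1.comp (Continuous.prodMk_right ())).abs) (integrable_of_continuous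
    (h2.comp (Continuous.prodMk_right ()))) fun x => ?_
  exact intervalIntegral.abs_integral_le_integral_abs zero_le_one

lemma integral_abs_prim_le (i : Fin d) {f : Torus d → ℝ} (hf : Continuous f) :
    ∫ x, |prim i f x| ≤ ∫ x, |f x| := by
  have hc : Continuous fun z : ℝ × Torus d => |f (z.2 - Pi.single i (z.1 : UnitAddCircle))| :=
    (hf.comp (continuous_snd.sub ((continuous_single i).comp continuous_fst))).abs
  have h3 : ∫ x, |f x| =
      ∫ x : Torus d, ∫ s in (0 : ℝ)..1, |f (x - Pi.single i (s : UnitAddCircle))| := by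
    have h := integral_intervalIntegral_swap
      (F := fun s x => |f (x - Pi.single i (s : UnitAddCircle))|) hc
    simp_rw [integral_sub_right_eq_self (μ := (volume : Measure (Torus d))) fun x => |f x|] at h
    simpa using h.symm
  rw [h3]
  have h1 := continuous_prim (X := Unit) i (f := fun _ => f) (hf.comp continuous_snd)
  have hx : ∀ x : Torus d, Continuous fun s : ℝ => f (x - Pi.single i (s : UnitAddCircle)) :=
    fun x => hf.comp (continuous_const.sub (continuous_single i))
  refine integral_mono (integrable_of_continuous
    (h1.comp (Continuous.prodMk_right ())).abs) (integrable_of_continuous ?_) fun x => ?_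
  · refine intervalIntegral.continuous_parametric_intervalIntegral_of_continuous' ?_ 0 1
    exact hc.comp continuous_swap
  · refine (intervalIntegral.abs_integral_le_integral_abs zero_le_one).trans ?_
    refine intervalIntegral.integral_mono_on zero_le_one
      (((by fun_prop : Continuous fun s : ℝ => 1 / 2 - s).mul (hx x)).abs.intervalIntegrable _ _)
      ((hx x).abs.intervalIntegrable _ _) fun s hs => ?_
    rw [abs_mul]
    have : |1 / 2 - s| ≤ 1 := abs_le.2 ⟨by linarith [hs.2], by linarith [hs.1]⟩
    exact mul_le_of_le_one_left (abs_nonneg _) this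

lemma avg_add_single (i : Fin d) (f : Torus d → ℝ) (x : Torus d) (r : ℝ) :
    avg i f (x + Pi.single i (r : UnitAddCircle)) = avg i f x := by
  unfold avg
  have hp : Function.Periodic (fun s : ℝ => f (x + Pi.single i (s : UnitAddCircle))) 1 := by
    intro s; simp
  have h1 : ∀ s : ℝ, f (x + Pi.single i (r : UnitAddCircle) + Pi.single i (s : UnitAddCircle)) =
      f (x + Pi.single i ((r + s : ℝ) : UnitAddCircle)) := by
    intro s; simp only [single_coe_add, add_assoc]
  have h2 := intervalIntegral.integral_comp_add_left (a := 0) (b := 1)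
    (fun s : ℝ => f (x + Pi.single i (s : UnitAddCircle))) r
  have h3 := hp.intervalIntegral_add_eq r 0
  simp_rw [h1]
  simpa using h2.trans (by simpa using h3)

/-- The function `f` does not depend on the `j`-th coordinate. -/
def InvariantIn (j : Fin d) {β : Type*} (f : Torus d → β) : Prop :=
  ∀ x (s : ℝ), f (x + Pi.single j (s : UnitAddCircle)) = f x

lemma InvariantIn.avg {j : Fin d} {f : Torus d → ℝ} (h : InvariantIn j f) (i : Fin d) :
    InvariantIn j (avg i f) := by
  intro x s
  unfold ContinuityEq.avg
  refine intervalIntegral.integral_congr fun r _ => ?_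
  rw [add_right_comm, h _ s]

lemma InvariantIn.prim {j : Fin d} {f : Torus d → ℝ} (h : InvariantIn j f) (i : Fin d) :
    InvariantIn j (prim i f) := by
  intro x s
  unfold ContinuityEq.prim
  refine intervalIntegral.integral_congr fun r _ => ?_
  simp only [add_sub_right_comm x, h _ s]

/-- The primitive is differentiable although `f` is only continuous: shifting the variable of
integration moves the increment into the kernel and the end points. -/
lemma hasPartial_prim (i : Fin d) {f : Torus d → ℝ} (hf : Continuous f) :
    HasPartial i (prim i f) (fun x => f x - avg i f x) := by
  intro x
  set φ : ℝ → ℝ := fun s => f (x + Pi.single i (s : UnitAddCircle)) with hφ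
  have cφ : Continuous φ := hf.comp (continuous_const.add (continuous_single i))
  have hp : Function.Periodic φ 1 := by intro s; simp [hφ]
  have hprim : ∀ h : ℝ, prim i f (x + Pi.single i (h : UnitAddCircle)) =
      (1 / 2 - h) * ((∫ r in (0 : ℝ)..h, φ r) - ∫ r in (0 : ℝ)..(h - 1), φ r) +
        ((∫ r in (0 : ℝ)..h, r * φ r) - ∫ r in (0 : ℝ)..(h - 1), r * φ r) := by
    intro h
    have h1 : ∀ s : ℝ, (1 / 2 - s) *
        f (x + Pi.single i (h : UnitAddCircle) - Pi.single i (s : UnitAddCircle)) =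
        (fun r : ℝ => (1 / 2 - h) * φ r + r * φ r) (h - s) := by
      intro s
      have : x + Pi.single i (h : UnitAddCircle) - Pi.single i (s : UnitAddCircle) =
          x + Pi.single i ((h - s : ℝ) : UnitAddCircle) := by
        rw [add_sub_assoc, ← Pi.single_sub]; simp
      simp only [hφ, this]; ring
    unfold prim
    simp_rw [h1]
    rw [intervalIntegral.integral_comp_sub_left (fun r : ℝ => (1 / 2 - h) * φ r + r * φ r),
      intervalIntegral.integral_add, intervalIntegral.integral_const_mul,
      intervalIntegral.integral_interval_sub_left, intervalIntegral.integral_interval_sub_left]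
    · simp
    all_goals exact Continuous.intervalIntegrable (by fun_prop) _ _
  simp_rw [hprim]
  have d1 : ∀ {ψ : ℝ → ℝ}, Continuous ψ →
      HasDerivAt (fun h : ℝ => (∫ r in (0 : ℝ)..h, ψ r) - ∫ r in (0 : ℝ)..(h - 1), ψ r)
        (ψ 0 - ψ (-1)) 0 := by
    intro ψ cψ
    have e1 := intervalIntegral.integral_hasDerivAt_right (a := 0) (b := 0)
      (cψ.intervalIntegrable _ _) cψ.aestronglyMeasurable.stronglyMeasurableAtFilter
      cψ.continuousAt
    have e2 := intervalIntegral.integral_hasDerivAt_right (a := 0) (b := -1)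
      (cψ.intervalIntegrable _ _) cψ.aestronglyMeasurable.stronglyMeasurableAtFilter
      cψ.continuousAt
    have e3 : HasDerivAt (fun h : ℝ => h - 1) 1 0 := (hasDerivAt_id 0).sub_const 1
    have e4 := HasDerivAt.comp_of_eq (0 : ℝ) e2 e3 (by norm_num)
    simpa [Function.comp_def] using e1.fun_sub e4
  have d2 : HasDerivAt (fun h : ℝ => 1 / 2 - h) (-1) 0 := by
    exact (hasDerivAt_id (0 : ℝ)).const_sub (1 / 2)
  have d3 := (d2.fun_mul (d1 cφ)).fun_add (d1 (ψ := fun r => r * φ r) (by fun_prop))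
  convert d3 using 1
  have e5 : φ (-1) = φ 0 := by simpa using (hp (-1)).symm
  have e6 : avg i f x = ∫ r in (-1 : ℝ)..0, φ r := by
    have := hp.intervalIntegral_add_eq 0 (-1)
    simpa [avg] using this
  have e7 : f x = φ 0 := by simp [hφ]
  have e8 : (∫ r in (0 : ℝ)..(0 - 1), φ r) = - ∫ r in (-1 : ℝ)..0, φ r := by
    rw [intervalIntegral.integral_symm]; simp
  rw [e6, e7, e8, e5]
  simp
  ring

/-! ### The antidivergence -/

/-- Average over the coordinates of a list, one after the other. -/
noncomputable def avgList : List (Fin d) → (Torus d → ℝ) → Torus d → ℝ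
  | [], f => f
  | i :: l, f => avgList l (avg i f)

/-- The field whose divergence removes from `f` its averages over the coordinates of a list. -/
noncomputable def antidivList : List (Fin d) → (Torus d → ℝ) → Torus d → Fin d → ℝ
  | [], _ => fun _ _ => 0
  | i :: l, f => fun x k => (if k = i then prim i f x else 0) + antidivList l (avg i f) x k

lemma continuous_antidivList {X : Type*} [TopologicalSpace X] (l : List (Fin d)) :
    ∀ {f : X → Torus d → ℝ}, (Continuous fun z : X × Torus d => f z.1 z.2) → ∀ k,
      Continuous fun z : X × Torus d => antidivList l (f z.1) z.2 k := by
  induction l with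
  | nil => intro f _ k; exact continuous_const
  | cons i l ih =>
    intro f hf k
    simp only [antidivList]
    refine Continuous.add ?_ (ih (f := fun p => avg i (f p)) (continuous_avg i hf) k)
    split_ifs
    · exact continuous_prim i hf
    · exact continuous_const

lemma continuous_avg_slice (i : Fin d) {f : Torus d → ℝ} (hf : Continuous f) :
    Continuous (avg i f) :=
  (continuous_avg (X := Unit) i (f := fun _ => f) (hf.comp continuous_snd)).comp
    (Continuous.prodMk_right ())

lemma continuous_prim_slice (i : Fin d) {f : Torus d → ℝ} (hf : Continuous f) :
    Continuous (prim i f) :=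
  (continuous_prim (X := Unit) i (f := fun _ => f) (hf.comp continuous_snd)).comp
    (Continuous.prodMk_right ())

lemma continuous_antidivList_slice (l : List (Fin d)) {f : Torus d → ℝ} (hf : Continuous f)
    (k : Fin d) : Continuous fun x => antidivList l f x k :=
  (continuous_antidivList (X := Unit) l (f := fun _ => f) (hf.comp continuous_snd) k).comp
    (Continuous.prodMk_right ())

/-- Telescoping: each coordinate of the list removes the oscillation of `f` in that coordinate. As
`f` is only continuous, the `k`-th component need only have a partial derivative in the direction `k`,
which is what the divergence requires. -/
lemma hasPartial_antidivList (l : List (Fin d)) :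
    ∀ {f : Torus d → ℝ}, Continuous f → ∃ g : Fin d → Torus d → ℝ,
      (∀ k, Continuous (g k)) ∧ (∀ k, HasPartial k (fun x => antidivList l f x k) (g k)) ∧
      ∀ x, ∑ k, g k x = f x - avgList l f x := by
  induction l with
  | nil =>
    intro f _
    exact ⟨fun _ _ => 0, fun _ => continuous_const, fun _ => HasPartial.const 0,
      fun x => by simp [avgList]⟩
  | cons i l ih =>
    intro f hf
    obtain ⟨g, cg, hg, sg⟩ := ih (continuous_avg_slice i hf)
    refine ⟨fun k x => (if k = i then f x - avg i f x else 0) + g k x, fun k => ?_, fun k => ?_,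
      fun x => ?_⟩
    · refine Continuous.add ?_ (cg k)
      split_ifs
      · exact hf.sub (continuous_avg_slice i hf)
      · exact continuous_const
    · simp only [antidivList]
      refine HasPartial.add ?_ (hg k)
      split_ifs with h
      · subst h; exact hasPartial_prim k hf
      · exact HasPartial.const 0
    · rw [Finset.sum_add_distrib, sg]
      simp [avgList]

/-- The antidivergence is bounded in `L¹`, hence on the squares of the profiles uniformly in their
concentration. -/
lemma integral_abs_antidivList_le (l : List (Fin d)) :
    ∀ {f : Torus d → ℝ}, Continuous f → ∀ k,
      ∫ x, |antidivList l f x k| ≤ l.length * ∫ x, |f x| := by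
  induction l with
  | nil => intro f _ k; simp [antidivList]
  | cons i l ih =>
    intro f hf k
    have h1 : ∫ x, |antidivList (i :: l) f x k| ≤
        ∫ x, (|prim i f x| + |antidivList l (avg i f) x k|) := by
      have c1 := continuous_antidivList_slice (i :: l) hf k
      have c2 := continuous_antidivList_slice l (continuous_avg_slice i hf) k
      refine integral_mono (integrable_of_continuous c1.abs) (integrable_of_continuous
        ((continuous_prim_slice i hf).abs.add c2.abs)) fun x => ?_
      simp only [antidivList]
      refine (abs_add_le _ _).trans (add_le_add_left ?_ _)
      split_ifs
      · exact le_rfl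
      · simp
    rw [integral_add (integrable_of_continuous (continuous_prim_slice i hf).abs)
      (integrable_of_continuous (continuous_antidivList_slice l
        (continuous_avg_slice i hf) k).abs)] at h1
    have h2 := ih (continuous_avg_slice i hf) k
    have h3 := integral_abs_prim_le i hf
    have h4 := mul_le_mul_of_nonneg_left (integral_abs_avg_le i hf)
      (Nat.cast_nonneg (α := ℝ) l.length)
    push_cast [List.length_cons]
    linarith

lemma InvariantIn.antidivList {j : Fin d} (l : List (Fin d)) :
    ∀ {f : Torus d → ℝ}, InvariantIn j f → InvariantIn j (antidivList l f) := by
  induction l with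
  | nil => intro f _ x s; rfl
  | cons i l ih =>
    intro f hf x s
    ext k
    simp only [ContinuityEq.antidivList]
    rw [ih (hf.avg i) x s, hf.prim i x s]

lemma InvariantIn.avgList {j : Fin d} (l : List (Fin d)) :
    ∀ {f : Torus d → ℝ}, InvariantIn j f → InvariantIn j (avgList l f) := by
  induction l with
  | nil => intro f hf; exact hf
  | cons i l ih => intro f hf; exact ih (hf.avg i)

lemma invariantIn_avgList_of_mem {j : Fin d} (l : List (Fin d)) (hj : j ∈ l) :
    ∀ f : Torus d → ℝ, InvariantIn j (avgList l f) := by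
  induction l with
  | nil => simp at hj
  | cons i l ih =>
    intro f
    rcases List.mem_cons.1 hj with rfl | h
    · exact InvariantIn.avgList l (avg_add_single _ f)
    · exact ih h _

lemma integral_avgList (l : List (Fin d)) :
    ∀ {f : Torus d → ℝ}, Continuous f → ∫ x, avgList l f x = ∫ x, f x := by
  induction l with
  | nil => intro f _; rfl
  | cons i l ih =>
    intro f hf
    rw [avgList, ih (continuous_avg_slice i hf), integral_avg i hf]

lemma eq_const_of_invariantIn {β : Type*} {f : Torus d → β} (h : ∀ j, InvariantIn j f)
    (x : Torus d) : f x = f 0 := by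
  obtain ⟨y, rfl⟩ := proj_surjective x
  have key : ∀ s : Finset (Fin d), f (∑ i ∈ s, Pi.single i (y i : UnitAddCircle)) = f 0 := by
    intro s
    induction s using Finset.induction_on with
    | empty => simp
    | insert i s hi ih => rw [Finset.sum_insert hi, add_comm, h i, ih]
  rw [← key Finset.univ, Finset.univ_sum_single]
  rfl

lemma avgList_finRange {f : Torus d → ℝ} (hf : Continuous f) (x : Torus d) :
    avgList (List.finRange d) f x = ∫ y, f y := by
  rw [← integral_avgList (List.finRange d) hf]
  have h := eq_const_of_invariantIn
    (fun j => invariantIn_avgList_of_mem (List.finRange d) (List.mem_finRange j) f)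
  rw [h x]
  simp_rw [h]
  simp

lemma antidivList_zero (l : List (Fin d)) : antidivList l (fun _ => 0) = fun _ _ => 0 := by
  induction l with
  | nil => rfl
  | cons i l ih =>
    have h1 : prim i (fun _ : Torus d => (0 : ℝ)) = fun _ => 0 := by ext x; simp [prim]
    have h2 : avg i (fun _ : Torus d => (0 : ℝ)) = fun _ => 0 := by ext x; simp [avg]
    simp [antidivList, h1, h2, ih]

/-- A continuous vector field whose divergence is `f - ∫ f`, with `L¹` norm controlled by the one
of `f`. -/
noncomputable def antidiv (f : Torus d → ℝ) : Torus d → Fin d → ℝ :=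
  antidivList (List.finRange d) f

/-! ### Composition with dilations of the torus -/

lemma measurePreserving_nsmul_sub {n : ℕ} (hn : n ≠ 0) (a : Torus d) :
    MeasurePreserving (fun x : Torus d => n • x - a) := by
  have h1 : MeasurePreserving (nsmulAddMonoidHom n : Torus d →+ Torus d) := by
    refine AddMonoidHom.measurePreserving ?_ ?_ rfl
    · exact continuous_nsmul n
    · intro x
      obtain ⟨y, rfl⟩ := proj_surjective x
      refine ⟨proj ((n : ℝ)⁻¹ • y), ?_⟩
      simp only [nsmulAddMonoidHom_apply, ← proj_nsmul]
      congr 1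
      ext i
      simp [hn]
  exact (measurePreserving_sub_right volume a).comp h1

lemma integral_comp_nsmul_sub {n : ℕ} (hn : n ≠ 0) (a : Torus d) {f : Torus d → ℝ}
    (hf : Continuous f) : ∫ x, f (n • x - a) = ∫ x, f x := by
  have h := measurePreserving_nsmul_sub hn a
  rw [← integral_map h.measurable.aemeasurable hf.aestronglyMeasurable, h.map_eq]

lemma norm_proj_le (y : Fin d → ℝ) : ‖proj y‖ ≤ ‖y‖ := by
  refine (pi_norm_le_iff_of_nonneg (norm_nonneg _)).2 fun i => ?_
  exact (QuotientAddGroup.norm_mk_le_norm).trans (norm_le_pi_norm y i)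

/-- If `g` oscillates fast enough, depending only on the modulus of continuity of `f`, the `L¹`
norm of the product is bounded by the product of the `L¹` norms up to a small error. -/
lemma exists_integral_abs_mul_le {f : ℝ → Torus d → ℝ}
    (hf : Continuous fun z : ℝ × Torus d => f z.1 z.2) {δ : ℝ} (hδ : 0 < δ) :
    ∃ N : ℕ, ∀ n ≥ N, ∀ g : Torus d → ℝ, Continuous g → ∀ t ∈ Icc (0 : ℝ) 1, ∀ a : Torus d,
      ∫ x, |f t x| * |g (n • x - a)| ≤ ((∫ x, |f t x|) + δ) * ∫ x, |g x| := by
  have hu := (isCompact_Icc.prod (isCompact_univ (X := Torus d))).uniformContinuousOn_of_continuous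
    (f := fun z : ℝ × Torus d => f z.1 z.2) (s := Icc (0 : ℝ) 1 ×ˢ univ) hf.continuousOn
  obtain ⟨η, hη, hu⟩ := Metric.uniformContinuousOn_iff.1 hu δ hδ
  obtain ⟨N, hN⟩ := exists_nat_gt (1 / η)
  have hN0 : 0 < (N : ℝ) := (by positivity : (0 : ℝ) < 1 / η).trans hN
  refine ⟨N, fun n hn g cg t ht a => ?_⟩
  have hnN : (N : ℝ) ≤ n := by exact_mod_cast hn
  have hn0 : (0 : ℝ) < n := hN0.trans_le hnN
  have hn0' : n ≠ 0 := by exact_mod_cast hn0.ne'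
  have cf : Continuous (f t) := hf.comp (Continuous.prodMk_right t)
  have step : ∀ s : Torus d, ∫ x, |f t x| * |g (n • x - a)| ≤
      ∫ x, (|f t x| + δ) * |g (s + (n • x - a))| := by
    intro s
    obtain ⟨y, hy, hyn⟩ : ∃ y : Fin d → ℝ, proj y = -s ∧ ‖y‖ ≤ 1 := by
      have : ∀ i, ∃ r : ℝ, (r : UnitAddCircle) = -s i ∧ |r| ≤ 1 := fun i => by
        obtain ⟨r, hr, h⟩ :=
          (AddCircle.coe_image_Icc_eq (p := (1 : ℝ)) 0).symm.subset (mem_univ (-s i))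
        exact ⟨r, h, abs_le.2 ⟨by linarith [hr.1], by linarith [hr.2]⟩⟩
      choose y h1 h2 using this
      exact ⟨y, funext h1, (pi_norm_le_iff_of_nonneg zero_le_one).2 h2⟩
    set z : Torus d := proj ((n : ℝ)⁻¹ • y) with hz
    have hzn : ‖z‖ < η := by
      refine (norm_proj_le _).trans_lt ?_
      rw [norm_smul, norm_inv, Real.norm_natCast]
      calc (n : ℝ)⁻¹ * ‖y‖ ≤ (n : ℝ)⁻¹ * 1 := by gcongr
        _ ≤ (N : ℝ)⁻¹ := by rw [mul_one]; gcongr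
        _ < η := by rw [inv_lt_comm₀ hN0 hη, ← one_div]; exact hN
    have hnz : n • z = -s := by
      rw [hz, ← proj_nsmul, ← hy]
      congr 1; ext i; simp [hn0']
    rw [← integral_sub_right_eq_self (fun x => |f t x| * |g (n • x - a)|) z]
    refine integral_mono (integrable_of_continuous ?_) (integrable_of_continuous ?_) fun x => ?_
    · exact (cf.comp (by fun_prop)).abs.mul (cg.comp (by fun_prop)).abs
    · exact (cf.abs.add continuous_const).mul (cg.comp (by fun_prop)).abs
    · have e1 : n • (x - z) - a = s + (n • x - a) := by rw [smul_sub, hnz]; abel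
      simp only [e1]
      refine mul_le_mul_of_nonneg_right ?_ (abs_nonneg _)
      have := hu (t, x - z) ⟨ht, mem_univ _⟩ (t, x) ⟨ht, mem_univ _⟩ (by
        rw [Prod.dist_eq, dist_self, dist_eq_norm]; simpa using hzn)
      rw [Real.dist_eq] at this
      have := (abs_sub_abs_le_abs_sub (f t (x - z)) (f t x)).trans this.le
      linarith
  have c2 : Continuous fun p : Torus d × Torus d =>
      (|f t p.2| + δ) * |g (p.1 + (n • p.2 - a))| :=
    ((cf.comp continuous_snd).abs.add continuous_const).mul (cg.comp (by fun_prop)).abs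
  calc ∫ x, |f t x| * |g (n • x - a)|
      = ∫ _ : Torus d, ∫ x, |f t x| * |g (n • x - a)| := by simp
    _ ≤ ∫ s : Torus d, ∫ x, (|f t x| + δ) * |g (s + (n • x - a))| := by
        refine integral_mono (integrable_const _) ?_ step
        exact (c2.integrable_of_hasCompactSupport
          (HasCompactSupport.of_compactSpace _)).integral_prod_left
    _ = ∫ x, ∫ s : Torus d, (|f t x| + δ) * |g (s + (n • x - a))| :=
        integral_integral_swap (c2.integrable_of_hasCompactSupport
          (HasCompactSupport.of_compactSpace _))
    _ = ((∫ x, |f t x|) + δ) * ∫ x, |g x| := by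
        simp_rw [integral_const_mul,
          integral_add_right_eq_self (μ := (volume : Measure (Torus d))) fun x => |g x|]
        rw [integral_mul_const, integral_add (integrable_of_continuous cf.abs)
          (integrable_const _)]
        simp

end ContinuityEq

namespace ContinuityEq

variable {d : ℕ}

/-! ### Concentrated periodic profiles in one variable -/

/-- The one-periodic function which is `ψ (μ y)` for `|y| ≤ 1/2`. -/
noncomputable def perFun (μ : ℝ) (ψ : ℝ → ℝ) (y : ℝ) : ℝ := ψ (μ * (y - round y))

lemma periodic_perFun (μ : ℝ) (ψ : ℝ → ℝ) : Function.Periodic (perFun μ ψ) 1 := by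
  intro y; simp [perFun]

/-- The function on the circle which is `ψ (μ y)` for `|y| ≤ 1/2`. -/
noncomputable def prof (μ : ℝ) (ψ : ℝ → ℝ) : UnitAddCircle → ℝ := (periodic_perFun μ ψ).lift

lemma prof_coe (μ : ℝ) (ψ : ℝ → ℝ) (y : ℝ) : prof μ ψ (y : UnitAddCircle) = perFun μ ψ y :=
  Function.Periodic.lift_coe _ y

/-- The function `ψ` vanishes outside `[-1/4, 1/4]`. -/
def QuarterSupported (ψ : ℝ → ℝ) : Prop := ∀ z, 1 / 4 < |z| → ψ z = 0

lemma QuarterSupported.deriv {ψ : ℝ → ℝ} (h : QuarterSupported ψ) :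
    QuarterSupported (deriv ψ) := by
  intro z hz
  have : ψ =ᶠ[nhds z] fun _ => 0 := by
    filter_upwards [(isOpen_lt continuous_const continuous_abs).mem_nhds hz] with w hw
    exact h w hw
  rw [this.deriv_eq]; simp

lemma perFun_eq {μ : ℝ} (hμ : 1 ≤ μ) {ψ : ℝ → ℝ} (hψ : QuarterSupported ψ) (n : ℤ) {y : ℝ}
    (hy : |y - n| < 3 / 4) : perFun μ ψ y = ψ (μ * (y - n)) := by
  unfold perFun
  by_cases hr : round y = n
  · rw [hr]
  have h1 : |y - round y| ≤ 1 / 2 := abs_sub_round y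
  have h2 : (1 : ℝ) ≤ |(round y : ℝ) - n| := by
    have : 1 ≤ |round y - n| := Int.one_le_abs (sub_ne_zero.2 hr)
    exact_mod_cast this
  have h3 : |(round y : ℝ) - n| ≤ |y - round y| + |y - n| := by
    rw [abs_sub_comm y (round y)]
    exact abs_sub_le _ _ _
  have big : ∀ w : ℝ, 1 / 4 < |w| → ψ (μ * w) = 0 := by
    intro w hw
    apply hψ
    rw [abs_mul, abs_of_pos (by linarith)]
    nlinarith
  rw [big _ (by linarith), big _ (by linarith)]

lemma perFun_eventuallyEq {μ : ℝ} (hμ : 1 ≤ μ) {ψ : ℝ → ℝ} (hψ : QuarterSupported ψ) (y : ℝ) :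
    perFun μ ψ =ᶠ[nhds y] fun z => ψ (μ * (z - round y)) := by
  have h1 : |y - round y| < 3 / 4 := (abs_sub_round y).trans_lt (by norm_num)
  filter_upwards [(isOpen_lt (by fun_prop : Continuous fun z : ℝ => |z - round y|)
    continuous_const).mem_nhds h1] with z hz
  exact perFun_eq hμ hψ _ hz

lemma contDiff_perFun {μ : ℝ} (hμ : 1 ≤ μ) {ψ : ℝ → ℝ} (hψ : QuarterSupported ψ)
    (sψ : ContDiff ℝ ∞ ψ) : ContDiff ℝ ∞ (perFun μ ψ) := by
  rw [contDiff_iff_contDiffAt]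
  intro y
  refine ContDiffAt.congr_of_eventuallyEq ?_ (perFun_eventuallyEq hμ hψ y)
  exact (sψ.comp (by fun_prop)).contDiffAt

lemma hasDerivAt_perFun {μ : ℝ} (hμ : 1 ≤ μ) {ψ : ℝ → ℝ} (hψ : QuarterSupported ψ)
    (sψ : ContDiff ℝ ∞ ψ) (y : ℝ) :
    HasDerivAt (perFun μ ψ) (μ * perFun μ (deriv ψ) y) y := by
  refine HasDerivAt.congr_of_eventuallyEq ?_ (perFun_eventuallyEq hμ hψ y)
  have h1 : HasDerivAt ψ (deriv ψ (μ * (y - round y))) (μ * (y - round y)) :=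
    (sψ.differentiable (by simp) _).hasDerivAt
  have h2 : HasDerivAt (fun z : ℝ => μ * (z - round y)) μ y := by
    simpa using ((hasDerivAt_id y).sub_const (round y : ℝ)).const_mul μ
  rw [mul_comm]
  exact h1.comp y h2

lemma integral_prof {μ : ℝ} (hμ : 1 ≤ μ) {ψ : ℝ → ℝ} (hψ : QuarterSupported ψ) :
    ∫ x, prof μ ψ x = μ⁻¹ * ∫ y, ψ y := by
  have hμ0 : 0 < μ := by linarith
  rw [← UnitAddCircle.intervalIntegral_preimage (-(1 / 2))]
  have h1 : ∀ y ∈ uIcc (-(1 / 2) : ℝ) (-(1 / 2) + 1), prof μ ψ (y : UnitAddCircle) = ψ (μ * y) := by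
    intro y hy
    rw [uIcc_of_le (by norm_num)] at hy
    rw [prof_coe, perFun_eq hμ hψ 0]
    · simp
    · rw [abs_lt]; constructor <;> simp <;> linarith [hy.1, hy.2]
  rw [intervalIntegral.integral_congr h1, intervalIntegral.integral_comp_mul_left _ hμ0.ne',
    smul_eq_mul, intervalIntegral.integral_eq_integral_of_support_subset]
  intro z hz
  have : |z| ≤ 1 / 4 := by
    by_contra h
    exact hz (hψ z (not_le.1 h))
  have := abs_le.1 this
  constructor
  · nlinarith
  · nlinarith

lemma prof_eq_zero {μ : ℝ} (hμ : 0 < μ) {ψ : ℝ → ℝ} (hψ : QuarterSupported ψ)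
    {x : UnitAddCircle} (hx : 1 / (4 * μ) < ‖x‖) : prof μ ψ x = 0 := by
  induction x using QuotientAddGroup.induction_on with
  | H y =>
    rw [prof_coe, perFun]
    apply hψ
    rw [UnitAddCircle.norm_eq] at hx
    rw [abs_mul, abs_of_pos hμ]
    rw [div_lt_iff₀ (by positivity)] at hx
    linarith

lemma abs_prof_le (μ : ℝ) {ψ : ℝ → ℝ} {C : ℝ} (h : ∀ z, |ψ z| ≤ C) (x : UnitAddCircle) :
    |prof μ ψ x| ≤ C := by
  induction x using QuotientAddGroup.induction_on with
  | H y => rw [prof_coe]; exact h _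

lemma prof_sq (μ : ℝ) (ψ : ℝ → ℝ) (x : UnitAddCircle) :
    prof μ ψ x ^ 2 = prof μ (fun z => ψ z ^ 2) x := by
  induction x using QuotientAddGroup.induction_on with
  | H y => rw [prof_coe, prof_coe]; rfl

/-- A smooth bump function supported in `[-1/4, 1/4]`. -/
noncomputable def bump : ContDiffBump (0 : ℝ) := ⟨1 / 8, 1 / 4, by norm_num, by norm_num⟩

/-- The `n`-th derivative of the bump function. -/
noncomputable def bumpD (n : ℕ) : ℝ → ℝ := iteratedDeriv n bump

lemma contDiff_bumpD (n : ℕ) : ContDiff ℝ ∞ (bumpD n) := by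
  unfold bumpD
  rw [iteratedDeriv_eq_iterate]
  exact ContDiff.iterate_deriv n bump.contDiff

lemma deriv_bumpD (n : ℕ) : deriv (bumpD n) = bumpD (n + 1) := by
  unfold bumpD; rw [iteratedDeriv_succ]

lemma quarterSupported_bumpD (n : ℕ) : QuarterSupported (bumpD n) := by
  induction n with
  | zero =>
    intro z hz
    simp only [bumpD, iteratedDeriv_zero]
    exact bump.zero_of_le_dist (by simpa [bump, Real.dist_eq] using hz.le)
  | succ n ih => rw [← deriv_bumpD]; exact ih.deriv

lemma QuarterSupported.hasCompactSupport {ψ : ℝ → ℝ} (h : QuarterSupported ψ) :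
    HasCompactSupport ψ :=
  HasCompactSupport.intro (isCompact_Icc (a := (-(1 / 4) : ℝ)) (b := 1 / 4)) fun z hz => h z (by
    by_contra hn
    exact hz (abs_le.1 (not_lt.1 hn)))

lemma exists_bound_bumpD (n : ℕ) : ∃ C, ∀ z, |bumpD n z| ≤ C :=
  (quarterSupported_bumpD n).hasCompactSupport.exists_bound_of_continuous
    (contDiff_bumpD n).continuous

lemma integral_bumpD_sq_pos {n : ℕ} (hn : ∃ z, bumpD n z ≠ 0) : 0 < ∫ z, bumpD n z ^ 2 := by
  obtain ⟨z, hz⟩ := hn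
  have h : QuarterSupported fun z => bumpD n z ^ 2 := fun z hz => by
    simp [quarterSupported_bumpD n z hz]
  exact ((contDiff_bumpD n).continuous.pow 2).integral_pos_of_hasCompactSupport_nonneg_nonzero
    h.hasCompactSupport (fun z => sq_nonneg _) (x := z) (by simpa using hz)

lemma bumpD_zero_ne : bumpD 0 0 ≠ 0 := by
  simp only [bumpD, iteratedDeriv_zero]
  rw [bump.one_of_mem_closedBall (by simp [bump])]
  norm_num

lemma exists_bumpD_one_ne : ∃ z, bumpD 1 z ≠ 0 := by
  by_contra! h
  have h1 : ∀ z, deriv (bumpD 0) z = 0 := by rw [deriv_bumpD]; exact h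
  have h2 := is_const_of_deriv_eq_zero ((contDiff_bumpD 0).differentiable (by simp)) h1 0 1
  rw [quarterSupported_bumpD 0 1 (by norm_num)] at h2
  exact bumpD_zero_ne h2

/-! ### Profiles concentrated near lines -/

/-- The product over the coordinates `l ≠ j` of the rescaled `k l`-th derivatives of the bump
function. It is concentrated in a `1/μ` neighbourhood of a line in the direction `j`. -/
noncomputable def tube (j : Fin d) (μ : ℝ) (k : Fin d → ℕ) (x : Torus d) : ℝ :=
  ∏ l ∈ Finset.univ.erase j, prof μ (bumpD (k l)) (x l)

lemma smoothTorus_tube (j : Fin d) {μ : ℝ} (hμ : 1 ≤ μ) (k : Fin d → ℕ) :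
    SmoothTorus (tube j μ k) := by
  unfold SmoothTorus tube
  refine contDiff_prod fun l _ => ?_
  have : (fun y : Fin d → ℝ => prof μ (bumpD (k l)) (proj y l)) =
      perFun μ (bumpD (k l)) ∘ fun y => y l := by
    ext y; exact prof_coe _ _ _
  rw [this]
  exact (contDiff_perFun hμ (quarterSupported_bumpD _) (contDiff_bumpD _)).comp (by fun_prop)

lemma invariantIn_tube (j : Fin d) (μ : ℝ) (k : Fin d → ℕ) : InvariantIn j (tube j μ k) := by
  intro x s
  refine Finset.prod_congr rfl fun l hl => ?_
  have : l ≠ j := Finset.ne_of_mem_erase hl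
  simp [this]

lemma hasPartial_tube {j i : Fin d} (hij : i ≠ j) {μ : ℝ} (hμ : 1 ≤ μ) (k : Fin d → ℕ) :
    HasPartial i (tube j μ k) (fun x => μ * tube j μ (k + Pi.single i 1) x) := by
  intro x
  have hi : i ∈ Finset.univ.erase j := Finset.mem_erase.2 ⟨hij, Finset.mem_univ _⟩
  have h1 : ∀ (k : Fin d → ℕ) (x : Torus d), tube j μ k x = prof μ (bumpD (k i)) (x i) *
      ∏ l ∈ (Finset.univ.erase j).erase i, prof μ (bumpD (k l)) (x l) := fun k x =>
    (Finset.mul_prod_erase _ _ hi).symm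
  have h2 : ∀ s : ℝ, tube j μ k (x + Pi.single i (s : UnitAddCircle)) =
      prof μ (bumpD (k i)) (x i + s) *
        ∏ l ∈ (Finset.univ.erase j).erase i, prof μ (bumpD (k l)) (x l) := by
    intro s
    rw [h1]
    congr 1
    · simp
    · refine Finset.prod_congr rfl fun l hl => ?_
      simp [Finset.ne_of_mem_erase hl]
  have h3 : (∏ l ∈ (Finset.univ.erase j).erase i, prof μ (bumpD (k l)) (x l)) =
      ∏ l ∈ (Finset.univ.erase j).erase i,
        prof μ (bumpD ((k + Pi.single i 1 : Fin d → ℕ) l)) (x l) := by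
    refine Finset.prod_congr rfl fun l hl => ?_
    simp [Finset.ne_of_mem_erase hl]
  simp_rw [h2]
  rw [h1, ← h3, ← mul_assoc]
  refine HasDerivAt.mul_const ?_ _
  obtain ⟨y, hy⟩ : ∃ y : ℝ, (y : UnitAddCircle) = x i := QuotientAddGroup.mk_surjective (x i)
  rw [← hy, prof_coe]
  have h4 : ∀ s : ℝ, prof μ (bumpD (k i)) ((y : UnitAddCircle) + s) =
      perFun μ (bumpD (k i)) (y + s) := fun s => by rw [← AddCircle.coe_add, prof_coe]
  simp_rw [h4]
  have h5 := hasDerivAt_perFun hμ (quarterSupported_bumpD (k i)) (contDiff_bumpD (k i)) (y + 0)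
  have h6 : HasDerivAt (fun s : ℝ => y + s) 1 0 := (hasDerivAt_id (0 : ℝ)).const_add y
  have h7 := h5.comp 0 h6
  simpa [deriv_bumpD, Function.comp_def] using h7

lemma abs_tube_le (j : Fin d) (μ : ℝ) {C : ℝ} (hC1 : 1 ≤ C) {k : Fin d → ℕ}
    (hC : ∀ l z, |bumpD (k l) z| ≤ C) (x : Torus d) : |tube j μ k x| ≤ C ^ d := by
  unfold tube
  rw [Finset.abs_prod]
  calc ∏ l ∈ Finset.univ.erase j, |prof μ (bumpD (k l)) (x l)|
      ≤ ∏ _l ∈ Finset.univ.erase j, C :=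
        Finset.prod_le_prod (fun _ _ => abs_nonneg _) fun l _ => abs_prof_le μ (hC l) _
    _ = C ^ (d - 1) := by simp
    _ ≤ C ^ d := pow_le_pow_right₀ hC1 (Nat.sub_le _ _)

/-- The support of the tubes of width `1/μ`. -/
def tubeSet (j : Fin d) (μ : ℝ) : Set (Torus d) :=
  univ.pi fun l => if l = j then univ else Metric.closedBall 0 (1 / (4 * μ))

lemma measurableSet_tubeSet (j : Fin d) (μ : ℝ) : MeasurableSet (tubeSet j μ) := by
  refine MeasurableSet.univ_pi fun l => ?_
  split_ifs
  · exact MeasurableSet.univ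
  · exact Metric.isClosed_closedBall.measurableSet

lemma volume_tubeSet_le (j : Fin d) {μ : ℝ} (hμ : 1 ≤ μ) :
    volume (tubeSet j μ) ≤ ENNReal.ofReal (μ⁻¹ ^ (d - 1)) := by
  have hμ0 : 0 < μ := by linarith
  rw [tubeSet, volume_pi, Measure.pi_pi, ← Finset.mul_prod_erase _ _ (Finset.mem_univ j)]
  rw [if_pos rfl, UnitAddCircle.measure_univ, one_mul]
  calc ∏ l ∈ Finset.univ.erase j, volume (if l = j then univ
          else Metric.closedBall (0 : UnitAddCircle) (1 / (4 * μ)))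
      ≤ ∏ _l ∈ Finset.univ.erase j, ENNReal.ofReal μ⁻¹ := by
        refine Finset.prod_le_prod' fun l hl => ?_
        rw [if_neg (Finset.ne_of_mem_erase hl), AddCircle.volume_closedBall]
        apply ENNReal.ofReal_le_ofReal
        refine (min_le_right _ _).trans ?_
        rw [← one_div, mul_one_div, div_le_div_iff₀ (by positivity) hμ0]
        linarith
    _ = ENNReal.ofReal (μ⁻¹ ^ (d - 1)) := by
        rw [Finset.prod_const, ENNReal.ofReal_pow (by positivity)]; simp

lemma tube_eq_zero (j : Fin d) {μ : ℝ} (hμ : 0 < μ) (k : Fin d → ℕ) {x : Torus d}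
    (hx : x ∉ tubeSet j μ) : tube j μ k x = 0 := by
  simp only [tubeSet, mem_univ_pi, not_forall] at hx
  obtain ⟨l, hl⟩ := hx
  by_cases h : l = j
  · simp [h] at hl
  rw [if_neg h, mem_closedBall_zero_iff, not_le] at hl
  exact Finset.prod_eq_zero (Finset.mem_erase.2 ⟨h, Finset.mem_univ _⟩)
    (prof_eq_zero hμ (quarterSupported_bumpD _) hl)

lemma integral_tube_sq (j : Fin d) {μ : ℝ} (hμ : 1 ≤ μ) (k : Fin d → ℕ) :
    ∫ x, tube j μ k x ^ 2 = ∏ l ∈ Finset.univ.erase j, (μ⁻¹ * ∫ z, bumpD (k l) z ^ 2) := by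
  have h1 : ∀ x : Torus d, tube j μ k x ^ 2 =
      ∏ l, (fun y : UnitAddCircle => if l = j then 1 else prof μ (fun z => bumpD (k l) z ^ 2) y)
        (x l) := by
    intro x
    rw [tube, ← Finset.prod_pow, ← Finset.mul_prod_erase _ _ (Finset.mem_univ j)]
    simp only [if_true, one_mul]
    refine Finset.prod_congr rfl fun l hl => ?_
    rw [if_neg (Finset.ne_of_mem_erase hl), prof_sq]
  simp_rw [h1]
  rw [integral_fintype_prod_volume_eq_prod (𝕜 := ℝ) fun l (y : UnitAddCircle) =>
      if l = j then (1 : ℝ) else prof μ (fun z => bumpD (k l) z ^ 2) y,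
    ← Finset.mul_prod_erase _ _ (Finset.mem_univ j)]
  have h2 : ∫ _x : UnitAddCircle, (1 : ℝ) = 1 := by simp [Measure.real]
  simp only [if_true, h2, one_mul]
  refine Finset.prod_congr rfl fun l hl => ?_
  simp only [if_neg (Finset.ne_of_mem_erase hl)]
  exact integral_prof hμ fun z hz => by simp [quarterSupported_bumpD (k l) z hz]

lemma eLpNorm_le_of_bound_of_support {f : Torus d → ℝ} {S : Set (Torus d)} (hS : MeasurableSet S)
    {C : ℝ} (hC : ∀ x, |f x| ≤ C) (h0 : ∀ x ∉ S, f x = 0) (p : ℝ≥0∞) :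
    eLpNorm f p volume ≤ volume S ^ p.toReal⁻¹ * ENNReal.ofReal C := by
  have h : S.indicator f = f := indicator_eq_self.2 fun x hx => by
    by_contra hn
    exact hx (h0 x hn)
  rw [← h, eLpNorm_indicator_eq_eLpNorm_restrict hS]
  refine (eLpNorm_le_of_ae_bound (C := C) (Filter.Eventually.of_forall hC)).trans ?_
  simp

/-- The estimates on the potential `q` of the building block in the direction `j` which lies in
the plane of the directions `j` and `m`; the density profile is `A ∂_m q`. -/
structure IsProfile (j m : Fin d) (M δ : ℝ) (p : ℝ≥0∞) (q : Torus d → ℝ) (A : ℝ) : Prop where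
  smooth : SmoothTorus q
  invariant : InvariantIn j q
  bound : ∀ x, |q x| ≤ M
  bound_deriv : ∀ x, |pderiv m q x| ≤ M
  small : eLpNorm q p volume ≤ ENNReal.ofReal δ
  small_deriv : ∀ i, eLpNorm (pderiv i q) p volume ≤ ENNReal.ofReal δ
  small_deriv_deriv : ∀ i, eLpNorm (pderiv i (pderiv m q)) p volume ≤ ENNReal.ofReal δ
  pos : 0 < A
  integral_le : A * ∫ x, |q x| ≤ M
  integral_deriv_le : A * ∫ x, |pderiv m q x| ≤ M
  normalized : A * ∫ x, pderiv m q x ^ 2 = 1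

/-- Profiles exist with a constant `M` depending only on the dimension: the amplitudes are bounded,
and the gradient scales like `μ`, on a set of measure `μ ^ (1 - d)`. -/
lemma exists_profile (d : ℕ) : ∃ M : ℝ, 0 < M ∧ ∀ j m : Fin d, m ≠ j → ∀ p : ℝ≥0∞, 1 ≤ p →
    p < (d : ℝ≥0∞) - 1 → ∀ δ : ℝ, 0 < δ → ∃ q A, IsProfile j m M δ p q A := by
  obtain ⟨C0, hC0⟩ := exists_bound_bumpD 0
  obtain ⟨C1, hC1⟩ := exists_bound_bumpD 1
  obtain ⟨C2, hC2⟩ := exists_bound_bumpD 2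
  obtain ⟨C, hC, h1C, hC0C, hC1C, hC2C⟩ : ∃ C : ℝ, 0 < C ∧ 1 ≤ C ∧ C0 ≤ C ∧ C1 ≤ C ∧ C2 ≤ C :=
    ⟨max 1 (max C0 (max C1 C2)), by positivity, by simp, by simp, by simp, by simp⟩
  have hbd : ∀ n ≤ 2, ∀ z, |bumpD n z| ≤ C := by
    intro n hn z
    interval_cases n
    · exact (hC0 z).trans hC0C
    · exact (hC1 z).trans hC1C
    · exact (hC2 z).trans hC2C
  obtain ⟨c, hc, hcle⟩ : ∃ c : ℝ, 0 < c ∧ ∀ n ≤ 1, c ≤ ∫ z, bumpD n z ^ 2 := by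
    refine ⟨min (∫ z, bumpD 0 z ^ 2) (∫ z, bumpD 1 z ^ 2),
      lt_min (integral_bumpD_sq_pos ⟨0, bumpD_zero_ne⟩) (integral_bumpD_sq_pos exists_bumpD_one_ne),
      fun n hn => ?_⟩
    interval_cases n
    · exact min_le_left _ _
    · exact min_le_right _ _
  have hMC : C ^ d ≤ C ^ d * (1 + c⁻¹ ^ (d - 1)) :=
    le_mul_of_one_le_right (by positivity) (le_add_of_nonneg_right (by positivity))
  refine ⟨C ^ d * (1 + c⁻¹ ^ (d - 1)), by positivity, ?_⟩
  intro j m hmj p hp hpd δ hδ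
  have hp_top : p ≠ ⊤ := (hpd.trans_le le_top).ne
  have hp0 : 0 < p.toReal := ENNReal.toReal_pos (by positivity) hp_top
  have hd1 : p.toReal < (d - 1 : ℕ) := by
    have : p < ((d - 1 : ℕ) : ℝ≥0∞) := by push_cast; exact hpd
    have := (ENNReal.toReal_lt_toReal hp_top (by simp)).2 this
    rwa [ENNReal.toReal_natCast] at this
  -- the exponent `(d - 1) / p` of the measure of the tube exceeds the exponent `1` of the gradient
  obtain ⟨μ, hμ, hsmall⟩ : ∃ μ : ℝ, 1 ≤ μ ∧
      C ^ d * (μ * (μ⁻¹ ^ (d - 1)) ^ p.toReal⁻¹) ≤ δ := by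
    have h1 : Filter.Tendsto (fun μ : ℝ => C ^ d * μ ^ (-(((d - 1 : ℕ) : ℝ) * p.toReal⁻¹ - 1)))
        Filter.atTop (nhds (C ^ d * 0)) := by
      refine (tendsto_rpow_neg_atTop ?_).const_mul _
      rw [sub_pos, ← div_eq_mul_inv, one_lt_div hp0]
      exact hd1
    rw [mul_zero] at h1
    obtain ⟨μ, h2, h3⟩ := ((h1.eventually (ge_mem_nhds hδ)).and
      (Filter.eventually_ge_atTop (1 : ℝ))).exists
    refine ⟨μ, h3, le_trans (le_of_eq ?_) h2⟩
    have hμ0 : 0 < μ := by linarith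
    congr 1
    rw [neg_sub, Real.rpow_sub hμ0, Real.rpow_one, inv_pow, Real.inv_rpow (by positivity),
      ← Real.rpow_natCast μ (d - 1), ← Real.rpow_mul hμ0.le]
    rfl
  have hμ0 : 0 < μ := by linarith
  have e0 : ∀ i, HasPartial i (fun x => μ⁻¹ * tube j μ 0 x)
      (fun x => if i = j then 0 else tube j μ (Pi.single i 1) x) := by
    intro i
    by_cases h : i = j
    · subst h
      simp only [if_true]
      refine HasPartial.of_invariant fun x s => ?_
      rw [invariantIn_tube i μ 0 x s]
    · simp only [if_neg h]
      have := (hasPartial_tube h hμ 0).const_mul μ⁻¹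
      simpa [hμ0.ne'] using this
  have e1 : ∀ i, HasPartial i (tube j μ (Pi.single m 1))
      (fun x => if i = j then 0 else μ * tube j μ (Pi.single m 1 + Pi.single i 1) x) := by
    intro i
    by_cases h : i = j
    · subst h
      simp only [if_true]
      exact HasPartial.of_invariant (invariantIn_tube i μ _)
    · simp only [if_neg h]
      exact hasPartial_tube h hμ _
  have em : pderiv m (fun x => μ⁻¹ * tube j μ 0 x) = tube j μ (Pi.single m 1) := by
    rw [(e0 m).pderiv_eq]; simp [hmj]
  have b0 : ∀ x : Torus d, |tube j μ 0 x| ≤ C ^ d := abs_tube_le j μ h1C fun l => hbd _ (by simp)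
  have b1 : ∀ i (x : Torus d), |tube j μ (Pi.single i 1) x| ≤ C ^ d := fun i =>
    abs_tube_le j μ h1C fun l => hbd _ (by
      rw [Pi.single_apply]; split_ifs <;> norm_num)
  have b2 : ∀ i (x : Torus d), |tube j μ (Pi.single m 1 + Pi.single i 1) x| ≤ C ^ d := fun i =>
    abs_tube_le j μ h1C fun l => hbd _ (by
      rw [Pi.add_apply, Pi.single_apply, Pi.single_apply]; split_ifs <;> norm_num)
  have bq : ∀ x : Torus d, |μ⁻¹ * tube j μ 0 x| ≤ C ^ d := fun x => by
    rw [abs_mul, abs_of_pos (by positivity)]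
    exact (mul_le_of_le_one_left (abs_nonneg _) (inv_le_one_of_one_le₀ hμ)).trans (b0 x)
  -- every function bounded by `C ^ d * μ` and supported in the tube is small in `L ^ p`
  have hLp : ∀ f : Torus d → ℝ, (∀ x, |f x| ≤ C ^ d * μ) → (∀ x ∉ tubeSet j μ, f x = 0) →
      eLpNorm f p volume ≤ ENNReal.ofReal δ := by
    intro f hf h0
    refine (eLpNorm_le_of_bound_of_support (measurableSet_tubeSet j μ) hf h0 p).trans ?_
    calc volume (tubeSet j μ) ^ p.toReal⁻¹ * ENNReal.ofReal (C ^ d * μ)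
        ≤ ENNReal.ofReal (μ⁻¹ ^ (d - 1)) ^ p.toReal⁻¹ * ENNReal.ofReal (C ^ d * μ) := by
          gcongr
          exact volume_tubeSet_le j hμ
      _ = ENNReal.ofReal (C ^ d * (μ * (μ⁻¹ ^ (d - 1)) ^ p.toReal⁻¹)) := by
          rw [ENNReal.ofReal_rpow_of_pos (by positivity), ← ENNReal.ofReal_mul (by positivity)]
          congr 1; ring
      _ ≤ ENNReal.ofReal δ := ENNReal.ofReal_le_ofReal hsmall
  have hCμ : C ^ d ≤ C ^ d * μ := le_mul_of_one_le_right (by positivity) hμ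
  have hI : (μ⁻¹ * c) ^ (d - 1) ≤ ∫ x, tube j μ (Pi.single m 1) x ^ 2 := by
    rw [integral_tube_sq j hμ]
    calc (μ⁻¹ * c) ^ (d - 1) = ∏ _l ∈ Finset.univ.erase j, (μ⁻¹ * c) := by simp
      _ ≤ _ := by
        refine Finset.prod_le_prod (fun _ _ => by positivity) fun l _ => ?_
        refine mul_le_mul_of_nonneg_left (hcle _ ?_) (by positivity)
        rw [Pi.single_apply]; split_ifs <;> norm_num
  have hI0 : 0 < ∫ x, tube j μ (Pi.single m 1) x ^ 2 := lt_of_lt_of_le (by positivity) hI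
  have hL1 : ∀ f : Torus d → ℝ, (∀ x, |f x| ≤ C ^ d) → (∀ x ∉ tubeSet j μ, f x = 0) →
      (∫ x, tube j μ (Pi.single m 1) x ^ 2)⁻¹ * ∫ x, |f x| ≤ C ^ d * (1 + c⁻¹ ^ (d - 1)) := by
    intro f hf h0
    have h1 : ∫ x, |f x| ≤ C ^ d * μ⁻¹ ^ (d - 1) := by
      have h2 : ∫ x, |f x| = ∫ x in tubeSet j μ, |f x| :=
        (setIntegral_eq_integral_of_forall_compl_eq_zero fun x hx => by simp [h0 x hx]).symm
      rw [h2]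
      have h3 := norm_setIntegral_le_of_norm_le_const (μ := (volume : Measure (Torus d)))
        (s := tubeSet j μ) (f := fun x => |f x|) (C := C ^ d) (measure_lt_top _ _)
        (fun x _ => by simpa using hf x)
      have h4 : volume.real (tubeSet j μ) ≤ μ⁻¹ ^ (d - 1) :=
        ENNReal.toReal_le_of_le_ofReal (by positivity) (volume_tubeSet_le j hμ)
      refine (le_abs_self _).trans (h3.trans ?_)
      gcongr
    calc (∫ x, tube j μ (Pi.single m 1) x ^ 2)⁻¹ * ∫ x, |f x|
        ≤ ((μ⁻¹ * c) ^ (d - 1))⁻¹ * (C ^ d * μ⁻¹ ^ (d - 1)) := by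
          gcongr
      _ = C ^ d * c⁻¹ ^ (d - 1) := by
          rw [mul_pow, mul_inv, inv_pow, inv_pow, inv_inv]; field_simp
      _ ≤ C ^ d * (1 + c⁻¹ ^ (d - 1)) := by
          gcongr; linarith
  refine ⟨fun x => μ⁻¹ * tube j μ 0 x, (∫ x, tube j μ (Pi.single m 1) x ^ 2)⁻¹, ?_, ?_, ?_, ?_, ?_,
    ?_, ?_, ?_, ?_, ?_, ?_⟩
  · exact contDiff_const.mul (smoothTorus_tube j hμ 0)
  · intro x s
    simp only [invariantIn_tube j μ 0 x s]
  · exact fun x => (bq x).trans hMC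
  · rw [em]; exact fun x => (b1 m x).trans hMC
  · exact hLp _ (fun x => (bq x).trans hCμ) fun x hx => by rw [tube_eq_zero j hμ0 _ hx, mul_zero]
  · intro i
    rw [(e0 i).pderiv_eq]
    refine hLp _ (fun x => ?_) fun x hx => ?_
    · split_ifs
      · simp; positivity
      · exact (b1 i x).trans hCμ
    · rw [tube_eq_zero j hμ0 _ hx, ite_self]
  · intro i
    rw [em, (e1 i).pderiv_eq]
    refine hLp _ (fun x => ?_) fun x hx => ?_
    · split_ifs
      · simp; positivity
      · rw [abs_mul, abs_of_pos hμ0, mul_comm]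
        gcongr
        exact b2 i x
    · rw [tube_eq_zero j hμ0 _ hx, mul_zero, ite_self]
  · positivity
  · exact hL1 _ bq fun x hx => by rw [tube_eq_zero j hμ0 _ hx, mul_zero]
  · rw [em]; exact hL1 _ (b1 m) fun x hx => tube_eq_zero j hμ0 _ hx
  · rw [em]; exact inv_mul_cancel₀ hI0.ne'

end ContinuityEq

namespace ContinuityEq

variable {d : ℕ}

/-! ### Subsolutions and their perturbations -/

/-- The space-time direction of the `k`-th coordinate of the torus. -/
def eDir (k : Fin d) : ℝ × (Fin d → ℝ) := (0, Pi.single k 1)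

/-- `(ρ, u)` solves `∂_t ρ + div (ρ u) = div R` and `div u = 0` in the sense of distributions on
`(0,1) × 𝕋^d`, and all three are continuous. The fields are given by their components. -/
structure IsSub (ρ : ℝ → Torus d → ℝ) (u R : Fin d → ℝ → Torus d → ℝ) : Prop where
  cont_density : Continuous fun z : ℝ × Torus d => ρ z.1 z.2
  cont_velocity : ∀ k, Continuous fun z : ℝ × Torus d => u k z.1 z.2
  cont_defect : ∀ k, Continuous fun z : ℝ × Torus d => R k z.1 z.2
  continuity : ∀ φ : ℝ → Torus d → ℝ, IsTestFunction φ →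
    ∫ z : ℝ × Torus d, (ρ z.1 z.2 * dirDeriv (1, 0) φ z.1 z.2 +
      ∑ k, ρ z.1 z.2 * u k z.1 z.2 * dirDeriv (eDir k) φ z.1 z.2) ∂(spaceTime d) =
    ∫ z : ℝ × Torus d, (∑ k, R k z.1 z.2 * dirDeriv (eDir k) φ z.1 z.2) ∂(spaceTime d)
  incompressible : ∀ φ : ℝ → Torus d → ℝ, IsTestFunction φ →
    ∫ z : ℝ × Torus d, (∑ k, u k z.1 z.2 * dirDeriv (eDir k) φ z.1 z.2) ∂(spaceTime d) = 0

lemma SmoothTorus.smoothOn {f : Torus d → ℝ} (hf : SmoothTorus f) :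
    SmoothOn univ (fun (_ : ℝ) x => f x) :=
  smoothOn_univ_iff.2 (ContDiff.comp (g := fun y => f (proj y)) hf contDiff_snd)

lemma SmoothTorus.continuous {f : Torus d → ℝ} (hf : SmoothTorus f) : Continuous f :=
  hf.smoothOn.continuous_slice 0

lemma SmoothTorus.hasPartial {f : Torus d → ℝ} (hf : SmoothTorus f) (i : Fin d) :
    HasPartial i f (pderiv i f) := by
  have h := hf.smoothOn.hasPartial i 0
  rwa [← h.pderiv_eq] at h

lemma SmoothTorus.pderiv {f : Torus d → ℝ} (hf : SmoothTorus f) (i : Fin d) :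
    SmoothTorus (pderiv i f) := by
  have h := (hf.smoothOn.dirDeriv (0, Pi.single i 1)).contDiff
  have h2 : ContDiff ℝ ∞ fun y : Fin d → ℝ => ((0 : ℝ), y) := by fun_prop
  have h3 := h.comp h2
  have h4 := hf.smoothOn.pderiv_eq i 0
  unfold SmoothTorus
  rw [h4]
  exact h3

/-- The rescaled profile `f (n x - n t c)`, oscillating in space and travelling with velocity
`c`. -/
noncomputable def osc (n : ℕ) (c : Fin d → ℝ) (f : Torus d → ℝ) (t : ℝ) (x : Torus d) : ℝ :=
  f (n • x - proj ((n * t) • c))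

lemma smoothOn_osc (n : ℕ) (c : Fin d → ℝ) {f : Torus d → ℝ} (hf : SmoothTorus f) :
    SmoothOn univ (osc n c f) := SmoothOn.travelling hf n c

lemma continuous_osc (n : ℕ) (c : Fin d → ℝ) {f : Torus d → ℝ} (hf : Continuous f) :
    Continuous fun z : ℝ × Torus d => osc n c f z.1 z.2 := by
  unfold osc
  exact hf.comp ((by fun_prop : Continuous fun z : ℝ × Torus d => n • z.2).sub
    (continuous_proj.comp (by fun_prop)))

lemma hasPartial_osc (n : ℕ) (c : Fin d → ℝ) {f f' : Torus d → ℝ} {i : Fin d}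
    (hf : HasPartial i f f') (t : ℝ) :
    HasPartial i (osc n c f t) (fun x => n * osc n c f' t x) :=
  hf.comp_nsmul_sub n _

lemma dirDeriv_osc (n : ℕ) (c : Fin d → ℝ) {f : Torus d → ℝ} (hf : SmoothTorus f) (i : Fin d)
    (t : ℝ) (x : Torus d) :
    dirDeriv (eDir i) (osc n c f) t x = n * osc n c (pderiv i f) t x := by
  have h1 := ((smoothOn_osc n c hf).hasPartial i t).pderiv_eq
  have h2 := (hasPartial_osc n c (hf.hasPartial i) t).pderiv_eq
  rw [h1] at h2
  exact congrFun h2 x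

lemma integral_abs_osc {n : ℕ} (hn : n ≠ 0) (c : Fin d → ℝ) {f : Torus d → ℝ} (hf : Continuous f)
    (t : ℝ) : ∫ x, |osc n c f t x| = ∫ x, |f x| :=
  integral_comp_nsmul_sub hn _ hf.abs

lemma eLpNorm_osc {n : ℕ} (hn : n ≠ 0) (c : Fin d → ℝ) {f : Torus d → ℝ} (hf : Continuous f)
    (t : ℝ) (p : ℝ≥0∞) : eLpNorm (osc n c f t) p volume = eLpNorm f p volume :=
  eLpNorm_comp_measurePreserving hf.aestronglyMeasurable (measurePreserving_nsmul_sub hn _)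

/-- The potential `n⁻¹ b q(n x - n t c)` of the perturbations. -/
noncomputable def potential (n : ℕ) (c : Fin d → ℝ) (q : Torus d → ℝ) (b : ℝ → Torus d → ℝ)
    (t : ℝ) (x : Torus d) : ℝ :=
  (n : ℝ)⁻¹ * (b t x * osc n c q t x)

/-- The perturbation of the density: a derivative of the potential, hence of mean zero. -/
noncomputable def pertDensity (n : ℕ) (c : Fin d → ℝ) (m : Fin d) (q : Torus d → ℝ) (A : ℝ)
    (a : ℝ → Torus d → ℝ) (t : ℝ) (x : Torus d) : ℝ :=
  A * dirDeriv (eDir m) (potential n c q a) t x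

/-- The perturbation of the velocity: a rotated gradient of the potential in the plane of the
directions `j` and `m`, hence divergence-free. -/
noncomputable def pertVelocity (n : ℕ) (c : Fin d → ℝ) (j m : Fin d) (q : Torus d → ℝ)
    (β : ℝ → Torus d → ℝ) (k : Fin d) (t : ℝ) (x : Torus d) : ℝ :=
  (if k = j then dirDeriv (eDir m) (potential n c q β) t x else 0) +
    (if k = m then -dirDeriv (eDir j) (potential n c q β) t x else 0)

/-- The field `B` with `div B = A (∂_m q)² - 1`. -/
noncomputable def correctorField (m : Fin d) (q : Torus d → ℝ) (A : ℝ) (k : Fin d) (x : Torus d) :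
    ℝ :=
  antidiv (fun x => A * pderiv m q x ^ 2) x k

/-- The part of the new defect which is small in `L¹`. -/
noncomputable def pertError (ρ : ℝ → Torus d → ℝ) (u : Fin d → ℝ → Torus d → ℝ)
    (n : ℕ) (c : Fin d → ℝ) (j m : Fin d) (q : Torus d → ℝ) (A : ℝ) (a β : ℝ → Torus d → ℝ)
    (k : Fin d) (t : ℝ) (x : Torus d) : ℝ :=
  (if k = m then A * dirDeriv (1, c) (potential n c q a) t x else 0) +
  pertDensity n c m q A a t x * (u k t x - c k) +
  ρ t x * pertVelocity n c j m q β k t x +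
  (pertDensity n c m q A a t x * pertVelocity n c j m q β k t x -
    if k = j then a t x * β t x * osc n c (fun x => A * pderiv m q x ^ 2) t x else 0) +
  (n : ℝ)⁻¹ * (dirDeriv (eDir j) (fun t x => a t x * β t x) t x *
      osc n c (correctorField m q A k) t x -
    if k = j then ∑ i, dirDeriv (eDir i) (fun t x => a t x * β t x) t x *
      osc n c (correctorField m q A i) t x else 0)

section

variable {n : ℕ} {c : Fin d → ℝ} {j m : Fin d} {q : Torus d → ℝ} {A : ℝ}
  {a β : ℝ → Torus d → ℝ}

lemma smoothOn_potential (hq : SmoothTorus q) (ha : SmoothOn univ a) :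
    SmoothOn univ (potential n c q a) :=
  (ha.mul (smoothOn_osc n c hq)).const_mul _

lemma smoothOn_pertDensity (hq : SmoothTorus q) (ha : SmoothOn univ a) :
    SmoothOn univ (pertDensity n c m q A a) :=
  ((smoothOn_potential hq ha).dirDeriv _).const_mul _

lemma smoothOn_pertVelocity (hq : SmoothTorus q) (hβ : SmoothOn univ β) (k : Fin d) :
    SmoothOn univ (pertVelocity n c j m q β k) := by
  unfold pertVelocity
  refine SmoothOn.add ?_ ?_
  · split_ifs
    · exact (smoothOn_potential hq hβ).dirDeriv _
    · exact SmoothOn.const 0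
  · split_ifs
    · exact ((smoothOn_potential hq hβ).dirDeriv _).neg
    · exact SmoothOn.const 0

lemma continuous_profile_sq (hq : SmoothTorus q) :
    Continuous fun x => A * pderiv m q x ^ 2 :=
  continuous_const.mul ((hq.pderiv m).continuous.pow 2)

lemma continuous_correctorField (hq : SmoothTorus q) (k : Fin d) :
    Continuous (correctorField m q A k) :=
  continuous_antidivList_slice _ (continuous_profile_sq hq) k

lemma invariantIn_pderiv {f : Torus d → ℝ} (hf : InvariantIn j f) (i : Fin d) :
    InvariantIn j (pderiv i f) := by
  intro x s
  unfold pderiv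
  congr 1
  ext1 r
  rw [add_right_comm, hf _ s]

lemma invariantIn_correctorField (hq : InvariantIn j q) (k : Fin d) :
    InvariantIn j (correctorField m q A k) := by
  have h : InvariantIn j fun x => A * pderiv m q x ^ 2 := by
    intro x s
    simp only [invariantIn_pderiv hq m x s]
  intro x s
  exact congrFun (InvariantIn.antidivList (List.finRange d) h x s) k

lemma integral_abs_correctorField_le (hq : SmoothTorus q) (hA : 0 < A)
    (hn : A * ∫ x, pderiv m q x ^ 2 = 1) (k : Fin d) :
    ∫ x, |correctorField m q A k x| ≤ d := by
  have h := integral_abs_antidivList_le (List.finRange d)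
    (continuous_profile_sq (m := m) (A := A) hq) k
  have h1 : ∫ x, |A * pderiv m q x ^ 2| = 1 := by
    refine Eq.trans ?_ hn
    rw [← integral_const_mul]
    refine integral_congr_ae (Filter.Eventually.of_forall fun x => ?_)
    exact abs_of_nonneg (by positivity)
  rw [h1] at h
  simpa [correctorField, antidiv] using h

lemma dirDeriv_potential (hn : n ≠ 0) (hq : SmoothTorus q) (ha : SmoothOn univ a) (i : Fin d)
    (t : ℝ) (x : Torus d) :
    dirDeriv (eDir i) (potential n c q a) t x =
      a t x * osc n c (pderiv i q) t x + (n : ℝ)⁻¹ * (dirDeriv (eDir i) a t x * osc n c q t x) := by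
  unfold potential
  rw [(ha.mul (smoothOn_osc n c hq)).dirDeriv_const_mul, ha.dirDeriv_mul (smoothOn_osc n c hq),
    dirDeriv_osc n c hq]
  have : (n : ℝ) ≠ 0 := by exact_mod_cast hn
  field_simp
  ring

lemma dirDeriv_transport_potential (hq : SmoothTorus q) (ha : SmoothOn univ a)
    (t : ℝ) (x : Torus d) :
    dirDeriv (1, c) (potential n c q a) t x =
      (n : ℝ)⁻¹ * (dirDeriv (1, c) a t x * osc n c q t x) := by
  unfold potential
  rw [(ha.mul (smoothOn_osc n c hq)).dirDeriv_const_mul, ha.dirDeriv_mul (smoothOn_osc n c hq)]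
  have : dirDeriv (1, c) (osc n c q) t x = 0 := SmoothOn.dirDeriv_travelling n c t x
  rw [this]; ring

lemma pderiv_eq_zero_of_invariantIn {f : Torus d → ℝ} (hf : InvariantIn j f) (x : Torus d) :
    pderiv j f x = 0 := by
  rw [(HasPartial.of_invariant hf).pderiv_eq]

/-- The density perturbation is transported by the constant velocity `c` up to an explicit
divergence. -/
lemma integral_pertDensity_transport (hq : SmoothTorus q) (ha : SmoothOn univ a)
    {φ : ℝ → Torus d → ℝ} (hφ : IsTestFunction φ) :
    ∫ z : ℝ × Torus d, pertDensity n c m q A a z.1 z.2 * dirDeriv (1, c) φ z.1 z.2 ∂(spaceTime d) =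
    ∫ z : ℝ × Torus d, A * dirDeriv (1, c) (potential n c q a) z.1 z.2 *
      dirDeriv (eDir m) φ z.1 z.2 ∂(spaceTime d) := by
  have hg := smoothOn_potential (n := n) (c := c) hq ha
  have h1 := (hφ.dirDeriv (1, c)).integral_dirDeriv_mul hg (eDir m)
  have h2 := (hφ.dirDeriv (eDir m)).integral_dirDeriv_mul hg (1, c)
  simp_rw [hφ.smooth.dirDeriv_comm (eDir m) (1, c)] at h1
  unfold pertDensity
  simp_rw [mul_assoc, integral_const_mul]
  rw [h1, h2]

lemma integral_pertVelocity (hq : SmoothTorus q) (hβ : SmoothOn univ β)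
    {φ : ℝ → Torus d → ℝ} (hφ : IsTestFunction φ) :
    ∫ z : ℝ × Torus d, (∑ k, pertVelocity n c j m q β k z.1 z.2 * dirDeriv (eDir k) φ z.1 z.2)
      ∂(spaceTime d) = 0 := by
  have hg := smoothOn_potential (n := n) (c := c) hq hβ
  have h1 := (hφ.dirDeriv (eDir j)).integral_dirDeriv_mul hg (eDir m)
  have h2 := (hφ.dirDeriv (eDir m)).integral_dirDeriv_mul hg (eDir j)
  simp_rw [hφ.smooth.dirDeriv_comm (eDir m) (eDir j)] at h1
  have h3 : ∀ z : ℝ × Torus d,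
      ∑ k, pertVelocity n c j m q β k z.1 z.2 * dirDeriv (eDir k) φ z.1 z.2 =
      dirDeriv (eDir m) (potential n c q β) z.1 z.2 * dirDeriv (eDir j) φ z.1 z.2 -
        dirDeriv (eDir j) (potential n c q β) z.1 z.2 * dirDeriv (eDir m) φ z.1 z.2 := by
    intro z
    simp only [pertVelocity, add_mul, ite_mul, zero_mul, Finset.sum_add_distrib,
      Finset.sum_ite_eq', Finset.mem_univ, if_true]
    ring
  simp_rw [h3]
  rw [integral_sub, h1, h2, sub_self]
  · exact integrable_spaceTime
      ((hg.dirDeriv _).continuous.mul (hφ.smooth.dirDeriv _).continuous)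
  · exact integrable_spaceTime
      ((hg.dirDeriv _).continuous.mul (hφ.smooth.dirDeriv _).continuous)

/-- The oscillation of the quadratic term about its mean is the divergence of a field which gains
the factor `n⁻¹`. -/
lemma integral_quadratic (hn : n ≠ 0) (hq : SmoothTorus q) (hinv : InvariantIn j q)
    (hA : A * ∫ x, pderiv m q x ^ 2 = 1) {f : ℝ → Torus d → ℝ} (hf : SmoothOn univ f)
    {φ : ℝ → Torus d → ℝ} (hφ : IsTestFunction φ) (t : ℝ) :
    ∫ x, f t x * (osc n c (fun x => A * pderiv m q x ^ 2) t x - 1) * dirDeriv (eDir j) φ t x =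
    ∫ x, ((n : ℝ)⁻¹ * ∑ k, (dirDeriv (eDir j) f t x * osc n c (correctorField m q A k) t x *
      dirDeriv (eDir k) φ t x - dirDeriv (eDir k) f t x * osc n c (correctorField m q A k) t x *
      dirDeriv (eDir j) φ t x)) := by
  obtain ⟨g, cg, hg, sg⟩ := hasPartial_antidivList (List.finRange d)
    (continuous_profile_sq (m := m) (A := A) hq)
  have sg' : ∀ x, ∑ k, g k x = A * pderiv m q x ^ 2 - 1 := by
    intro x
    rw [sg, avgList_finRange (continuous_profile_sq hq), integral_const_mul, hA]
  have hn0 : (n : ℝ) ≠ 0 := by exact_mod_cast hn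
  have cT : ∀ {h : Torus d → ℝ}, Continuous h → Continuous (osc n c h t) := fun hh =>
    (continuous_osc n c hh).comp (Continuous.prodMk_right t)
  have cB : ∀ k, Continuous (osc n c (correctorField m q A k) t) := fun k =>
    cT (continuous_correctorField hq k)
  have cf := hf.continuous_slice t
  have cf' : ∀ k, Continuous (dirDeriv (eDir k) f t) := fun k => (hf.dirDeriv _).continuous_slice t
  have cφ' : ∀ k, Continuous (dirDeriv (eDir k) φ t) := fun k =>
    (hφ.smooth.dirDeriv _).continuous_slice t
  have cφ'' : ∀ k l, Continuous (dirDeriv (eDir l) (dirDeriv (eDir k) φ) t) := fun k l =>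
    ((hφ.smooth.dirDeriv _).dirDeriv _).continuous_slice t
  have pB : ∀ k, HasPartial k (osc n c (correctorField m q A k) t)
      (fun x => n * osc n c (g k) t x) := fun k => hasPartial_osc n c (hg k) t
  have pBj : ∀ k, HasPartial j (osc n c (correctorField m q A k) t) (fun _ => 0) := fun k => by
    have := hasPartial_osc n c (HasPartial.of_invariant
      (invariantIn_correctorField (m := m) (A := A) hinv k)) t
    simpa [osc] using this
  have main : ∀ k, ∫ x, f t x * osc n c (g k) t x * dirDeriv (eDir j) φ t x =
      ∫ x, (n : ℝ)⁻¹ * (dirDeriv (eDir j) f t x * osc n c (correctorField m q A k) t x *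
        dirDeriv (eDir k) φ t x - dirDeriv (eDir k) f t x * osc n c (correctorField m q A k) t x *
        dirDeriv (eDir j) φ t x) := by
    intro k
    have i1 := integral_mul_partial (pB k)
      ((hf.hasPartial k t).mul ((hφ.dirDeriv (eDir j)).smooth.hasPartial k t)) (cB k)
      (continuous_const.mul (cT (cg k))) (cf.mul (cφ' j))
      (((cf' k).mul (cφ' j)).add (cf.mul (cφ'' j k)))
    have i2 := integral_mul_partial ((pBj k).mul (hf.hasPartial j t))
      ((hφ.dirDeriv (eDir k)).smooth.hasPartial j t) ((cB k).mul cf)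
      ((continuous_const.mul cf).add ((cB k).mul (cf' j))) (cφ' k) (cφ'' k j)
    have e1 : ∀ x, f t x * osc n c (g k) t x * dirDeriv (eDir j) φ t x =
        (n : ℝ)⁻¹ * (n * osc n c (g k) t x * (f t x * dirDeriv (eDir j) φ t x)) := by
      intro x; field_simp
    simp_rw [e1]
    rw [integral_const_mul, integral_const_mul]
    congr 1
    rw [i1]
    have comm : ∀ x, dirDeriv (0, Pi.single k 1) (dirDeriv (eDir j) φ) t x =
        dirDeriv (0, Pi.single j 1) (dirDeriv (eDir k) φ) t x := fun x =>
      hφ.smooth.dirDeriv_comm _ _ t x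
    simp_rw [comm, mul_add]
    rw [integral_add, integral_sub]
    rotate_left
    · exact integrable_of_continuous (((cf' j).mul (cB k)).mul (cφ' k))
    · exact integrable_of_continuous (((cf' k).mul (cB k)).mul (cφ' j))
    · exact integrable_of_continuous ((cB k).mul ((cf' k).mul (cφ' j)))
    · exact integrable_of_continuous ((cB k).mul (cf.mul (cφ'' k j)))
    have e2 : ∀ x, (0 * f t x + osc n c (correctorField m q A k) t x *
        dirDeriv (0, Pi.single j 1) f t x) * dirDeriv (eDir k) φ t x =
        dirDeriv (eDir j) f t x * osc n c (correctorField m q A k) t x *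
          dirDeriv (eDir k) φ t x := by
      intro x; simp only [eDir]; ring
    have e3 : ∀ x, osc n c (correctorField m q A k) t x *
        (dirDeriv (0, Pi.single k 1) f t x * dirDeriv (eDir j) φ t x) =
        dirDeriv (eDir k) f t x * osc n c (correctorField m q A k) t x *
          dirDeriv (eDir j) φ t x := by
      intro x; simp only [eDir]; ring
    simp_rw [e2, mul_assoc] at i2
    simp_rw [e3, mul_assoc]
    rw [i2]
    ring
  have e4 : ∀ x, f t x * (osc n c (fun x => A * pderiv m q x ^ 2) t x - 1) *
      dirDeriv (eDir j) φ t x = ∑ k, f t x * osc n c (g k) t x * dirDeriv (eDir j) φ t x := by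
    intro x
    rw [← Finset.sum_mul, ← Finset.mul_sum]
    simp only [osc, sg']
  simp_rw [e4, Finset.mul_sum]
  rw [integral_finsetSum, integral_finsetSum]
  · exact Finset.sum_congr rfl fun k _ => main k
  · exact fun k _ => integrable_of_continuous (continuous_const.mul
      ((((cf' j).mul (cB k)).mul (cφ' k)).sub (((cf' k).mul (cB k)).mul (cφ' j))))
  · exact fun k _ => integrable_of_continuous ((cf.mul (cT (cg k))).mul (cφ' j))

lemma continuous_pertError {ρ : ℝ → Torus d → ℝ} {u : Fin d → ℝ → Torus d → ℝ}
    (cρ : Continuous fun z : ℝ × Torus d => ρ z.1 z.2)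
    (cu : ∀ k, Continuous fun z : ℝ × Torus d => u k z.1 z.2)
    (hq : SmoothTorus q) (ha : SmoothOn univ a) (hβ : SmoothOn univ β) (k : Fin d) :
    Continuous fun z : ℝ × Torus d => pertError ρ u n c j m q A a β k z.1 z.2 := by
  have c1 := (smoothOn_pertDensity (n := n) (c := c) (m := m) (A := A) hq ha).continuous
  have c2 := (smoothOn_pertVelocity (n := n) (c := c) (j := j) (m := m) hq hβ k).continuous
  have c3 : Continuous fun z : ℝ × Torus d => dirDeriv (1, c) (potential n c q a) z.1 z.2 :=
    ((smoothOn_potential hq ha).dirDeriv _).continuous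
  have c4 : ∀ i, Continuous fun z : ℝ × Torus d =>
      dirDeriv (eDir i) (fun t x => a t x * β t x) z.1 z.2 := fun i =>
    ((ha.mul hβ).dirDeriv _).continuous
  have c5 : ∀ i, Continuous fun z : ℝ × Torus d => osc n c (correctorField m q A i) z.1 z.2 :=
    fun i => continuous_osc n c (continuous_correctorField hq i)
  have c6 : Continuous fun z : ℝ × Torus d =>
      osc n c (fun x => A * pderiv m q x ^ 2) z.1 z.2 :=
    continuous_osc n c (continuous_profile_sq hq)
  have c7 := ha.continuous
  have c8 := hβ.continuous
  have c9 := cu k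
  unfold pertError
  have hite : ∀ (P : Prop) [Decidable P] {F : ℝ × Torus d → ℝ}, Continuous F →
      Continuous fun z => if P then F z else 0 := fun P _ F hF => by
    split_ifs
    · exact hF
    · exact continuous_const
  exact ((((hite _ (continuous_const.mul c3)).add (c1.mul (c9.sub continuous_const))).add
    (cρ.mul c2)).add ((c1.mul c2).sub (hite _ ((c7.mul c8).mul c6)))).add
    (continuous_const.mul (((c4 j).mul (c5 k)).sub
      (hite _ (continuous_finsetSum _ fun i _ => (c4 i).mul (c5 i)))))

lemma integral_add_add_eq_zero {α : Type*} [MeasurableSpace α] {μ : Measure α} {X Y Z : α → ℝ}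
    (hX : Integrable X μ) (hY : Integrable Y μ) (hZ : Integrable Z μ) (h1 : ∫ z, X z ∂μ = 0)
    (h2 : ∫ z, Y z ∂μ = 0) (h3 : ∫ z, Z z ∂μ = 0) : ∫ z, (X z + Y z + Z z) ∂μ = 0 := by
  rw [integral_add (f := fun z => X z + Y z) (hX.add hY) hZ, integral_add hX hY, h1, h2, h3]; simp

/-- The perturbed triple is again a subsolution: the defect changes by the product `a β` in the
direction `j` and by the error. -/
lemma IsSub.perturb {ρ : ℝ → Torus d → ℝ} {u R : Fin d → ℝ → Torus d → ℝ} (h : IsSub ρ u R)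
    (hn : n ≠ 0) (hq : SmoothTorus q) (hinv : InvariantIn j q)
    (hA : A * ∫ x, pderiv m q x ^ 2 = 1) (ha : SmoothOn univ a) (hβ : SmoothOn univ β) :
    IsSub (fun t x => ρ t x + pertDensity n c m q A a t x)
      (fun k t x => u k t x + pertVelocity n c j m q β k t x)
      (fun k t x => R k t x + (if k = j then a t x * β t x else 0) +
        pertError ρ u n c j m q A a β k t x) := by
  have cϑ := (smoothOn_pertDensity (n := n) (c := c) (m := m) (A := A) hq ha).continuous
  have cw := fun k => (smoothOn_pertVelocity (n := n) (c := c) (j := j) (m := m) hq hβ k).continuous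
  have cE := fun k => continuous_pertError (n := n) (c := c) (j := j) (m := m) (A := A)
    h.cont_density h.cont_velocity hq ha hβ k
  have cρ := h.cont_density
  have cu := h.cont_velocity
  have cR := h.cont_defect
  have caβ : ∀ k, Continuous fun z : ℝ × Torus d =>
      if k = j then a z.1 z.2 * β z.1 z.2 else 0 := fun k => by
    split_ifs
    · exact ha.continuous.mul hβ.continuous
    · exact continuous_const
  refine ⟨cρ.add cϑ, fun k => (cu k).add (cw k), fun k => ((cR k).add (caβ k)).add (cE k), ?_, ?_⟩
  swap
  · intro φ hφ
    have cφ : ∀ k, Continuous fun z : ℝ × Torus d => dirDeriv (eDir k) φ z.1 z.2 := fun k =>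
      (hφ.smooth.dirDeriv _).continuous
    simp_rw [add_mul, Finset.sum_add_distrib]
    rw [integral_add, h.incompressible φ hφ, integral_pertVelocity hq hβ hφ, add_zero]
    · exact integrable_spaceTime (continuous_finsetSum _ fun k _ => (cu k).mul (cφ k))
    · exact integrable_spaceTime (continuous_finsetSum _ fun k _ => (cw k).mul (cφ k))
  intro φ hφ
  have cφ : ∀ k, Continuous fun z : ℝ × Torus d => dirDeriv (eDir k) φ z.1 z.2 := fun k =>
    (hφ.smooth.dirDeriv _).continuous
  have cφt : Continuous fun z : ℝ × Torus d => dirDeriv (1, 0) φ z.1 z.2 :=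
    (hφ.smooth.dirDeriv _).continuous
  have cφc : Continuous fun z : ℝ × Torus d => dirDeriv (1, c) φ z.1 z.2 :=
    (hφ.smooth.dirDeriv _).continuous
  have cf := (ha.mul hβ).continuous
  have cf' : ∀ k, Continuous fun z : ℝ × Torus d =>
      dirDeriv (eDir k) (fun t x => a t x * β t x) z.1 z.2 := fun k =>
    ((ha.mul hβ).dirDeriv _).continuous
  have cB : ∀ k, Continuous fun z : ℝ × Torus d => osc n c (correctorField m q A k) z.1 z.2 :=
    fun k => continuous_osc n c (continuous_correctorField hq k)
  have cT : Continuous fun z : ℝ × Torus d => osc n c (fun x => A * pderiv m q x ^ 2) z.1 z.2 :=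
    continuous_osc n c (continuous_profile_sq hq)
  have ch : Continuous fun z : ℝ × Torus d => dirDeriv (1, c) (potential n c q a) z.1 z.2 :=
    ((smoothOn_potential hq ha).dirDeriv _).continuous
  have I0 := h.continuity φ hφ
  have I1 := integral_pertDensity_transport (n := n) (c := c) (m := m) (A := A) hq ha hφ
  have I2 := integral_spaceTime_congr
    (F := fun z => a z.1 z.2 * β z.1 z.2 * (osc n c (fun x => A * pderiv m q x ^ 2) z.1 z.2 - 1) *
      dirDeriv (eDir j) φ z.1 z.2)
    (G := fun z => (n : ℝ)⁻¹ * ∑ k, (dirDeriv (eDir j) (fun t x => a t x * β t x) z.1 z.2 *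
      osc n c (correctorField m q A k) z.1 z.2 * dirDeriv (eDir k) φ z.1 z.2 -
      dirDeriv (eDir k) (fun t x => a t x * β t x) z.1 z.2 *
      osc n c (correctorField m q A k) z.1 z.2 * dirDeriv (eDir j) φ z.1 z.2))
    (integrable_spaceTime (by fun_prop)) (integrable_spaceTime (by fun_prop))
    (fun t _ => integral_quadratic hn hq hinv hA (ha.mul hβ) hφ t)
  have lin : ∀ z : ℝ × Torus d, dirDeriv (1, c) φ z.1 z.2 = dirDeriv (1, 0) φ z.1 z.2 +
      ∑ k, c k * dirDeriv (eDir k) φ z.1 z.2 := fun z => by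
    simpa [eDir] using hφ.smooth.dirDeriv_linear (1, c) z.1 z.2
  rw [← sub_eq_zero] at I0 I1 I2 ⊢
  rw [← integral_sub (integrable_spaceTime (by fun_prop)) (integrable_spaceTime (by fun_prop))]
    at I0 I1 I2 ⊢
  refine Eq.trans ?_ (integral_add_add_eq_zero (integrable_spaceTime (by fun_prop))
    (integrable_spaceTime (by fun_prop)) (integrable_spaceTime (by fun_prop)) I0 I1 I2)
  refine integral_congr_ae (Filter.Eventually.of_forall fun z => ?_)
  simp only [lin, pertError]
  simp only [add_mul, mul_add, sub_mul, mul_sub, Finset.sum_add_distrib, Finset.sum_sub_distrib,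
    ite_mul, zero_mul, mul_ite, mul_zero, Finset.sum_ite_eq', Finset.mem_univ, if_true,
    Finset.mul_sum, Finset.sum_mul]
  simp only [mul_assoc, mul_comm, mul_left_comm]
  ring

end

end ContinuityEq

namespace ContinuityEq

variable {d : ℕ}

/-! ### Estimates for one perturbation -/

/-- The data of an elementary perturbation: the direction `j`, the amplitudes of the perturbations
of the density and of the velocity, and the constant velocity with which the oscillations travel. -/
structure Block (d : ℕ) where
  /-- the direction of the perturbation of the velocity -/
  dir : Fin d
  /-- the amplitude of the perturbation of the density -/
  amp : ℝ → Torus d → ℝ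
  /-- the amplitude of the perturbation of the velocity -/
  ampVel : ℝ → Torus d → ℝ
  /-- the velocity with which the oscillations travel -/
  speed : Fin d → ℝ
  smooth_amp : SmoothOn univ amp
  smooth_ampVel : SmoothOn univ ampVel

/-- The amplitudes and the time derivative of the first one vanish at time `t`. -/
def Block.VanishesAt (b : Block d) (t : ℝ) : Prop :=
  (∀ x, b.amp t x = 0) ∧ (∀ x, b.ampVel t x = 0) ∧ ∀ x, dirDeriv (1, 0) b.amp t x = 0

/-- The contribution of a block to the defect. -/
def Block.flux (b : Block d) (k : Fin d) (t : ℝ) (x : Torus d) : ℝ :=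
  if k = b.dir then b.amp t x * b.ampVel t x else 0

/-- `(ϑ, w)` is a perturbation of `(ρ, u, R)` which changes the defect by the fluxes of the blocks
in a list, up to errors. -/
structure IsPerturbation (K δ : ℝ) (p : ℝ≥0∞) (L : List (Block d)) (ρ : ℝ → Torus d → ℝ)
    (u R : Fin d → ℝ → Torus d → ℝ) (ϑ : ℝ → Torus d → ℝ) (w F : Fin d → ℝ → Torus d → ℝ) :
    Prop where
  isSub : IsSub (fun t x => ρ t x + ϑ t x) (fun k t x => u k t x + w k t x)
    (fun k t x => R k t x + (L.map fun b => b.flux k t x).sum + F k t x)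
  smooth_density : SmoothOn univ ϑ
  smooth_velocity : ∀ k, SmoothOn univ (w k)
  cont_error : ∀ k, Continuous fun z : ℝ × Torus d => F k z.1 z.2
  density_le : ∀ t ∈ Icc (0 : ℝ) 1, ∫ x, |ϑ t x| ≤ K * (L.map fun b => ∫ x, |b.amp t x|).sum + δ
  velocity_le : ∀ t ∈ Icc (0 : ℝ) 1, ∀ x k,
    |w k t x| ≤ K * (L.map fun b => |b.ampVel t x|).sum + δ
  velocity_Lp : ∀ t ∈ Icc (0 : ℝ) 1, ∀ k, eLpNorm (w k t) p volume ≤ ENNReal.ofReal δ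
  gradient_Lp : ∀ t ∈ Icc (0 : ℝ) 1, ∀ k i,
    eLpNorm (dirDeriv (eDir i) (w k) t) p volume ≤ ENNReal.ofReal δ
  error_le : ∀ t ∈ Icc (0 : ℝ) 1, ∀ k, ∫ x, |F k t x| ≤
    K * (L.map fun b => ∫ x, |b.amp t x * (u k t x - b.speed k)|).sum + δ
  vanish : ∀ t, (∀ b ∈ L, b.VanishesAt t) → (∀ x, ϑ t x = 0) ∧ (∀ k x, w k t x = 0) ∧
    ∀ k x, F k t x = 0

lemma exists_bound_Icc {ι : Type*} [Finite ι] (F : ι → ℝ → Torus d → ℝ)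
    (hF : ∀ i, Continuous fun z : ℝ × Torus d => F i z.1 z.2) :
    ∃ C : ℝ, 1 ≤ C ∧ ∀ i, ∀ t ∈ Icc (0 : ℝ) 1, ∀ x, |F i t x| ≤ C := by
  have : ∀ i, ∃ C : ℝ, ∀ t ∈ Icc (0 : ℝ) 1, ∀ x, |F i t x| ≤ C := fun i => by
    obtain ⟨C, hC⟩ :=
      (isCompact_Icc.prod (isCompact_univ (X := Torus d))).exists_bound_of_continuousOn
      (s := Icc (0 : ℝ) 1 ×ˢ univ) (hF i).continuousOn
    exact ⟨C, fun t ht x => hC (t, x) ⟨ht, mem_univ _⟩⟩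
  choose C hC using this
  obtain ⟨B, hB⟩ := (finite_range C).bddAbove
  exact ⟨max 1 B, le_max_left _ _, fun i t ht x =>
    (hC i t ht x).trans ((hB (mem_range_self i)).trans (le_max_right _ _))⟩

lemma integral_norm_le_of_eLpNorm_le {G : Type*} [NormedAddCommGroup G] {f : Torus d → G}
    (hf : Continuous f) {p : ℝ≥0∞} (hp : 1 ≤ p) {δ : ℝ} (hδ : 0 ≤ δ)
    (h : eLpNorm f p volume ≤ ENNReal.ofReal δ) : ∫ x, ‖f x‖ ≤ δ := by
  have h1 : eLpNorm f 1 volume ≤ ENNReal.ofReal δ :=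
    (eLpNorm_le_eLpNorm_of_exponent_le hp hf.aestronglyMeasurable).trans h
  have h2 : ∫ x, ‖f x‖ = (eLpNorm f 1 volume).toReal := by
    rw [eLpNorm_one_eq_lintegral_enorm]
    exact integral_norm_eq_lintegral_enorm hf.aestronglyMeasurable
  rw [h2]
  exact ENNReal.toReal_le_of_le_ofReal hδ h1

lemma abs_mul_le_mul {x y X Y : ℝ} (hx : |x| ≤ X) (hy : |y| ≤ Y) : |x * y| ≤ X * Y := by
  rw [abs_mul]
  exact mul_le_mul hx hy (abs_nonneg _) ((abs_nonneg _).trans hx)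

lemma abs_add_five_le {x₁ x₂ x₃ x₄ x₅ y₁ y₂ y₃ y₄ y₅ : ℝ} (h₁ : |x₁| ≤ y₁) (h₂ : |x₂| ≤ y₂)
    (h₃ : |x₃| ≤ y₃) (h₄ : |x₄| ≤ y₄) (h₅ : |x₅| ≤ y₅) :
    |x₁ + x₂ + x₃ + x₄ + x₅| ≤ y₁ + y₂ + y₃ + y₄ + y₅ :=
  (abs_add_le _ _).trans (add_le_add ((abs_add_le _ _).trans (add_le_add ((abs_add_le _ _).trans
    (add_le_add ((abs_add_le _ _).trans (add_le_add h₁ h₂)) h₃)) h₄)) h₅)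

lemma dirDeriv_eDir_eq_zero {a : ℝ → Torus d → ℝ} {t : ℝ} (h : ∀ x, a t x = 0)
    (i : Fin d) (x : Torus d) : dirDeriv (eDir i) a t x = 0 := by
  simp [dirDeriv, eDir, h]

section

variable {n : ℕ} {c : Fin d → ℝ} {j m : Fin d} {q : Torus d → ℝ} {A M C δ₀ : ℝ} {p : ℝ≥0∞}
  {a β : ℝ → Torus d → ℝ}

lemma abs_potential_deriv_le (hn : n ≠ 0) (hq : SmoothTorus q) (ha : SmoothOn univ a) {t : ℝ}
    {x : Torus d} {i : Fin d} (h : |dirDeriv (eDir i) a t x| ≤ C) :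
    |dirDeriv (eDir i) (potential n c q a) t x| ≤ |a t x| * |osc n c (pderiv i q) t x| +
      (n : ℝ)⁻¹ * (C * |osc n c q t x|) := by
  rw [dirDeriv_potential hn hq ha]
  refine (abs_add_le _ _).trans ?_
  rw [abs_mul, abs_mul, abs_of_nonneg (by positivity : (0 : ℝ) ≤ (n : ℝ)⁻¹)]
  gcongr
  exact abs_mul_le_mul h le_rfl

lemma abs_pertVelocity_le (hn : n ≠ 0) (hjm : m ≠ j) (hq : SmoothTorus q)
    (hinv : InvariantIn j q) (hβ : SmoothOn univ β) {t : ℝ} {x : Torus d}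
    (h : ∀ i, |dirDeriv (eDir i) β t x| ≤ C) (k : Fin d) :
    |pertVelocity n c j m q β k t x| ≤ |β t x| * |osc n c (pderiv m q) t x| +
      (n : ℝ)⁻¹ * (C * |osc n c q t x|) := by
  have hC : 0 ≤ C := (abs_nonneg _).trans (h j)
  unfold pertVelocity
  by_cases h1 : k = j
  · subst h1
    rw [if_pos rfl, if_neg hjm.symm, add_zero]
    exact abs_potential_deriv_le hn hq hβ (h m)
  · rw [if_neg h1, zero_add]
    split_ifs with h2
    · rw [abs_neg]
      refine (abs_potential_deriv_le hn hq hβ (h j)).trans ?_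
      have : osc n c (pderiv j q) t x = 0 := pderiv_eq_zero_of_invariantIn hinv _
      rw [this]
      simp only [abs_zero, mul_zero, zero_add, le_add_iff_nonneg_left]
      positivity
    · rw [abs_zero]; positivity

lemma dirDeriv_dirDeriv_potential (hn : n ≠ 0) (hq : SmoothTorus q) (hβ : SmoothOn univ β)
    (i l : Fin d) (t : ℝ) (x : Torus d) :
    dirDeriv (eDir i) (dirDeriv (eDir l) (potential n c q β)) t x =
      (n * (β t x * osc n c (pderiv i (pderiv l q)) t x) +
        dirDeriv (eDir i) β t x * osc n c (pderiv l q) t x) +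
      (dirDeriv (eDir l) β t x * osc n c (pderiv i q) t x +
      (n : ℝ)⁻¹ * (dirDeriv (eDir i) (dirDeriv (eDir l) β) t x * osc n c q t x)) := by
  have h0 : dirDeriv (eDir l) (potential n c q β) = fun t x =>
      β t x * osc n c (pderiv l q) t x + (n : ℝ)⁻¹ * (dirDeriv (eDir l) β t x * osc n c q t x) := by
    ext t x; exact dirDeriv_potential hn hq hβ l t x
  have s1 := smoothOn_osc n c (hq.pderiv l)
  have s2 := smoothOn_osc n c hq
  have s3 := hβ.dirDeriv (eDir l)
  have : (n : ℝ) ≠ 0 := by exact_mod_cast hn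
  rw [h0, (hβ.mul s1).dirDeriv_add ((s3.mul s2).const_mul _), (s3.mul s2).dirDeriv_const_mul,
    hβ.dirDeriv_mul s1, s3.dirDeriv_mul s2, dirDeriv_osc n c hq, dirDeriv_osc n c (hq.pderiv l)]
  field_simp
  ring

lemma abs_gradient_pertVelocity_le (hn : n ≠ 0) (hjm : m ≠ j) (hq : SmoothTorus q)
    (hinv : InvariantIn j q) (hβ : SmoothOn univ β) {t : ℝ} {x : Torus d} (h0 : |β t x| ≤ C)
    (h : ∀ i, |dirDeriv (eDir i) β t x| ≤ C)
    (h' : ∀ i l, |dirDeriv (eDir i) (dirDeriv (eDir l) β) t x| ≤ C) (i k : Fin d) :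
    |dirDeriv (eDir i) (pertVelocity n c j m q β k) t x| ≤
      (n * C) * (|osc n c (pderiv i (pderiv m q)) t x| + |osc n c (pderiv m q) t x| +
        |osc n c (pderiv i q) t x| + |osc n c q t x|) := by
  have hC : 0 ≤ C := (abs_nonneg _).trans h0
  have hn1 : (1 : ℝ) ≤ n := by exact_mod_cast Nat.one_le_iff_ne_zero.2 hn
  have hni : (n : ℝ)⁻¹ ≤ 1 := inv_le_one_of_one_le₀ hn1
  have hs := smoothOn_potential (n := n) (c := c) hq hβ
  have hCn : C ≤ n * C := le_mul_of_one_le_left hC hn1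
  have key : ∀ l, |dirDeriv (eDir i) (dirDeriv (eDir l) (potential n c q β)) t x| ≤
      (n * C) * (|osc n c (pderiv i (pderiv l q)) t x| + |osc n c (pderiv l q) t x| +
        |osc n c (pderiv i q) t x| + |osc n c q t x|) := by
    intro l
    rw [dirDeriv_dirDeriv_potential hn hq hβ]
    have e1 : |(n : ℝ) * (β t x * osc n c (pderiv i (pderiv l q)) t x)| ≤
        (n * C) * |osc n c (pderiv i (pderiv l q)) t x| := by
      rw [← mul_assoc]
      exact abs_mul_le_mul (abs_mul_le_mul (by simp) h0) le_rfl
    have e2 := abs_mul_le_mul ((h i).trans hCn) (le_refl |osc n c (pderiv l q) t x|)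
    have e3 := abs_mul_le_mul ((h l).trans hCn) (le_refl |osc n c (pderiv i q) t x|)
    have e4 : |(n : ℝ)⁻¹ * (dirDeriv (eDir i) (dirDeriv (eDir l) β) t x * osc n c q t x)| ≤
        (n * C) * |osc n c q t x| := by
      rw [abs_mul, abs_of_nonneg (by positivity : (0 : ℝ) ≤ (n : ℝ)⁻¹)]
      exact (mul_le_of_le_one_left (abs_nonneg _) hni).trans
        (abs_mul_le_mul ((h' i l).trans hCn) le_rfl)
    refine (abs_add_le _ _).trans ?_
    have e5 := abs_add_le ((n : ℝ) * (β t x * osc n c (pderiv i (pderiv l q)) t x))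
      (dirDeriv (eDir i) β t x * osc n c (pderiv l q) t x)
    have e6 := abs_add_le (dirDeriv (eDir l) β t x * osc n c (pderiv i q) t x)
      ((n : ℝ)⁻¹ * (dirDeriv (eDir i) (dirDeriv (eDir l) β) t x * osc n c q t x))
    linarith
  by_cases h1 : k = j
  · subst h1
    have : pertVelocity n c k m q β k = dirDeriv (eDir m) (potential n c q β) := by
      ext t x; simp [pertVelocity, hjm.symm]
    rw [this]
    exact key m
  · by_cases h2 : k = m
    · have : pertVelocity n c j m q β k = fun t x =>
          (-1) * dirDeriv (eDir j) (potential n c q β) t x := by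
        ext t x; simp [pertVelocity, h2, hjm]
      rw [this, (hs.dirDeriv _).dirDeriv_const_mul, neg_one_mul, abs_neg]
      refine (key j).trans ?_
      have z1 : osc n c (pderiv j q) t x = 0 := pderiv_eq_zero_of_invariantIn hinv _
      have z2 : osc n c (pderiv i (pderiv j q)) t x = 0 := by
        have : pderiv j q = fun _ => 0 := by
          ext y; exact pderiv_eq_zero_of_invariantIn hinv y
        unfold osc
        rw [this]
        simp [pderiv]
      rw [z1, z2, abs_zero]
      gcongr
      · exact abs_nonneg _
      · exact abs_nonneg _
    · have : pertVelocity n c j m q β k = fun t x => 0 := by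
        ext t x; simp [pertVelocity, h1, h2]
      rw [this]
      have : dirDeriv (eDir i) (fun (_ : ℝ) (_ : Torus d) => (0 : ℝ)) t x = 0 := by simp [dirDeriv]
      rw [this, abs_zero]
      positivity

lemma abs_pertDensity_le (hn : n ≠ 0) (hA : 0 ≤ A) (hq : SmoothTorus q) (ha : SmoothOn univ a)
    {t : ℝ} {x : Torus d} (h : |dirDeriv (eDir m) a t x| ≤ C) :
    |pertDensity n c m q A a t x| ≤ A * (|a t x| * |osc n c (pderiv m q) t x|) +
      (n : ℝ)⁻¹ * C * (A * |osc n c q t x|) := by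
  rw [pertDensity, abs_mul, abs_of_nonneg hA]
  have := mul_le_mul_of_nonneg_left (abs_potential_deriv_le (c := c) hn hq ha h) hA
  linarith

/-- The pointwise bound on the error: the first term is the transport error, the second one gains
the factor `n⁻¹`, and the last one is small because the velocity perturbation is concentrated. -/
lemma abs_pertError_le {ρ : ℝ → Torus d → ℝ} {u : Fin d → ℝ → Torus d → ℝ}
    (hn : n ≠ 0) (hjm : m ≠ j) (hq : IsProfile j m M δ₀ p q A) (hM : 0 < M) (hC : 1 ≤ C)
    (ha : SmoothOn univ a) (hβ : SmoothOn univ β) {t : ℝ} {x : Torus d}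
    (ba : |a t x| ≤ C) (bβ : |β t x| ≤ C) (bρ : |ρ t x| ≤ C)
    (ba' : ∀ i, |dirDeriv (eDir i) a t x| ≤ C) (bβ' : ∀ i, |dirDeriv (eDir i) β t x| ≤ C)
    (bD : |dirDeriv (1, c) a t x| ≤ C)
    (bf : ∀ i, |dirDeriv (eDir i) (fun t x => a t x * β t x) t x| ≤ C) (k : Fin d)
    (bu : |u k t x - c k| ≤ C) :
    |pertError ρ u n c j m q A a β k t x| ≤
      A * (|a t x * (u k t x - c k)| * |osc n c (pderiv m q) t x|) +
      (n : ℝ)⁻¹ * (4 * C ^ 2 * (M + 1)) * (A * |osc n c q t x| + A * |osc n c (pderiv m q) t x| +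
        ∑ i, |osc n c (correctorField m q A i) t x|) +
      4 * C ^ 2 * (M + 1) * (|osc n c (pderiv m q) t x| + |osc n c q t x|) := by
  have hA := hq.pos.le
  have hn1 : (1 : ℝ) ≤ n := by exact_mod_cast Nat.one_le_iff_ne_zero.2 hn
  have hν1 : (n : ℝ)⁻¹ ≤ 1 := inv_le_one_of_one_le₀ hn1
  have hν0 : (0 : ℝ) ≤ (n : ℝ)⁻¹ := by positivity
  have hϑ := abs_pertDensity_le (c := c) hn hA hq.smooth ha (ba' m)
  have hw := abs_pertVelocity_le (c := c) hn hjm hq.smooth hq.invariant hβ bβ' k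
  have bψ : |osc n c (pderiv m q) t x| ≤ M := hq.bound_deriv _
  have bq : |osc n c q t x| ≤ M := hq.bound _
  have hfst := dirDeriv_transport_potential (n := n) (c := c) hq.smooth ha t x
  have hϑe := congrArg (A * ·) (dirDeriv_potential (c := c) hn hq.smooth ha m t x)
  have hwe := dirDeriv_potential (c := c) hn hq.smooth hβ m t x
  have hwj := dirDeriv_potential (c := c) hn hq.smooth hβ j t x
  have hzj : osc n c (pderiv j q) t x = 0 := pderiv_eq_zero_of_invariantIn hq.invariant _
  rw [hzj, mul_zero, zero_add] at hwj
  unfold pertError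
  set ψ := osc n c (pderiv m q) t x
  set q' := osc n c q t x
  set ν := (n : ℝ)⁻¹
  set S := ∑ i, |osc n c (correctorField m q A i) t x|
  have hS : 0 ≤ S := Finset.sum_nonneg fun i _ => abs_nonneg _
  have hBk : |osc n c (correctorField m q A k) t x| ≤ S :=
    Finset.single_le_sum (f := fun i => |osc n c (correctorField m q A i) t x|)
      (fun i _ => abs_nonneg _) (Finset.mem_univ k)
  have hC0 : 0 ≤ C := by linarith
  have hP := abs_nonneg ψ
  have hQ := abs_nonneg q'
  have hCC : C ≤ C ^ 2 := by nlinarith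
  have hCM : 0 ≤ C ^ 2 * M := by positivity
  have t1 : |if k = m then A * dirDeriv (1, c) (potential n c q a) t x else 0| ≤
      ν * C * (A * |q'|) := by
    split_ifs
    · rw [hfst, abs_mul, abs_mul, abs_of_nonneg hA, abs_of_nonneg hν0]
      have := mul_le_mul_of_nonneg_left (abs_mul_le_mul bD (le_refl |q'|))
        (mul_nonneg hA hν0)
      linarith
    · rw [abs_zero]; positivity
  have t2 : |pertDensity n c m q A a t x * (u k t x - c k)| ≤
      A * (|a t x * (u k t x - c k)| * |ψ|) + ν * C ^ 2 * (A * |q'|) := by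
    rw [abs_mul, abs_mul]
    have e1 := mul_le_mul_of_nonneg_right hϑ (abs_nonneg (u k t x - c k))
    have e2 := mul_le_mul_of_nonneg_left bu (by positivity : 0 ≤ ν * C * (A * |q'|))
    linarith
  have t3 : |ρ t x * pertVelocity n c j m q β k t x| ≤ C ^ 2 * (|ψ| + |q'|) := by
    have e1 : |pertVelocity n c j m q β k t x| ≤ C * |ψ| + C * |q'| := by
      refine hw.trans (add_le_add (by gcongr) ?_)
      exact mul_le_of_le_one_left (by positivity) hν1
    have := abs_mul_le_mul bρ e1
    linarith
  have t4 : |pertDensity n c m q A a t x * pertVelocity n c j m q β k t x -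
      if k = j then a t x * β t x * osc n c (fun x => A * pderiv m q x ^ 2) t x else 0| ≤
      ν * (C ^ 2 * M) * (A * |ψ| + 2 * (A * |q'|)) := by
    have hosc : osc n c (fun x => A * pderiv m q x ^ 2) t x = A * ψ ^ 2 := rfl
    have b1 := abs_mul_le_mul ba bβ
    have b2 := abs_mul_le_mul ba (bβ' m)
    have b2j := abs_mul_le_mul ba (bβ' j)
    have b3 := abs_mul_le_mul (ba' m) bβ
    have b4 := abs_mul_le_mul (ba' m) (bβ' m)
    have b4j := abs_mul_le_mul (ba' m) (bβ' j)
    have m1 : |ψ * q'| ≤ |ψ| * M := abs_mul_le_mul le_rfl bq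
    have m2 : |q' * ψ| ≤ |q'| * M := abs_mul_le_mul le_rfl bψ
    have m3 : |q' * q'| ≤ |q'| * M := abs_mul_le_mul le_rfl bq
    have νm3 : |ν * (q' * q')| ≤ |q'| * M := by
      rw [abs_mul, abs_of_nonneg hν0]
      exact (mul_le_of_le_one_left (abs_nonneg _) hν1).trans m3
    by_cases h1 : k = j
    · have hwk : pertVelocity n c j m q β k t x =
          β t x * ψ + ν * (dirDeriv (eDir m) β t x * q') := by
        rw [pertVelocity, if_pos h1, if_neg (by rw [h1]; exact hjm.symm), add_zero, hwe]
      rw [if_pos h1, hosc, hwk, pertDensity, hϑe]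
      have : A * (a t x * ψ + ν * (dirDeriv (eDir m) a t x * q')) *
          (β t x * ψ + ν * (dirDeriv (eDir m) β t x * q')) - a t x * β t x * (A * ψ ^ 2) =
          (ν * A) * ((a t x * dirDeriv (eDir m) β t x) * (ψ * q') +
            ((dirDeriv (eDir m) a t x * β t x) * (q' * ψ) +
            (dirDeriv (eDir m) a t x * dirDeriv (eDir m) β t x) * (ν * (q' * q')))) := by ring
      rw [this, abs_mul, abs_of_nonneg (mul_nonneg hν0 hA)]
      have e1 := abs_mul_le_mul b2 m1
      have e2 := abs_mul_le_mul b3 m2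
      have e3 := abs_mul_le_mul b4 νm3
      have e4 := (abs_add_le ((a t x * dirDeriv (eDir m) β t x) * (ψ * q'))
        ((dirDeriv (eDir m) a t x * β t x) * (q' * ψ) +
            (dirDeriv (eDir m) a t x * dirDeriv (eDir m) β t x) * (ν * (q' * q')))).trans
        (add_le_add le_rfl (abs_add_le _ _))
      calc ν * A * _ ≤ ν * A * (C * C * (|ψ| * M) + (C * C * (|q'| * M) + C * C * (|q'| * M))) := by
            refine mul_le_mul_of_nonneg_left ?_ (mul_nonneg hν0 hA)
            linarith
        _ = _ := by ring
    · rw [if_neg h1, sub_zero]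
      by_cases h2 : k = m
      · have hwk : pertVelocity n c j m q β k t x = -(ν * (dirDeriv (eDir j) β t x * q')) := by
          rw [pertVelocity, if_neg h1, if_pos h2, zero_add, hwj]
        rw [hwk, pertDensity, hϑe]
        have : A * (a t x * ψ + ν * (dirDeriv (eDir m) a t x * q')) *
            -(ν * (dirDeriv (eDir j) β t x * q')) =
            -((ν * A) * ((a t x * dirDeriv (eDir j) β t x) * (ψ * q') +
              (dirDeriv (eDir m) a t x * dirDeriv (eDir j) β t x) * (ν * (q' * q')))) := by ring
        rw [this, abs_neg, abs_mul, abs_of_nonneg (mul_nonneg hν0 hA)]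
        have e1 := abs_mul_le_mul b2j m1
        have e3 := abs_mul_le_mul b4j νm3
        have e4 := abs_add_le ((a t x * dirDeriv (eDir j) β t x) * (ψ * q'))
          ((dirDeriv (eDir m) a t x * dirDeriv (eDir j) β t x) * (ν * (q' * q')))
        have e5 : 0 ≤ C * C * (|q'| * M) := by positivity
        calc ν * A * _
            ≤ ν * A * (C * C * (|ψ| * M) + (C * C * (|q'| * M) + C * C * (|q'| * M))) := by
              refine mul_le_mul_of_nonneg_left ?_ (mul_nonneg hν0 hA)
              linarith
          _ = _ := by ring
      · rw [pertVelocity, if_neg h1, if_neg h2, add_zero, mul_zero, abs_zero]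
        positivity
  have t5 : |ν * (dirDeriv (eDir j) (fun t x => a t x * β t x) t x *
      osc n c (correctorField m q A k) t x -
      if k = j then ∑ i, dirDeriv (eDir i) (fun t x => a t x * β t x) t x *
      osc n c (correctorField m q A i) t x else 0)| ≤ ν * (2 * C) * S := by
    rw [abs_mul, abs_of_nonneg hν0, mul_assoc]
    refine mul_le_mul_of_nonneg_left ?_ hν0
    refine (abs_sub _ _).trans ?_
    have e1 := (abs_mul_le_mul (bf j) hBk)
    have e2 : |if k = j then ∑ i, dirDeriv (eDir i) (fun t x => a t x * β t x) t x *
        osc n c (correctorField m q A i) t x else 0| ≤ C * S := by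
      split_ifs
      · refine (Finset.abs_sum_le_sum_abs _ _).trans ?_
        rw [Finset.mul_sum]
        exact Finset.sum_le_sum fun i _ => abs_mul_le_mul (bf i) le_rfl
      · rw [abs_zero]; positivity
    linarith
  refine (abs_add_five_le t1 t2 t3 t4 t5).trans ?_
  have hAQ : 0 ≤ ν * (A * |q'|) := by positivity
  have hAP : 0 ≤ ν * (A * |ψ|) := by positivity
  have hνS : 0 ≤ ν * S := by positivity
  have f1 : (C + C ^ 2 + 2 * (C ^ 2 * M)) * (ν * (A * |q'|)) ≤
      (4 * C ^ 2 * (M + 1)) * (ν * (A * |q'|)) := by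
    refine mul_le_mul_of_nonneg_right ?_ hAQ
    linarith
  have f2 : (C ^ 2 * M) * (ν * (A * |ψ|)) ≤ (4 * C ^ 2 * (M + 1)) * (ν * (A * |ψ|)) := by
    refine mul_le_mul_of_nonneg_right ?_ hAP
    linarith
  have f3 : (2 * C) * (ν * S) ≤ (4 * C ^ 2 * (M + 1)) * (ν * S) := by
    refine mul_le_mul_of_nonneg_right ?_ hνS
    linarith
  have f4 : C ^ 2 * (|ψ| + |q'|) ≤ 4 * C ^ 2 * (M + 1) * (|ψ| + |q'|) := by
    refine mul_le_mul_of_nonneg_right ?_ (by positivity)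
    linarith
  linarith

end

end ContinuityEq

namespace ContinuityEq

variable {d : ℕ}

/-! ### Existence of perturbations -/

/-- An `L^p` bound from a pointwise bound by four functions. -/
lemma eLpNorm_le_four {f g₁ g₂ g₃ g₄ : Torus d → ℝ} {p : ℝ≥0∞} (hp : 1 ≤ p) {B δ : ℝ} (hB : 0 ≤ B)
    (hδ : 0 ≤ δ) (c₁ : Continuous g₁) (c₂ : Continuous g₂) (c₃ : Continuous g₃) (c₄ : Continuous g₄)
    (h : ∀ x, |f x| ≤ B * (|g₁ x| + |g₂ x| + |g₃ x| + |g₄ x|))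
    (h₁ : eLpNorm g₁ p volume ≤ ENNReal.ofReal δ) (h₂ : eLpNorm g₂ p volume ≤ ENNReal.ofReal δ)
    (h₃ : eLpNorm g₃ p volume ≤ ENNReal.ofReal δ) (h₄ : eLpNorm g₄ p volume ≤ ENNReal.ofReal δ) :
    eLpNorm f p volume ≤ ENNReal.ofReal (B * (4 * δ)) := by
  have e : ∀ g : Torus d → ℝ, eLpNorm (fun x => |g x|) p volume = eLpNorm g p volume :=
    fun g => eLpNorm_norm g
  have m₁ := c₁.abs.aestronglyMeasurable (μ := (volume : Measure (Torus d)))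
  have m₂ := c₂.abs.aestronglyMeasurable (μ := (volume : Measure (Torus d)))
  have m₃ := c₃.abs.aestronglyMeasurable (μ := (volume : Measure (Torus d)))
  have m₄ := c₄.abs.aestronglyMeasurable (μ := (volume : Measure (Torus d)))
  have step : eLpNorm (fun x => |g₁ x| + |g₂ x| + |g₃ x| + |g₄ x|) p volume ≤
      ENNReal.ofReal (4 * δ) := by
    refine (eLpNorm_add_le ((m₁.add m₂).add m₃) m₄ hp).trans ?_
    refine (add_le_add ((eLpNorm_add_le (m₁.add m₂) m₃ hp).trans
      (add_le_add (eLpNorm_add_le m₁ m₂ hp) le_rfl)) le_rfl).trans ?_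
    rw [e, e, e, e]
    have : ENNReal.ofReal (4 * δ) =
        ENNReal.ofReal δ + ENNReal.ofReal δ + ENNReal.ofReal δ + ENNReal.ofReal δ := by
      rw [← ENNReal.ofReal_add hδ hδ, ← ENNReal.ofReal_add (by positivity) hδ,
        ← ENNReal.ofReal_add (by positivity) hδ]
      congr 1; ring
    rw [this]
    gcongr
  refine (eLpNorm_mono_real h).trans ?_
  have : eLpNorm (fun x => B * (|g₁ x| + |g₂ x| + |g₃ x| + |g₄ x|)) p volume =
      ‖B‖ₑ * eLpNorm (fun x => |g₁ x| + |g₂ x| + |g₃ x| + |g₄ x|) p volume :=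
    eLpNorm_const_smul B _ p volume
  rw [this, Real.enorm_of_nonneg hB, ENNReal.ofReal_mul hB]
  gcongr

/-- A single block can be added with arbitrarily small errors. The frequency `n` is fixed first,
from the moduli of continuity of the coefficients; the concentration of the profile is taken large
depending on `n`. -/
lemma exists_perturbation_single (hd : 3 ≤ d) : ∃ K : ℝ, 0 < K ∧ ∀ (b : Block d)
    (ρ : ℝ → Torus d → ℝ) (u R : Fin d → ℝ → Torus d → ℝ), IsSub ρ u R →
    ∀ p : ℝ≥0∞, 1 ≤ p → p < (d : ℝ≥0∞) - 1 → ∀ δ : ℝ, 0 < δ →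
    ∃ ϑ w F, IsPerturbation K δ p [b] ρ u R ϑ w F := by
  obtain ⟨M, hM, hprof⟩ := exists_profile d
  refine ⟨M, hM, ?_⟩
  rintro ⟨j, a, β, c, ha, hβ⟩ ρ u R hsub p hp hpd δ hδ
  have : Nontrivial (Fin d) := Fin.nontrivial_iff_two_le.2 (by omega)
  obtain ⟨m, hjm⟩ := exists_ne j
  have cu : ∀ k, Continuous fun z : ℝ × Torus d => u k z.1 z.2 - c k := fun k =>
    (hsub.cont_velocity k).sub continuous_const
  obtain ⟨C1, k1, b1⟩ := exists_bound_Icc (fun _ : Unit => ρ) fun _ => hsub.cont_density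
  obtain ⟨C2, k2, b2⟩ := exists_bound_Icc (fun _ : Unit => a) fun _ => ha.continuous
  obtain ⟨C3, k3, b3⟩ := exists_bound_Icc (fun _ : Unit => β) fun _ => hβ.continuous
  obtain ⟨C4, k4, b4⟩ := exists_bound_Icc (fun _ : Unit => dirDeriv (1, c) a) fun _ =>
    (ha.dirDeriv _).continuous
  obtain ⟨C5, k5, b5⟩ := exists_bound_Icc (fun i : Fin d => dirDeriv (eDir i) a) fun _ =>
    (ha.dirDeriv _).continuous
  obtain ⟨C6, k6, b6⟩ := exists_bound_Icc (fun i : Fin d => dirDeriv (eDir i) β) fun _ =>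
    (hβ.dirDeriv _).continuous
  obtain ⟨C7, k7, b7⟩ := exists_bound_Icc
    (fun i : Fin d => dirDeriv (eDir i) (fun t x => a t x * β t x)) fun _ =>
    ((ha.mul hβ).dirDeriv _).continuous
  obtain ⟨C8, k8, b8⟩ := exists_bound_Icc (fun k : Fin d => fun t x => u k t x - c k) cu
  obtain ⟨C9, k9, b9⟩ := exists_bound_Icc
    (fun i : Fin d × Fin d => dirDeriv (eDir i.1) (dirDeriv (eDir i.2) β)) fun _ =>
    ((hβ.dirDeriv _).dirDeriv _).continuous
  obtain ⟨C, hC⟩ : ∃ C, C = C1 + C2 + C3 + C4 + C5 + C6 + C7 + C8 + C9 := ⟨_, rfl⟩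
  have hC1 : 1 ≤ C := by linarith
  have hC0 : 0 < C := by linarith
  -- the constants of the smallness conditions
  obtain ⟨C', hC'⟩ : ∃ C', C' = 4 * C ^ 2 * (M + 1) := ⟨_, rfl⟩
  have hC'0 : 0 < C' := by rw [hC']; positivity
  obtain ⟨T, hT⟩ : ∃ T, T = C * M + C' * (M + M + d * d) := ⟨_, rfl⟩
  have hT0 : 0 < T := by rw [hT]; positivity
  -- the frequency, chosen before the concentration of the profile
  obtain ⟨N1, hN1⟩ := exists_integral_abs_mul_le ha.continuous (δ := δ / (4 * M)) (by positivity)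
  have hN2 := fun k => exists_integral_abs_mul_le (f := fun t x => a t x * (u k t x - c k))
    (ha.continuous.mul (cu k)) (δ := δ / (4 * M)) (by positivity)
  choose N2 hN2 using hN2
  obtain ⟨N3, hN3⟩ := exists_nat_ge (4 * T / δ)
  obtain ⟨n, hn⟩ : ∃ n, n = N1 + ∑ k, N2 k + N3 + 1 := ⟨_, rfl⟩
  have hn0 : n ≠ 0 := by omega
  have hn1 : (1 : ℝ) ≤ n := by exact_mod_cast Nat.one_le_iff_ne_zero.2 hn0
  have hnN1 : N1 ≤ n := by omega
  have hnN2 : ∀ k, N2 k ≤ n := fun k => by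
    have := Finset.single_le_sum (f := N2) (fun i _ => Nat.zero_le _) (Finset.mem_univ k)
    omega
  have hνT : (n : ℝ)⁻¹ * T ≤ δ / 4 := by
    have h1 : 4 * T / δ ≤ n := hN3.trans (by exact_mod_cast (by omega : N3 ≤ n))
    rw [div_le_iff₀ hδ] at h1
    rw [inv_mul_le_iff₀ (by linarith)]
    linarith
  have hν0 : (0 : ℝ) < (n : ℝ)⁻¹ := by positivity
  have hν1 : (n : ℝ)⁻¹ ≤ 1 := inv_le_one_of_one_le₀ hn1
  -- the size of the profile in `L^p` and `W^(1,p)`, chosen after the frequency `n`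
  obtain ⟨δ₀, hδ₀⟩ : ∃ δ₀, δ₀ = δ / (4 * (n * C) + 8 * C') := ⟨_, rfl⟩
  have hδ₀0 : 0 < δ₀ := by rw [hδ₀]; positivity
  have hδ₀e : δ₀ * (4 * (n * C) + 8 * C') = δ := by rw [hδ₀]; field_simp
  have hδ₀a : n * C * (4 * δ₀) ≤ δ := by
    have : 0 ≤ δ₀ * (8 * C') := by positivity
    linarith
  have hδ₀b : C' * (δ₀ + δ₀) ≤ δ / 4 := by
    have : 0 ≤ δ₀ * (4 * (n * C)) := by positivity
    linarith
  obtain ⟨q, A, hq⟩ := hprof j m hjm p hp hpd δ₀ hδ₀0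
  have cψ := (hq.smooth.pderiv m).continuous
  have cq := hq.smooth.continuous
  have cTψ : ∀ t, Continuous (osc n c (pderiv m q) t) := fun t =>
    (smoothOn_osc n c (hq.smooth.pderiv m)).continuous_slice t
  have cTq : ∀ t, Continuous (osc n c q t) := fun t =>
    (smoothOn_osc n c hq.smooth).continuous_slice t
  have cTB : ∀ i t, Continuous (osc n c (correctorField m q A i) t) := fun i t =>
    (continuous_osc n c (continuous_correctorField hq.smooth i)).comp (Continuous.prodMk_right t)
  have iψ : ∀ t, ∫ x, |osc n c (pderiv m q) t x| = ∫ x, |pderiv m q x| := integral_abs_osc hn0 c cψ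
  have iq : ∀ t, ∫ x, |osc n c q t x| = ∫ x, |q x| := integral_abs_osc hn0 c cq
  have sψ : ∫ x, |pderiv m q x| ≤ δ₀ :=
    integral_norm_le_of_eLpNorm_le cψ hp hδ₀0.le (hq.small_deriv m)
  have sq : ∫ x, |q x| ≤ δ₀ := integral_norm_le_of_eLpNorm_le cq hp hδ₀0.le hq.small
  have hA := hq.pos
  have hδM : δ / (4 * M) * M = δ / 4 := by field_simp
  have sϑ := smoothOn_pertDensity (n := n) (c := c) (m := m) (A := A) hq.smooth ha
  have sw := fun k => smoothOn_pertVelocity (n := n) (c := c) (j := j) (m := m) hq.smooth hβ k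
  have cE := fun k => continuous_pertError (n := n) (c := c) (j := j) (m := m) (A := A)
    hsub.cont_density hsub.cont_velocity hq.smooth ha hβ k
  -- a product with the concentrated density profile
  have holder : ∀ {f : ℝ → Torus d → ℝ} {t : ℝ},
      ∫ x, |f t x| * |pderiv m q (n • x - proj ((n * t) • c))| ≤
        ((∫ x, |f t x|) + δ / (4 * M)) * ∫ x, |pderiv m q x| →
      A * ∫ x, |f t x| * |osc n c (pderiv m q) t x| ≤ M * (∫ x, |f t x|) + δ / 4 := by
    intro f t h
    have h1 := mul_le_mul_of_nonneg_left h hA.le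
    have h2 : 0 ≤ ∫ x, |f t x| := integral_nonneg fun x => abs_nonneg _
    have h3 := mul_le_mul_of_nonneg_left hq.integral_deriv_le
      (by positivity : 0 ≤ (∫ x, |f t x|) + δ / (4 * M))
    calc _ ≤ _ := h1
      _ = ((∫ x, |f t x|) + δ / (4 * M)) * (A * ∫ x, |pderiv m q x|) := by ring
      _ ≤ _ := h3
      _ = M * (∫ x, |f t x|) + δ / (4 * M) * M := by ring
      _ = _ := by rw [hδM]
  refine ⟨pertDensity n c m q A a, pertVelocity n c j m q β, pertError ρ u n c j m q A a β,
    ?_, sϑ, sw, cE, ?_, ?_, ?_, ?_, ?_, ?_⟩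
  · have := hsub.perturb (c := c) hn0 hq.smooth hq.invariant hq.normalized ha hβ
    simpa [Block.flux] using this
  · intro t ht
    simp only [List.map_cons, List.map_nil, List.sum_cons, List.sum_nil, add_zero]
    have h1 := holder (hN1 n hnN1 (pderiv m q) cψ t ht (proj ((n * t) • c)))
    have h2 : ∫ x, |pertDensity n c m q A a t x| ≤
        ∫ x, (A * (|a t x| * |osc n c (pderiv m q) t x|) +
          (n : ℝ)⁻¹ * C * (A * |osc n c q t x|)) := by
      refine integral_mono (integrable_of_continuous (sϑ.continuous_slice t).abs)
        (integrable_of_continuous ?_) fun x => ?_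
      · exact (continuous_const.mul ((ha.continuous_slice t).abs.mul (cTψ t).abs)).add
          (continuous_const.mul (continuous_const.mul (cTq t).abs))
      · exact abs_pertDensity_le hn0 hA.le hq.smooth ha ((b5 m t ht x).trans (by linarith))
    have h2' : ∫ x, (A * (|a t x| * |osc n c (pderiv m q) t x|) +
        (n : ℝ)⁻¹ * C * (A * |osc n c q t x|)) =
        A * (∫ x, |a t x| * |osc n c (pderiv m q) t x|) +
        (n : ℝ)⁻¹ * C * (A * ∫ x, |q x|) := by
      rw [integral_add, integral_const_mul, integral_const_mul, integral_const_mul, iq]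
      · exact integrable_of_continuous
          (continuous_const.mul ((ha.continuous_slice t).abs.mul (cTψ t).abs))
      · exact integrable_of_continuous (continuous_const.mul (continuous_const.mul (cTq t).abs))
    rw [h2'] at h2
    have h3 := mul_le_mul_of_nonneg_left hq.integral_le (by positivity : 0 ≤ (n : ℝ)⁻¹ * C)
    have h4 : (n : ℝ)⁻¹ * (C * M) ≤ (n : ℝ)⁻¹ * T := by
      refine mul_le_mul_of_nonneg_left ?_ hν0.le
      rw [hT]
      have : 0 ≤ C' * (M + M + d * d) := by positivity
      linarith
    linarith
  · intro t ht x k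
    simp only [List.map_cons, List.map_nil, List.sum_cons, List.sum_nil, add_zero]
    have h1 := abs_pertVelocity_le (n := n) (c := c) (C := C) hn0 hjm hq.smooth hq.invariant hβ
      (t := t) (x := x) (fun i => (b6 i t ht x).trans (by linarith)) k
    have h2 : |osc n c (pderiv m q) t x| ≤ M := hq.bound_deriv _
    have h3 : |osc n c q t x| ≤ M := hq.bound _
    have h4 : (n : ℝ)⁻¹ * (C * M) ≤ (n : ℝ)⁻¹ * T := by
      refine mul_le_mul_of_nonneg_left ?_ hν0.le
      rw [hT]
      have : 0 ≤ C' * (M + M + d * d) := by positivity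
      linarith
    have h5 : |β t x| * |osc n c (pderiv m q) t x| ≤ |β t x| * M := by gcongr
    have h6 : (n : ℝ)⁻¹ * (C * |osc n c q t x|) ≤ (n : ℝ)⁻¹ * (C * M) := by gcongr
    linarith
  · intro t ht k
    refine (eLpNorm_le_four (B := n * C) (δ := δ₀) hp (by positivity) hδ₀0.le (cTψ t) (cTq t)
      (continuous_const (y := (0 : ℝ))) (continuous_const (y := (0 : ℝ))) (fun x => ?_)
      ?_ ?_ (by simp) (by simp)).trans (ENNReal.ofReal_le_ofReal hδ₀a)
    · have h1 := abs_pertVelocity_le (n := n) (c := c) (C := C) hn0 hjm hq.smooth hq.invariant hβ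
        (t := t) (x := x) (fun i => (b6 i t ht x).trans (by linarith)) k
      have hCn : C ≤ n * C := le_mul_of_one_le_left hC0.le hn1
      have h2 : |β t x| * |osc n c (pderiv m q) t x| ≤ n * C * |osc n c (pderiv m q) t x| := by
        gcongr
        exact ((b3 () t ht x).trans (by linarith)).trans hCn
      have h3 : (n : ℝ)⁻¹ * (C * |osc n c q t x|) ≤ n * C * |osc n c q t x| :=
        (mul_le_of_le_one_left (by positivity) hν1).trans (by gcongr)
      simp only [abs_zero, add_zero]
      linarith
    · rw [eLpNorm_osc hn0 c cψ]; exact hq.small_deriv m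
    · rw [eLpNorm_osc hn0 c cq]; exact hq.small
  · intro t ht k i
    refine (eLpNorm_le_four (B := n * C) (δ := δ₀) hp (by positivity) hδ₀0.le
      ((smoothOn_osc n c ((hq.smooth.pderiv m).pderiv i)).continuous_slice t) (cTψ t)
      ((smoothOn_osc n c (hq.smooth.pderiv i)).continuous_slice t) (cTq t) (fun x => ?_)
      ?_ ?_ ?_ ?_).trans (ENNReal.ofReal_le_ofReal hδ₀a)
    · exact abs_gradient_pertVelocity_le hn0 hjm hq.smooth hq.invariant hβ
        ((b3 () t ht x).trans (by linarith)) (fun i => (b6 i t ht x).trans (by linarith))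
        (fun i l => (b9 (i, l) t ht x).trans (by linarith)) i k
    · rw [eLpNorm_osc hn0 c ((hq.smooth.pderiv m).pderiv i).continuous]
      exact hq.small_deriv_deriv i
    · rw [eLpNorm_osc hn0 c cψ]; exact hq.small_deriv m
    · rw [eLpNorm_osc hn0 c (hq.smooth.pderiv i).continuous]; exact hq.small_deriv i
    · rw [eLpNorm_osc hn0 c cq]; exact hq.small
  · intro t ht k
    simp only [List.map_cons, List.map_nil, List.sum_cons, List.sum_nil, add_zero]
    have h1 := holder (f := fun t x => a t x * (u k t x - c k))
      (hN2 k n (hnN2 k) (pderiv m q) cψ t ht (proj ((n * t) • c)))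
    have cau : Continuous fun x => a t x * (u k t x - c k) :=
      (ha.continuous.mul (cu k)).comp (Continuous.prodMk_right t)
    have cS : Continuous fun x => ∑ i, |osc n c (correctorField m q A i) t x| :=
      continuous_finsetSum _ fun i _ => (cTB i t).abs
    have g1 : Continuous fun x => A * (|a t x * (u k t x - c k)| * |osc n c (pderiv m q) t x|) :=
      continuous_const.mul (cau.abs.mul (cTψ t).abs)
    have g2 : Continuous fun x => A * |osc n c q t x| + A * |osc n c (pderiv m q) t x| +
        ∑ i, |osc n c (correctorField m q A i) t x| :=
      ((continuous_const.mul (cTq t).abs).add (continuous_const.mul (cTψ t).abs)).add cS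
    have g3 : Continuous fun x => |osc n c (pderiv m q) t x| + |osc n c q t x| :=
      (cTψ t).abs.add (cTq t).abs
    have h2 : ∫ x, |pertError ρ u n c j m q A a β k t x| ≤
        ∫ x, (A * (|a t x * (u k t x - c k)| * |osc n c (pderiv m q) t x|) +
          (n : ℝ)⁻¹ * C' * (A * |osc n c q t x| + A * |osc n c (pderiv m q) t x| +
            ∑ i, |osc n c (correctorField m q A i) t x|) +
          C' * (|osc n c (pderiv m q) t x| + |osc n c q t x|)) := by
      refine integral_mono (integrable_of_continuous
        ((cE k).comp (Continuous.prodMk_right t)).abs) (integrable_of_continuous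
        ((g1.add (continuous_const.mul g2)).add (continuous_const.mul g3))) fun x => ?_
      rw [hC']
      exact abs_pertError_le hn0 hjm hq hM hC1 ha hβ ((b2 () t ht x).trans (by linarith))
        ((b3 () t ht x).trans (by linarith)) ((b1 () t ht x).trans (by linarith))
        (fun i => (b5 i t ht x).trans (by linarith)) (fun i => (b6 i t ht x).trans (by linarith))
        ((b4 () t ht x).trans (by linarith)) (fun i => (b7 i t ht x).trans (by linarith)) k
        ((b8 k t ht x).trans (by linarith))
    have i1 := integrable_of_continuous g1
    have i2 := integrable_of_continuous (continuous_const (y := (n : ℝ)⁻¹ * C').mul g2)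
    have i3 := integrable_of_continuous (continuous_const (y := C').mul g3)
    have e2 : ∫ x, (A * |osc n c q t x| + A * |osc n c (pderiv m q) t x| +
        ∑ i, |osc n c (correctorField m q A i) t x|) ≤ M + M + d * d := by
      have j1 := integrable_of_continuous (continuous_const (y := A).mul (cTq t).abs)
      have j2 := integrable_of_continuous (continuous_const (y := A).mul (cTψ t).abs)
      have j3 := integrable_of_continuous cS
      rw [integral_add (f := fun x => A * |osc n c q t x| + A * |osc n c (pderiv m q) t x|)
        (j1.add j2) j3, integral_add (f := fun x => A * |osc n c q t x|)
        (g := fun x => A * |osc n c (pderiv m q) t x|) j1 j2, integral_const_mul,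
        integral_const_mul, iq, iψ,
        integral_finsetSum _ fun i _ => integrable_of_continuous (cTB i t).abs]
      refine add_le_add (add_le_add hq.integral_le hq.integral_deriv_le) ?_
      calc ∑ i, ∫ x, |osc n c (correctorField m q A i) t x| ≤ ∑ _i : Fin d, (d : ℝ) := by
            refine Finset.sum_le_sum fun i _ => ?_
            rw [integral_abs_osc hn0 c (continuous_correctorField hq.smooth i)]
            exact integral_abs_correctorField_le hq.smooth hA hq.normalized i
        _ = d * d := by simp
    have e3 : ∫ x, (|osc n c (pderiv m q) t x| + |osc n c q t x|) ≤ δ₀ + δ₀ := by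
      rw [integral_add (integrable_of_continuous (cTψ t).abs)
        (integrable_of_continuous (cTq t).abs), iψ, iq]
      exact add_le_add sψ sq
    rw [integral_add (f := fun x => A * (|a t x * (u k t x - c k)| * |osc n c (pderiv m q) t x|) +
          (n : ℝ)⁻¹ * C' * (A * |osc n c q t x| + A * |osc n c (pderiv m q) t x| +
            ∑ i, |osc n c (correctorField m q A i) t x|))
          (g := fun x => C' * (|osc n c (pderiv m q) t x| + |osc n c q t x|)) (i1.add i2) i3,
      integral_add (f := fun x => A * (|a t x * (u k t x - c k)| * |osc n c (pderiv m q) t x|))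
        (g := fun x => (n : ℝ)⁻¹ * C' * (A * |osc n c q t x| + A * |osc n c (pderiv m q) t x| +
            ∑ i, |osc n c (correctorField m q A i) t x|)) i1 i2,
      integral_const_mul, integral_const_mul, integral_const_mul] at h2
    have f2 := mul_le_mul_of_nonneg_left e2 (by positivity : 0 ≤ (n : ℝ)⁻¹ * C')
    have f3 := mul_le_mul_of_nonneg_left e3 hC'0.le
    have h4 : (n : ℝ)⁻¹ * (C' * (M + M + d * d)) ≤ (n : ℝ)⁻¹ * T := by
      refine mul_le_mul_of_nonneg_left ?_ hν0.le
      rw [hT]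
      have : 0 ≤ C * M := by positivity
      linarith
    linarith
  · intro t hv
    obtain ⟨v1, v2, v3⟩ := hv _ (List.mem_singleton.2 rfl)
    simp only at v1 v2 v3
    have va := fun i x => dirDeriv_eDir_eq_zero (i := i) (x := x) v1
    have vβ := fun i x => dirDeriv_eDir_eq_zero (i := i) (x := x) v2
    have vf : ∀ i x, dirDeriv (eDir i) (fun t x => a t x * β t x) t x = 0 := fun i x => by
      rw [ha.dirDeriv_mul hβ, v1, v2]; simp
    have vD : ∀ x, dirDeriv (1, c) a t x = 0 := fun x => by
      rw [ha.dirDeriv_linear]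
      simp only [v3]
      simpa using Finset.sum_eq_zero fun i _ => by
        have := va i x
        rw [eDir] at this
        rw [this, mul_zero]
    have wϑ : ∀ x, pertDensity n c m q A a t x = 0 := fun x => by
      rw [pertDensity, dirDeriv_potential hn0 hq.smooth ha, v1, va]; simp
    have ww : ∀ k x, pertVelocity n c j m q β k t x = 0 := fun k x => by
      rw [pertVelocity, dirDeriv_potential hn0 hq.smooth hβ,
        dirDeriv_potential hn0 hq.smooth hβ, v2, vβ, vβ]; simp
    refine ⟨wϑ, ww, fun k x => ?_⟩
    rw [pertError, wϑ, ww, v1, dirDeriv_transport_potential hq.smooth ha, vD]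
    simp [vf]

/-- The transport errors of a list of blocks change little when a field which is small in `L¹` is
added to the velocity. -/
lemma exists_sum_integral_le (L : List (Block d)) : ∃ C : ℝ, 0 ≤ C ∧ ∀ t ∈ Icc (0 : ℝ) 1,
    ∀ k, ∀ f g : Torus d → ℝ, Continuous f → Continuous g →
      (L.map fun b => ∫ x, |b.amp t x * (f x + g x - b.speed k)|).sum ≤
        (L.map fun b => ∫ x, |b.amp t x * (f x - b.speed k)|).sum + C * ∫ x, |g x| := by
  induction L with
  | nil => exact ⟨0, le_rfl, by simp⟩
  | cons b L ih =>
    obtain ⟨C₁, h₁, hb⟩ := exists_bound_Icc (fun _ : Unit => b.amp) fun _ => b.smooth_amp.continuous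
    obtain ⟨C₂, h₂, hL⟩ := ih
    refine ⟨C₁ + C₂, by linarith, fun t ht k f g cf cg => ?_⟩
    have ca := b.smooth_amp.continuous_slice t
    have e₁ : ∫ x, |b.amp t x * (f x + g x - b.speed k)| ≤
        ∫ x, (|b.amp t x * (f x - b.speed k)| + C₁ * |g x|) := by
      refine integral_mono (integrable_of_continuous (by fun_prop))
        (integrable_of_continuous (by fun_prop)) fun x => ?_
      have e : b.amp t x * (f x + g x - b.speed k) =
          b.amp t x * (f x - b.speed k) + b.amp t x * g x := by ring
      simp only [e]
      exact (abs_add_le _ _).trans (add_le_add le_rfl (abs_mul_le_mul (hb () t ht x) le_rfl))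
    have e₂ : ∫ x, (|b.amp t x * (f x - b.speed k)| + C₁ * |g x|) =
        (∫ x, |b.amp t x * (f x - b.speed k)|) + C₁ * ∫ x, |g x| := by
      rw [integral_add, integral_const_mul]
      · exact integrable_of_continuous (by fun_prop)
      · exact integrable_of_continuous (by fun_prop)
    have e₃ := hL t ht k f g cf cg
    simp only [List.map_cons, List.sum_cons]
    linarith

/-- Finitely many blocks can be added one after the other: the velocity perturbations added before
are small in `L¹` and do not disturb the following steps. -/
lemma exists_perturbation (hd : 3 ≤ d) : ∃ K : ℝ, 0 < K ∧ ∀ (L : List (Block d))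
    (ρ : ℝ → Torus d → ℝ) (u R : Fin d → ℝ → Torus d → ℝ), IsSub ρ u R →
    ∀ p : ℝ≥0∞, 1 ≤ p → p < (d : ℝ≥0∞) - 1 → ∀ δ : ℝ, 0 < δ →
    ∃ ϑ w F, IsPerturbation K δ p L ρ u R ϑ w F := by
  obtain ⟨K, hK, single⟩ := exists_perturbation_single hd
  refine ⟨K, hK, fun L => ?_⟩
  induction L with
  | nil =>
    intro ρ u R h p hp hpd δ hδ
    refine ⟨fun _ _ => 0, fun _ _ _ => 0, fun _ _ _ => 0, ?_, SmoothOn.const 0,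
      fun _ => SmoothOn.const 0, fun _ => continuous_const, ?_, ?_, ?_, ?_, ?_, ?_⟩
    · simpa using h
    · intro t _; simpa using hδ.le
    · intro t _ x k; simpa using hδ.le
    · intro t _ k; simp
    · intro t _ k i
      have : dirDeriv (eDir i) (fun (_ : ℝ) (_ : Torus d) => (0 : ℝ)) t = fun _ => 0 := by
        ext x; simp [dirDeriv]
      rw [this]; simp
    · intro t _ k; simpa using hδ.le
    · intro t _; exact ⟨fun _ => rfl, fun _ _ => rfl, fun _ _ => rfl⟩
  | cons b L ih =>
    intro ρ u R h p hp hpd δ hδ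
    obtain ⟨C, hC0, hC⟩ := exists_sum_integral_le L
    obtain ⟨δ₁, hδ₁⟩ : ∃ δ₁, δ₁ = δ / (2 * (K * C + 1)) := ⟨_, rfl⟩
    have hδ₁0 : 0 < δ₁ := by rw [hδ₁]; positivity
    have hδ₁e : K * (C * δ₁) + δ₁ = δ / 2 := by rw [hδ₁]; field_simp
    have hδ₁2 : δ₁ ≤ δ / 2 := by
      have : 0 ≤ K * (C * δ₁) := by positivity
      linarith
    obtain ⟨ϑ₁, w₁, F₁, h₁⟩ := single b ρ u R h p hp hpd δ₁ hδ₁0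
    obtain ⟨ϑ₂, w₂, F₂, h₂⟩ := ih _ _ _ h₁.isSub p hp hpd (δ / 2) (by positivity)
    have hsum : ENNReal.ofReal δ₁ + ENNReal.ofReal (δ / 2) ≤ ENNReal.ofReal δ := by
      rw [← ENNReal.ofReal_add hδ₁0.le (by positivity)]
      exact ENNReal.ofReal_le_ofReal (by linarith)
    have cs : ∀ {f : ℝ → Torus d → ℝ} (t : ℝ), SmoothOn univ f → Integrable (fun x => |f t x|) :=
      fun t hf => integrable_of_continuous (hf.continuous_slice t).abs
    have cF : ∀ {f : ℝ → Torus d → ℝ} (t : ℝ), (Continuous fun z : ℝ × Torus d => f z.1 z.2) →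
        Integrable (fun x => |f t x|) :=
      fun t hf => integrable_of_continuous (hf.comp (Continuous.prodMk_right t)).abs
    refine ⟨fun t x => ϑ₁ t x + ϑ₂ t x, fun k t x => w₁ k t x + w₂ k t x,
      fun k t x => F₁ k t x + F₂ k t x, ?_, h₁.smooth_density.add h₂.smooth_density,
      fun k => (h₁.smooth_velocity k).add (h₂.smooth_velocity k),
      fun k => (h₁.cont_error k).add (h₂.cont_error k), ?_, ?_, ?_, ?_, ?_, ?_⟩
    · have := h₂.isSub
      simp only [List.map_cons, List.map_nil, List.sum_cons, List.sum_nil, add_zero] at this ⊢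
      convert this using 3 <;> first | ring1 | (funext x; ring1)
    · intro t ht
      have e₁ := h₁.density_le t ht
      have e₂ := h₂.density_le t ht
      have e₃ := integral_mono (integrable_of_continuous (((h₁.smooth_density.add
        h₂.smooth_density).continuous_slice t).abs))
        ((cs t h₁.smooth_density).add (cs t h₂.smooth_density))
        fun x => abs_add_le (ϑ₁ t x) (ϑ₂ t x)
      have e₄ := integral_add (cs t h₁.smooth_density) (cs t h₂.smooth_density)
      simp only [List.map_cons, List.map_nil, List.sum_cons, List.sum_nil, add_zero,
        Pi.add_apply] at e₁ e₂ e₃ ⊢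
      linarith
    · intro t ht x k
      have e₁ := h₁.velocity_le t ht x k
      have e₂ := h₂.velocity_le t ht x k
      have e₃ := abs_add_le (w₁ k t x) (w₂ k t x)
      simp only [List.map_cons, List.map_nil, List.sum_cons, List.sum_nil, add_zero] at e₁ e₂ ⊢
      linarith
    · intro t ht k
      exact (eLpNorm_add_le ((h₁.smooth_velocity k).continuous_slice t).aestronglyMeasurable
        ((h₂.smooth_velocity k).continuous_slice t).aestronglyMeasurable hp).trans
        ((add_le_add (h₁.velocity_Lp t ht k) (h₂.velocity_Lp t ht k)).trans hsum)
    · intro t ht k i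
      have : dirDeriv (eDir i) (fun t x => w₁ k t x + w₂ k t x) t =
          dirDeriv (eDir i) (w₁ k) t + dirDeriv (eDir i) (w₂ k) t := by
        ext x
        exact (h₁.smooth_velocity k).dirDeriv_add (h₂.smooth_velocity k) _ _ _
      rw [this]
      exact (eLpNorm_add_le
        (((h₁.smooth_velocity k).dirDeriv _).continuous_slice t).aestronglyMeasurable
        (((h₂.smooth_velocity k).dirDeriv _).continuous_slice t).aestronglyMeasurable hp).trans
        ((add_le_add (h₁.gradient_Lp t ht k i) (h₂.gradient_Lp t ht k i)).trans hsum)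
    · intro t ht k
      have e₁ := h₁.error_le t ht k
      have e₂ := h₂.error_le t ht k
      have e₃ := integral_mono (integrable_of_continuous ((((h₁.cont_error k).add
        (h₂.cont_error k)).comp (Continuous.prodMk_right t)).abs))
        ((cF t (h₁.cont_error k)).add (cF t (h₂.cont_error k)))
        fun x => abs_add_le (F₁ k t x) (F₂ k t x)
      have e₄ := integral_add (cF t (h₁.cont_error k)) (cF t (h₂.cont_error k))
      have e₅ := hC t ht k (u k t) (w₁ k t)
        ((h.cont_velocity k).comp (Continuous.prodMk_right t))
        ((h₁.smooth_velocity k).continuous_slice t)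
      have e₆ : ∫ x, |w₁ k t x| ≤ δ₁ := integral_norm_le_of_eLpNorm_le
        ((h₁.smooth_velocity k).continuous_slice t) hp hδ₁0.le (h₁.velocity_Lp t ht k)
      have e₇ := mul_le_mul_of_nonneg_left e₆ hC0
      have e₈ := mul_le_mul_of_nonneg_left (e₅.trans (add_le_add le_rfl e₇)) hK.le
      simp only [List.map_cons, List.map_nil, List.sum_cons, List.sum_nil, add_zero,
        Pi.add_apply, Function.comp_def] at e₁ e₂ e₃ ⊢
      linarith
    · intro t hv
      obtain ⟨a₁, a₂, a₃⟩ := h₁.vanish t fun b' hb' => hv b' (by simp_all)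
      obtain ⟨b₁, b₂, b₃⟩ := h₂.vanish t fun b' hb' => hv b' (by simp_all)
      exact ⟨fun x => by simp [a₁, b₁], fun k x => by simp [a₂, b₂], fun k x => by simp [a₃, b₃]⟩

end ContinuityEq

namespace ContinuityEq

variable {d : ℕ}

/-! ### Smooth approximation, cut-offs and partitions of the velocity space -/

lemma smoothOn_coordinate_toCircle (i : Fin d) {φ : ℂ → ℝ} (hφ : ContDiff ℝ ∞ φ) :
    SmoothOn univ fun (_ : ℝ) (x : Torus d) => φ (AddCircle.toCircle (x i) : ℂ) := by
  rw [smoothOn_univ_iff]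
  refine hφ.comp ?_
  simp only [proj, AddCircle.toCircle_apply_mk, Circle.coe_exp]
  have h : ContDiff ℝ ∞ fun z : ℝ × (Fin d → ℝ) => 2 * Real.pi / 1 * z.2 i :=
    contDiff_const.mul (by fun_prop)
  have : ContDiff ℝ ∞ fun z : ℝ × (Fin d → ℝ) => ((2 * Real.pi / 1 * z.2 i : ℝ) : ℂ) :=
    Complex.ofRealCLM.contDiff.comp h
  exact (this.mul contDiff_const).cexp

/-- The restrictions to `[0,1] × 𝕋^d` of smooth functions. -/
def smoothSubalgebra (d : ℕ) : Subalgebra ℝ C(Icc (0 : ℝ) 1 × Torus d, ℝ) where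
  carrier := {f | ∃ F : ℝ → Torus d → ℝ, SmoothOn univ F ∧ ∀ z, f z = F z.1 z.2}
  mul_mem' := by
    rintro f g ⟨F, hF, hf⟩ ⟨G, hG, hg⟩
    exact ⟨_, hF.mul hG, fun z => by simp [hf, hg]⟩
  add_mem' := by
    rintro f g ⟨F, hF, hf⟩ ⟨G, hG, hg⟩
    exact ⟨_, hF.add hG, fun z => by simp [hf, hg]⟩
  algebraMap_mem' c := ⟨_, SmoothOn.const c, fun _ => rfl⟩

lemma separatesPoints_smoothSubalgebra : (smoothSubalgebra d).SeparatesPoints := by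
  have mk : ∀ F : ℝ → Torus d → ℝ, SmoothOn univ F → ∀ z z' : Icc (0 : ℝ) 1 × Torus d,
      F z.1 z.2 ≠ F z'.1 z'.2 → ∃ f ∈ (fun f : C(Icc (0 : ℝ) 1 × Torus d, ℝ) =>
        (f : Icc (0 : ℝ) 1 × Torus d → ℝ)) '' (smoothSubalgebra d : Set _), f z ≠ f z' := by
    intro F hF z z' h
    have c : Continuous fun z : Icc (0 : ℝ) 1 × Torus d => F z.1 z.2 :=
      hF.continuous.comp ((continuous_subtype_val.comp continuous_fst).prodMk continuous_snd)
    exact ⟨_, ⟨⟨_, c⟩, ⟨F, hF, fun _ => rfl⟩, rfl⟩, h⟩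
  rintro ⟨t, x⟩ ⟨t', x'⟩ h
  by_cases ht : t = t'
  · have hx : x ≠ x' := fun hx => h (by rw [ht, hx])
    obtain ⟨i, hi⟩ := Function.ne_iff.1 hx
    have hc : (AddCircle.toCircle (x i) : ℂ) ≠ AddCircle.toCircle (x' i) := fun hc =>
      hi (AddCircle.injective_toCircle one_ne_zero (Subtype.ext hc))
    by_cases hre : (AddCircle.toCircle (x i) : ℂ).re = (AddCircle.toCircle (x' i) : ℂ).re
    · exact mk _ (smoothOn_coordinate_toCircle i Complex.imCLM.contDiff) _ _
        fun him => hc (Complex.ext hre him)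
    · exact mk _ (smoothOn_coordinate_toCircle i Complex.reCLM.contDiff) _ _ hre
  · exact mk _ (SmoothOn.of_time contDiff_id) _ _ fun h' => ht (Subtype.ext h')

/-- Uniform approximation by smooth functions, from the Stone–Weierstrass theorem. -/
lemma exists_smooth_approx {f : ℝ → Torus d → ℝ} (hf : Continuous fun z : ℝ × Torus d => f z.1 z.2)
    {ε : ℝ} (hε : 0 < ε) :
    ∃ F : ℝ → Torus d → ℝ, SmoothOn univ F ∧ ∀ t ∈ Icc (0 : ℝ) 1, ∀ x, |F t x - f t x| ≤ ε := by
  have c : Continuous fun z : Icc (0 : ℝ) 1 × Torus d => f z.1 z.2 :=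
    hf.comp ((continuous_subtype_val.comp continuous_fst).prodMk continuous_snd)
  obtain ⟨⟨g, F, hF, hg⟩, h⟩ :=
    ContinuousMap.exists_mem_subalgebra_near_continuous_of_separatesPoints _
      separatesPoints_smoothSubalgebra _ c ε hε
  refine ⟨F, hF, fun t ht x => ?_⟩
  have := h (⟨t, ht⟩, x)
  simp only [hg] at this
  exact this.le

/-- A smooth cut-off in time: it vanishes where `R` vanishes, and equals one where `R` is not small.
-/
lemma exists_time_cutoff {R : Fin d → ℝ → Torus d → ℝ}
    (hR : ∀ k, Continuous fun z : ℝ × Torus d => R k z.1 z.2) {δ : ℝ} (hδ : 0 < δ) :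
    ∃ χ : ℝ → ℝ, ContDiff ℝ ∞ χ ∧ (∀ t, χ t ∈ Icc (0 : ℝ) 1) ∧
      (∀ t ∈ Icc (0 : ℝ) 1, (∀ k x, R k t x = 0) → χ t = 0) ∧
      ∀ t ∈ Icc (0 : ℝ) 1, ∀ k x, δ ≤ |R k t x| → χ t = 1 := by
  have hs : IsClosed {t : ℝ | ∀ k x, R k t x = 0} := by
    simp only [ofPred_forall]
    exact isClosed_iInter fun k => isClosed_iInter fun x =>
      isClosed_eq ((hR k).comp (Continuous.prodMk_left x)) continuous_const
  have ht : IsClosed (⋃ k, Prod.fst '' ((Icc (0 : ℝ) 1 ×ˢ (univ : Set (Torus d))) ∩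
      {z | δ ≤ |R k z.1 z.2|})) :=
    isClosed_iUnion_of_finite fun k => (((isCompact_Icc.prod isCompact_univ).inter_right
      (isClosed_le continuous_const (hR k).abs)).image continuous_fst).isClosed
  obtain ⟨χ, h0, h1, h⟩ := exists_contMDiffMap_zero_one_of_isClosed (n := (⊤ : ℕ∞))
    (modelWithCornersSelf ℝ ℝ) hs ht (by
      rw [Set.disjoint_left]
      intro t h0 h1
      obtain ⟨k, z, ⟨_, hz⟩, rfl⟩ := mem_iUnion.1 h1
      have : R k z.1 z.2 = 0 := h0 k z.2
      simp only [mem_ofPred_eq, this, abs_zero] at hz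
      linarith)
  exact ⟨χ, χ.contMDiff.contDiff, h, fun t _ hz => h0 hz, fun t ht' k x hx =>
    h1 (mem_iUnion.2 ⟨k, (t, x), ⟨⟨ht', mem_univ _⟩, hx⟩, rfl⟩)⟩

/-- A smooth function supported in `[-1,1]` whose squares, translated by integers, sum to one. -/
noncomputable def squareBump (x : ℝ) : ℝ :=
  Real.sin (Real.pi / 2 * Real.smoothTransition (x + 1)) *
    Real.cos (Real.pi / 2 * Real.smoothTransition x)

lemma contDiff_squareBump : ContDiff ℝ ∞ squareBump := by
  have : ContDiff ℝ ∞ Real.smoothTransition := Real.smoothTransition.contDiff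
  unfold squareBump
  exact (contDiff_const.mul (this.comp (contDiff_id.add contDiff_const))).sin.mul
    (contDiff_const.mul this).cos

lemma squareBump_nonneg (x : ℝ) : 0 ≤ squareBump x := by
  have hπ := Real.pi_pos
  have h : ∀ y, 0 ≤ Real.pi / 2 * Real.smoothTransition y ∧
      Real.pi / 2 * Real.smoothTransition y ≤ Real.pi / 2 := fun y =>
    ⟨mul_nonneg (by linarith) (Real.smoothTransition.nonneg y),
      mul_le_of_le_one_right (by linarith) (Real.smoothTransition.le_one y)⟩
  exact mul_nonneg (Real.sin_nonneg_of_nonneg_of_le_pi (h _).1 (by linarith [(h (x + 1)).2]))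
    (Real.cos_nonneg_of_neg_pi_div_two_le_of_le (by linarith [(h x).1]) (h x).2)

lemma squareBump_le_one (x : ℝ) : squareBump x ≤ 1 :=
  (le_abs_self _).trans (by
    have := abs_mul_le_mul (Real.abs_sin_le_one (Real.pi / 2 * Real.smoothTransition (x + 1)))
      (Real.abs_cos_le_one (Real.pi / 2 * Real.smoothTransition x))
    rwa [mul_one] at this)

lemma squareBump_eq_zero {x : ℝ} (h : 1 ≤ |x|) : squareBump x = 0 := by
  unfold squareBump
  rcases le_abs.1 h with h | h
  · rw [Real.smoothTransition.one_of_one_le h]; simp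
  · rw [Real.smoothTransition.zero_of_nonpos (by linarith : x + 1 ≤ 0)]; simp

lemma squareBump_sq (x : ℝ) : squareBump x ^ 2 =
    Real.sin (Real.pi / 2 * Real.smoothTransition (x + 1)) ^ 2 -
      Real.sin (Real.pi / 2 * Real.smoothTransition x) ^ 2 := by
  rw [squareBump, mul_pow, Real.cos_sq']
  rcases le_or_gt x 0 with h | h
  · rw [Real.smoothTransition.zero_of_nonpos h]; simp
  · rw [Real.smoothTransition.one_of_one_le (by linarith : 1 ≤ x + 1)]; simp

lemma sum_squareBump_sq {L : ℕ} {y : ℝ} (hy : |y| ≤ L) :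
    ∑ i ∈ Finset.range (2 * L + 1), squareBump (y + L - i) ^ 2 = 1 := by
  obtain ⟨h1, h2⟩ := abs_le.1 hy
  have h := Finset.sum_range_sub' (fun i : ℕ =>
    Real.sin (Real.pi / 2 * Real.smoothTransition (y + L - i + 1)) ^ 2) (2 * L + 1)
  have e : ∀ i : ℕ, y + L - ((i + 1 : ℕ) : ℝ) + 1 = y + L - i := fun i => by push_cast; ring
  simp only [e, ← squareBump_sq] at h
  rw [h, Real.smoothTransition.one_of_one_le (by simp; linarith),
    Real.smoothTransition.zero_of_nonpos (by push_cast; linarith)]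
  simp

lemma sum_squareBump_le (L : ℕ) (y : ℝ) :
    ∑ i ∈ Finset.range (2 * L + 1), squareBump (y + L - i) ≤ 2 := by
  -- at most two terms do not vanish: compare with differences of a Heaviside function
  let P : ℝ → ℝ := fun x => if 0 < x then 1 else 0
  have hP : ∀ x, squareBump x ≤ (P (x + 1) - P x) + (P x - P (x - 1)) := by
    intro x
    rcases le_or_gt 1 |x| with h | h
    · rw [squareBump_eq_zero h]
      rcases le_abs.1 h with h | h
      · have : P (x + 1) = 1 := if_pos (by linarith)
        rw [this]
        simp only [P]; split_ifs <;> norm_num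
      · have : P (x - 1) = 0 := if_neg (by linarith)
        rw [this]
        simp only [P]; split_ifs <;> norm_num
    · obtain ⟨h1, h2⟩ := abs_lt.1 h
      have e1 : P (x + 1) = 1 := if_pos (by linarith)
      have e2 : P (x - 1) = 0 := if_neg (by linarith)
      rw [e1, e2]
      linarith [squareBump_le_one x]
  refine (Finset.sum_le_sum fun i _ => hP _).trans ?_
  rw [Finset.sum_add_distrib]
  have e : ∀ i : ℕ, y + L - ((i + 1 : ℕ) : ℝ) + 1 = y + L - i := fun i => by push_cast; ring
  have e' : ∀ i : ℕ, y + L - ((i + 1 : ℕ) : ℝ) = y + L - i - 1 := fun i => by push_cast; ring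
  have h1 := Finset.sum_range_sub' (fun i : ℕ => P (y + L - i + 1)) (2 * L + 1)
  have h2 := Finset.sum_range_sub' (fun i : ℕ => P (y + L - i)) (2 * L + 1)
  simp only [e] at h1
  simp only [e'] at h2
  rw [h1, h2]
  have b0 : ∀ x, 0 ≤ P x := fun x => by simp only [P]; split_ifs <;> norm_num
  have b1 : ∀ x, P x ≤ 1 := fun x => by simp only [P]; split_ifs <;> norm_num
  linarith [b0 (y + L - (2 * L : ℕ)), b1 (y + L - (0 : ℕ) + 1), b1 (y + L - (0 : ℕ)),
    b0 (y + L - ((2 * L : ℕ) : ℝ) - 1)]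

/-- A partition of unity by squares, adapted to the level sets of a smooth velocity field: on the
support of each function of the partition the velocity is almost constant. -/
lemma exists_velocity_partition {v : Fin d → ℝ → Torus d → ℝ} (hv : ∀ k, SmoothOn univ (v k))
    {h : ℝ} (hh : 0 < h) :
    ∃ (ι : Type) (_ : Fintype ι) (b : ι → ℝ → Torus d → ℝ) (c : ι → Fin d → ℝ),
      (∀ n, SmoothOn univ (b n)) ∧ (∀ n t x, 0 ≤ b n t x) ∧
      (∀ t ∈ Icc (0 : ℝ) 1, ∀ x, ∑ n, b n t x ^ 2 = 1) ∧ (∀ t x, ∑ n, b n t x ≤ 2 ^ d) ∧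
      ∀ n t x, b n t x ≠ 0 → ∀ k, |v k t x - c n k| ≤ h := by
  obtain ⟨C, hC1, hC⟩ := exists_bound_Icc v fun k => (hv k).continuous
  obtain ⟨L, hL⟩ := exists_nat_ge (h⁻¹ * C)
  refine ⟨Fin d → Fin (2 * L + 1), inferInstance,
    fun n t x => ∏ k, squareBump (h⁻¹ * v k t x + L - (n k : ℕ)),
    fun n k => h * ((n k : ℕ) - L), fun n => ?_, fun n t x => ?_, fun t ht x => ?_, fun t x => ?_,
    fun n t x hb k => ?_⟩
  · refine SmoothOn.prod fun k _ => SmoothOn.comp contDiff_squareBump ?_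
    exact (((hv k).const_mul _).add (SmoothOn.const _)).sub (SmoothOn.const _)
  · exact Finset.prod_nonneg fun k _ => squareBump_nonneg _
  · have := Finset.prod_univ_sum (fun _ : Fin d => (Finset.univ : Finset (Fin (2 * L + 1))))
      (fun k i => squareBump (h⁻¹ * v k t x + L - (i : ℕ)) ^ 2)
    rw [Fintype.piFinset_univ] at this
    simp only [← Finset.prod_pow]
    rw [← this]
    refine Finset.prod_eq_one fun k _ => ?_
    rw [Fin.sum_univ_eq_sum_range fun i => squareBump (h⁻¹ * v k t x + L - i) ^ 2]
    refine sum_squareBump_sq ?_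
    rw [abs_mul, abs_of_pos (inv_pos.2 hh)]
    exact (mul_le_mul_of_nonneg_left (hC k t ht x) (inv_pos.2 hh).le).trans hL
  · have := Finset.prod_univ_sum (fun _ : Fin d => (Finset.univ : Finset (Fin (2 * L + 1))))
      (fun k i => squareBump (h⁻¹ * v k t x + L - (i : ℕ)))
    rw [Fintype.piFinset_univ] at this
    rw [← this]
    refine (Finset.prod_le_prod (fun k _ => Finset.sum_nonneg fun i _ => squareBump_nonneg _)
      (g := fun _ => 2) fun k _ => ?_).trans (by simp)
    rw [Fin.sum_univ_eq_sum_range fun i => squareBump (h⁻¹ * v k t x + L - i)]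
    exact sum_squareBump_le L _
  · have h1 := Finset.prod_ne_zero_iff.1 hb k (Finset.mem_univ k)
    have h2 : |h⁻¹ * v k t x + L - (n k : ℕ)| < 1 := by
      by_contra hn
      exact h1 (squareBump_eq_zero (not_lt.1 hn))
    have h3 : v k t x - h * ((n k : ℕ) - L) = h * (h⁻¹ * v k t x + L - (n k : ℕ)) := by
      field_simp; ring
    rw [h3, abs_mul, abs_of_pos hh]
    exact mul_le_of_le_one_right hh.le h2.le

end ContinuityEq

namespace ContinuityEq

variable {d : ℕ}

/-! ### The iteration step -/

/-- `(ϑ, w)` is a perturbation of `(ρ, u, R)` with new defect `R'`, of size governed by the size `r`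
of the defect and a parameter `η`, which can be used to make either the perturbation of the density
or that of the velocity small. -/
structure IsStep (M r η δ : ℝ) (p : ℝ≥0∞) (ρ : ℝ → Torus d → ℝ) (u R : Fin d → ℝ → Torus d → ℝ)
    (ϑ : ℝ → Torus d → ℝ) (w R' : Fin d → ℝ → Torus d → ℝ) : Prop where
  isSub : IsSub (fun t x => ρ t x + ϑ t x) (fun k t x => u k t x + w k t x) R'
  smooth_density : SmoothOn univ ϑ
  smooth_velocity : ∀ k, SmoothOn univ (w k)
  density_le : ∀ t ∈ Icc (0 : ℝ) 1, ∫ x, |ϑ t x| ≤ M * (η * r)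
  velocity_le : ∀ t ∈ Icc (0 : ℝ) 1, ∀ x k, |w k t x| ≤ M * η⁻¹
  gradient_Lp : ∀ t ∈ Icc (0 : ℝ) 1, ∀ k i,
    eLpNorm (dirDeriv (eDir i) (w k) t) p volume ≤ ENNReal.ofReal δ
  defect_le : ∀ t ∈ Icc (0 : ℝ) 1, ∀ k, ∫ x, |R' k t x| ≤ δ
  vanish : ∀ t ∈ Icc (0 : ℝ) 1, (∀ k x, R k t x = 0) →
    (∀ x, ϑ t x = 0) ∧ (∀ k x, w k t x = 0) ∧ ∀ k x, R' k t x = 0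

lemma sum_integral_le {ι : Type*} [Fintype ι] {f : ι → Torus d → ℝ} {g : Torus d → ℝ}
    (hf : ∀ n, Continuous (f n)) (hg : Continuous g) (h : ∀ x, ∑ n, f n x ≤ g x) :
    ∑ n, ∫ x, f n x ≤ ∫ x, g x := by
  rw [← integral_finsetSum _ fun n _ => integrable_of_continuous (hf n)]
  exact integral_mono (integrable_of_continuous (continuous_finsetSum _ fun n _ => hf n))
    (integrable_of_continuous hg) h

/-- The block with which one piece of the defect is cancelled: its flux is `-χ² b² S` in the
direction `j`, independently of `η`. -/
noncomputable def cancelBlock (η : ℝ) (j : Fin d) (c : Fin d → ℝ) {χ : ℝ → ℝ}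
    {b S : ℝ → Torus d → ℝ} (hχ : ContDiff ℝ ∞ χ) (hb : SmoothOn univ b) (hS : SmoothOn univ S) :
    Block d where
  dir := j
  amp := fun t x => -η * (χ t * b t x * S t x)
  ampVel := fun t x => η⁻¹ * (χ t * b t x)
  speed := c
  smooth_amp := (((SmoothOn.of_time hχ).mul hb).mul hS).const_mul _
  smooth_ampVel := ((SmoothOn.of_time hχ).mul hb).const_mul _

/-- At the zeros of the cut-off the block and its time derivative vanish. -/
lemma cancelBlock_vanishesAt (η : ℝ) (j : Fin d) (c : Fin d → ℝ) {χ : ℝ → ℝ}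
    {b S : ℝ → Torus d → ℝ} (hχ : ContDiff ℝ ∞ χ) (hb : SmoothOn univ b) (hS : SmoothOn univ S)
    (hχ0 : ∀ t, 0 ≤ χ t) {t : ℝ} (ht : χ t = 0) :
    (cancelBlock η j c hχ hb hS).VanishesAt t := by
  refine ⟨fun x => by simp [cancelBlock, ht], fun x => by simp [cancelBlock, ht], fun x => ?_⟩
  -- `t` is a minimum of the nonnegative cut-off
  have hmin : deriv χ t = 0 := (show IsLocalMin χ t from
    Filter.Eventually.of_forall fun s => by rw [ht]; exact hχ0 s).deriv_eq_zero
  have h0 : dirDeriv (1, 0) (fun s (_ : Torus d) => χ s) t x = 0 := by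
    rw [← ((SmoothOn.of_time (d := d) hχ).hasDerivAt_time t x).deriv]; exact hmin
  have e : (cancelBlock η j c hχ hb hS).amp =
      fun t x => (fun s (_ : Torus d) => χ s) t x * (fun t x => -η * (b t x * S t x)) t x := by
    ext t x; simp only [cancelBlock]; ring
  rw [e, (SmoothOn.of_time hχ).dirDeriv_mul ((hb.mul hS).const_mul _), h0, ht]
  simp

/-- The defect can be replaced by an arbitrarily small one. The constant `M` depends only on the
dimension, while the gradient of the new velocity perturbation is as small as desired in `L^p`. -/
theorem exists_step (hd : 3 ≤ d) : ∃ M : ℝ, 0 < M ∧ ∀ (ρ : ℝ → Torus d → ℝ)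
    (u R : Fin d → ℝ → Torus d → ℝ), IsSub ρ u R → ∀ r : ℝ, 0 < r →
    (∀ t ∈ Icc (0 : ℝ) 1, ∀ k, ∫ x, |R k t x| ≤ r) → ∀ η : ℝ, 0 < η →
    ∀ p : ℝ≥0∞, 1 ≤ p → p < (d : ℝ≥0∞) - 1 → ∀ δ : ℝ, 0 < δ →
    ∃ ϑ w R', IsStep M r η δ p ρ u R ϑ w R' := by
  obtain ⟨K, hK, pert⟩ := exists_perturbation hd
  obtain ⟨D, hD⟩ : ∃ D : ℝ, D = d * 2 ^ d := ⟨_, rfl⟩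
  have hD0 : 0 ≤ D := by rw [hD]; positivity
  refine ⟨2 * K * D + 1, by positivity, fun ρ u R hsub r hr hRr η hη p hp hpd δ hδ => ?_⟩
  obtain ⟨C, hC1, hC⟩ := exists_bound_Icc R hsub.cont_defect
  -- the part of the defect which is not cancelled, owing to the smoothing and to the cut-off
  obtain ⟨δ', hδ', hδ'r, hδ'δ⟩ : ∃ δ' : ℝ, 0 < δ' ∧ δ' ≤ r ∧ δ' ≤ δ / 2 :=
    ⟨min r (δ / 2), by positivity, min_le_left _ _, min_le_right _ _⟩
  -- the oscillation of the velocity on one piece, for which the transport error is at most `δ / 4`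
  obtain ⟨h, hh⟩ : ∃ h, h = δ / (8 * (K * (η * D * (C + r)) + 1)) := ⟨_, rfl⟩
  have hh0 : 0 < h := by rw [hh]; positivity
  have hhe : K * (η * D * (C + r) * (2 * h)) + 2 * h = δ / 4 := by rw [hh]; field_simp; ring
  obtain ⟨δ₀, hδ₀, h1, h2, h3⟩ : ∃ δ₀ : ℝ, 0 < δ₀ ∧ δ₀ ≤ δ / 4 ∧ δ₀ ≤ η * r ∧ δ₀ ≤ η⁻¹ :=
    ⟨min (δ / 4) (min (η * r) η⁻¹), by positivity, min_le_left _ _,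
      (min_le_right _ _).trans (min_le_left _ _), (min_le_right _ _).trans (min_le_right _ _)⟩
  choose S hS hSR using fun k => exists_smooth_approx (hsub.cont_defect k) hδ'
  choose v hv hvu using fun k => exists_smooth_approx (hsub.cont_velocity k) hh0
  obtain ⟨ι, _, b, c, hb, hb0, hb2, hb1, hbv⟩ := exists_velocity_partition hv hh0
  obtain ⟨χ, hχ, hχI, hχ0, hχ1⟩ := exists_time_cutoff hsub.cont_defect hδ'
  let B : Fin d × ι → Block d := fun z => cancelBlock η z.1 (c z.2) hχ (hb z.2) (hS z.1)
  obtain ⟨ϑ, w, F, hP⟩ := pert ((Finset.univ : Finset (Fin d × ι)).toList.map B) ρ u R hsub p hp hpd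
    δ₀ hδ₀
  have hsum : ∀ f : Block d → ℝ, (((Finset.univ : Finset (Fin d × ι)).toList.map B).map f).sum =
      ∑ j, ∑ n, f (B (j, n)) := fun f => by
    rw [List.map_map, Finset.sum_map_toList, Fintype.sum_prod_type]; rfl
  have hδ₀δ : ENNReal.ofReal δ₀ ≤ ENNReal.ofReal δ := ENNReal.ofReal_le_ofReal (by linarith)
  have habs : ∀ j n t x, |(B (j, n)).amp t x| = η * (χ t * |S j t x|) * b n t x := by
    intro j n t x
    simp only [B, cancelBlock, abs_mul, abs_neg, abs_of_pos hη, abs_of_nonneg (hχI t).1,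
      abs_of_nonneg (hb0 n t x)]
    ring
  have hsumb : ∀ a t x, 0 ≤ a → ∑ n, a * b n t x ≤ a * 2 ^ d := fun a t x ha => by
    rw [← Finset.mul_sum]; exact mul_le_mul_of_nonneg_left (hb1 t x) ha
  refine ⟨ϑ, w, _, hP.isSub, hP.smooth_density, hP.smooth_velocity, ?_, ?_,
    fun t ht k i => (hP.gradient_Lp t ht k i).trans hδ₀δ, ?_, ?_⟩
  · intro t ht
    have e1 := hP.density_le t ht
    rw [hsum] at e1
    have e2 : ∀ j : Fin d, ∑ n, ∫ x, |(B (j, n)).amp t x| ≤ η * 2 ^ d * (2 * r) := by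
      intro j
      refine (sum_integral_le (g := fun x => η * 2 ^ d * (|R j t x| + δ'))
        (fun n => ((B (j, n)).smooth_amp.continuous_slice t).abs) ?_ fun x => ?_).trans ?_
      · exact continuous_const.mul
          (((hsub.cont_defect j).comp (Continuous.prodMk_right t)).abs.add continuous_const)
      · simp only [habs]
        refine (hsumb _ _ _ (by have := (hχI t).1; positivity)).trans ?_
        have e3 : |S j t x| ≤ |R j t x| + δ' := by
          have := hSR j t ht x
          have := abs_sub_abs_le_abs_sub (S j t x) (R j t x)
          linarith
        have e4 : χ t * |S j t x| ≤ |R j t x| + δ' :=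
          (mul_le_of_le_one_left (abs_nonneg _) (hχI t).2).trans e3
        calc η * (χ t * |S j t x|) * 2 ^ d ≤ η * (|R j t x| + δ') * 2 ^ d := by gcongr
          _ = _ := by ring
      · rw [integral_const_mul, integral_add, integral_const]
        · have := hRr t ht j
          simp only [probReal_univ, one_smul]
          gcongr
          linarith
        · exact integrable_of_continuous
            ((hsub.cont_defect j).comp (Continuous.prodMk_right t)).abs
        · exact integrable_const _
    have e3 : ∑ j, ∑ n, ∫ x, |(B (j, n)).amp t x| ≤ D * (η * (2 * r)) := by
      refine (Finset.sum_le_sum fun j _ => e2 j).trans ?_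
      rw [hD, Finset.sum_const, Finset.card_univ, Fintype.card_fin, nsmul_eq_mul]
      exact le_of_eq (by ring)
    have e4 := mul_le_mul_of_nonneg_left e3 hK.le
    linarith
  · intro t ht x k
    have e1 := hP.velocity_le t ht x k
    rw [hsum] at e1
    have e2 : ∀ j : Fin d, ∑ n, |(B (j, n)).ampVel t x| ≤ η⁻¹ * 2 ^ d := by
      intro j
      have : ∀ n, |(B (j, n)).ampVel t x| = (η⁻¹ * χ t) * b n t x := fun n => by
        simp only [B, cancelBlock, abs_mul, abs_of_pos (inv_pos.2 hη), abs_of_nonneg (hχI t).1,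
          abs_of_nonneg (hb0 n t x)]
        ring
      simp only [this]
      refine (hsumb _ _ _ (mul_nonneg (inv_pos.2 hη).le (hχI t).1)).trans ?_
      gcongr
      exact mul_le_of_le_one_right (inv_pos.2 hη).le (hχI t).2
    have e3 : ∑ j, ∑ n, |(B (j, n)).ampVel t x| ≤ D * η⁻¹ := by
      refine (Finset.sum_le_sum fun j _ => e2 j).trans ?_
      rw [hD, Finset.sum_const, Finset.card_univ, Fintype.card_fin, nsmul_eq_mul]
      exact le_of_eq (by ring)
    have e4 := mul_le_mul_of_nonneg_left e3 hK.le
    have e5 : 0 ≤ K * (D * η⁻¹) := by positivity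
    linarith
  · intro t ht k
    have e1 := hP.error_le t ht k
    rw [hsum] at e1
    have e2 : ∀ j : Fin d, ∑ n, ∫ x, |(B (j, n)).amp t x * (u k t x - (B (j, n)).speed k)| ≤
        η * 2 ^ d * ((C + r) * (2 * h)) := by
      intro j
      refine (sum_integral_le (g := fun _ => η * 2 ^ d * ((C + r) * (2 * h)))
        (fun n => (((B (j, n)).smooth_amp.continuous_slice t).mul (((hsub.cont_velocity k).comp
          (Continuous.prodMk_right t)).sub continuous_const)).abs) continuous_const
        fun x => ?_).trans (by simp)
      have e3 : |S j t x| ≤ C + r := by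
        have := hSR j t ht x
        have := abs_sub_abs_le_abs_sub (S j t x) (R j t x)
        have := hC j t ht x
        linarith
      have e4 : ∀ n, |(B (j, n)).amp t x * (u k t x - (B (j, n)).speed k)| ≤
          (η * ((C + r) * (2 * h))) * b n t x := by
        intro n
        rw [abs_mul, habs]
        have hs : (B (j, n)).speed k = c n k := rfl
        rw [hs]
        by_cases hbn : b n t x = 0
        · simp [hbn]
        have e5 : |u k t x - c n k| ≤ 2 * h := by
          have a1 := hbv n t x hbn k
          have a2 := hvu k t ht x
          have a3 := abs_sub_le (u k t x) (v k t x) (c n k)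
          rw [abs_sub_comm (u k t x) (v k t x)] at a3
          linarith
        have e6 : χ t * |S j t x| ≤ C + r :=
          (mul_le_of_le_one_left (abs_nonneg _) (hχI t).2).trans e3
        have e7 := hb0 n t x
        calc η * (χ t * |S j t x|) * b n t x * |u k t x - c n k|
            ≤ η * (C + r) * b n t x * (2 * h) := by gcongr
          _ = _ := by ring
      refine (Finset.sum_le_sum fun n _ => e4 n).trans ((hsumb _ _ _ (by positivity)).trans ?_)
      exact le_of_eq (by ring)
    have e3 : ∑ j, ∑ n, ∫ x, |(B (j, n)).amp t x * (u k t x - (B (j, n)).speed k)| ≤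
        η * D * (C + r) * (2 * h) := by
      refine (Finset.sum_le_sum fun j _ => e2 j).trans ?_
      rw [hD, Finset.sum_const, Finset.card_univ, Fintype.card_fin, nsmul_eq_mul]
      exact le_of_eq (by ring)
    have e4 := mul_le_mul_of_nonneg_left e3 hK.le
    -- the squares of the partition sum to one, so the fluxes add up to minus the smoothed defect
    have e5 : ∀ x, (((Finset.univ : Finset (Fin d × ι)).toList.map B).map
        fun b => b.flux k t x).sum = -(χ t ^ 2 * S k t x) := by
      intro x
      have e6 : ∀ j n, (B (j, n)).flux k t x =
          if k = j then -(χ t ^ 2 * S j t x) * b n t x ^ 2 else 0 := fun j n => by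
        have : η * η⁻¹ = 1 := mul_inv_cancel₀ hη.ne'
        have hflux : (B (j, n)).flux k t x = if k = j then -η * (χ t * b n t x * S j t x) *
            (η⁻¹ * (χ t * b n t x)) else 0 := rfl
        rw [hflux]
        split_ifs
        · linear_combination (-(χ t ^ 2 * S j t x) * b n t x ^ 2) * this
        · rfl
      rw [hsum]
      simp only [e6]
      rw [Finset.sum_comm]
      simp only [Finset.sum_ite_eq, Finset.mem_univ, if_true]
      rw [← Finset.mul_sum, hb2 t ht x, mul_one]
    have e6 : ∀ x, |R k t x - χ t ^ 2 * S k t x| ≤ δ' := by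
      intro x
      have a1 := hSR k t ht x
      rw [abs_sub_comm] at a1
      have a0 : 0 ≤ χ t ^ 2 := sq_nonneg _
      have a2 : χ t ^ 2 ≤ 1 := pow_le_one₀ (hχI t).1 (hχI t).2
      have a3 : R k t x - χ t ^ 2 * S k t x =
          (1 - χ t ^ 2) * R k t x + χ t ^ 2 * (R k t x - S k t x) := by ring
      by_cases a4 : δ' ≤ |R k t x|
      · rw [hχ1 t ht k x a4]; simpa using a1
      · rw [a3]
        refine (abs_add_le _ _).trans ?_
        rw [abs_mul, abs_mul, abs_of_nonneg a0, abs_of_nonneg (by linarith : 0 ≤ 1 - χ t ^ 2)]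
        have a5 := mul_le_mul_of_nonneg_left (not_le.1 a4).le (by linarith : 0 ≤ 1 - χ t ^ 2)
        have a6 := mul_le_mul_of_nonneg_left a1 a0
        linarith
    have cF : Continuous (F k t) := (hP.cont_error k).comp (Continuous.prodMk_right t)
    have e7 : ∫ x, |R k t x + (((Finset.univ : Finset (Fin d × ι)).toList.map B).map
        fun b => b.flux k t x).sum + F k t x| ≤ ∫ x, (δ' + |F k t x|) := by
      refine integral_mono (integrable_of_continuous
        (((hP.isSub.cont_defect k).comp (Continuous.prodMk_right t)).abs))
        (integrable_of_continuous (continuous_const.add cF.abs)) fun x => ?_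
      simp only [e5, ← sub_eq_add_neg]
      exact (abs_add_le _ _).trans (add_le_add (e6 x) le_rfl)
    have e8 : ∫ x, (δ' + |F k t x|) = δ' + ∫ x, |F k t x| := by
      rw [integral_add (integrable_const _) (integrable_of_continuous cF.abs)]
      simp
    linarith
  · intro t ht hz
    obtain ⟨a1, a2, a3⟩ := hP.vanish t fun b' hb' => by
      obtain ⟨z, _, rfl⟩ := List.mem_map.1 hb'
      exact cancelBlock_vanishesAt η _ _ hχ _ _ (fun s => (hχI s).1) (hχ0 t ht hz)
    refine ⟨a1, a2, fun k x => ?_⟩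
    rw [hz, a3, hsum]
    have : ∀ j n, (B (j, n)).flux k t x = 0 := fun j n => by
      simp [Block.flux, B, cancelBlock, hχ0 t ht hz]
    simp [this]

end ContinuityEq

namespace ContinuityEq

variable {d : ℕ} {E : Type*} [NormedAddCommGroup E] [NormedSpace ℝ E]

/-! ### Functions which are smooth on the closed time interval -/

/-- The projection of the time axis onto `[0,1]`; it is used to extend functions on `[0,1]`
continuously to all times. -/
noncomputable def clampTime (t : ℝ) : ℝ := projIcc (0 : ℝ) 1 zero_le_one t

lemma continuous_clampTime : Continuous clampTime := continuous_subtype_val.comp continuous_projIcc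

lemma clampTime_mem (t : ℝ) : clampTime t ∈ Icc (0 : ℝ) 1 := (projIcc (0 : ℝ) 1 zero_le_one t).2

lemma clampTime_of_mem {t : ℝ} (ht : t ∈ Icc (0 : ℝ) 1) : clampTime t = t := by
  rw [clampTime, projIcc_of_mem _ ht]

namespace SmoothOn

variable {f : ℝ → Torus d → E}

lemma continuous_clamp (hf : SmoothOn (Icc 0 1) f) :
    Continuous fun z : ℝ × Torus d => f (clampTime z.1) z.2 :=
  continuous_uncurry_of_lift (f := fun t x => f (clampTime t) x)
    (hf.continuousOn.comp_continuous
      ((continuous_clampTime.comp continuous_fst).prodMk continuous_snd)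
      fun _ => ⟨clampTime_mem _, mem_univ _⟩)

lemma continuous_slice_Icc (hf : SmoothOn (Icc 0 1) f) {t : ℝ} (ht : t ∈ Icc (0 : ℝ) 1) :
    Continuous (f t) := by
  have := hf.continuous_clamp.comp (Continuous.prodMk_right t)
  simpa only [Function.comp_def, clampTime_of_mem ht] using this

lemma uniqueDiffOn_Icc_prod : UniqueDiffOn ℝ (Icc (0 : ℝ) 1 ×ˢ (univ : Set (Fin d → ℝ))) :=
  (uniqueDiffOn_Icc zero_lt_one).prod uniqueDiffOn_univ

lemma hasFDerivWithinAt_lift (hf : SmoothOn (Icc 0 1) f) {t : ℝ} (ht : t ∈ Icc (0 : ℝ) 1)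
    (y : Fin d → ℝ) :
    HasFDerivWithinAt (fun z : ℝ × (Fin d → ℝ) => f z.1 (proj z.2))
      (fderivWithin ℝ (fun z : ℝ × (Fin d → ℝ) => f z.1 (proj z.2)) (Icc 0 1 ×ˢ univ) (t, y))
      (Icc 0 1 ×ˢ univ) (t, y) :=
  (ContDiffOn.differentiableOn hf (by simp) (t, y) ⟨ht, mem_univ _⟩).hasFDerivWithinAt

lemma hasDerivAt_space_lift (hf : SmoothOn (Icc 0 1) f) {t : ℝ} (ht : t ∈ Icc (0 : ℝ) 1)
    (y : Fin d → ℝ) (i : Fin d) :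
    HasDerivAt (fun s : ℝ => f t (proj y + Pi.single i (s : UnitAddCircle)))
      (fderivWithin ℝ (fun z : ℝ × (Fin d → ℝ) => f z.1 (proj z.2)) (Icc 0 1 ×ˢ univ) (t, y)
        (0, Pi.single i 1)) 0 := by
  have h2 : HasDerivAt (fun s : ℝ => (t, y) + s • ((0, Pi.single i 1) : ℝ × (Fin d → ℝ)))
      (0, Pi.single i 1) 0 := by
    simpa using
      ((hasDerivAt_id (0 : ℝ)).smul_const ((0, Pi.single i 1) : ℝ × (Fin d → ℝ))).const_add
      (t, y)
  have h3 := HasFDerivWithinAt.comp_hasDerivWithinAt_of_eq (t := Icc 0 1 ×ˢ univ) (s := univ)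
    (0 : ℝ) (hf.hasFDerivWithinAt_lift ht y) h2.hasDerivWithinAt
    (fun s _ => ⟨by simpa using ht, mem_univ _⟩) (by simp)
  rw [hasDerivWithinAt_univ] at h3
  refine h3.congr_of_eventuallyEq (Filter.Eventually.of_forall fun r => ?_)
  simp [proj_smul_single]

lemma hasPartial_Icc (hf : SmoothOn (Icc 0 1) f) {t : ℝ} (ht : t ∈ Icc (0 : ℝ) 1) (i : Fin d) :
    HasPartial i (f t) (pderiv i (f t)) := fun x => by
  obtain ⟨y, rfl⟩ := proj_surjective x
  exact (hf.hasDerivAt_space_lift ht y i).differentiableAt.hasDerivAt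

lemma continuous_fderivWithin_clamp (hf : SmoothOn (Icc 0 1) f) (v : ℝ × (Fin d → ℝ)) :
    Continuous fun z : ℝ × (Fin d → ℝ) => fderivWithin ℝ (fun z : ℝ × (Fin d → ℝ) =>
      f z.1 (proj z.2)) (Icc 0 1 ×ˢ univ) (clampTime z.1, z.2) v := by
  have h : ContinuousOn (fderivWithin ℝ (fun z : ℝ × (Fin d → ℝ) => f z.1 (proj z.2))
      (Icc 0 1 ×ˢ univ)) (Icc 0 1 ×ˢ univ) :=
    ContDiffOn.continuousOn_fderivWithin hf uniqueDiffOn_Icc_prod (by simp)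
  exact (h.comp_continuous ((continuous_clampTime.comp continuous_fst).prodMk continuous_snd)
      fun z => ⟨clampTime_mem _, mem_univ _⟩).clm_apply continuous_const

lemma continuous_pderiv_clamp (hf : SmoothOn (Icc 0 1) f) (i : Fin d) :
    Continuous fun z : ℝ × Torus d => pderiv i (f (clampTime z.1)) z.2 := by
  refine continuous_uncurry_of_lift (f := fun t x => pderiv i (f (clampTime t)) x) ?_
  convert hf.continuous_fderivWithin_clamp (0, Pi.single i 1) using 2 with z
  exact (hf.hasDerivAt_space_lift (clampTime_mem _) _ i).deriv

lemma hasDerivWithinAt_time_lift (hf : SmoothOn (Icc 0 1) f) {t : ℝ} (ht : t ∈ Icc (0 : ℝ) 1)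
    (y : Fin d → ℝ) :
    HasDerivWithinAt (fun s : ℝ => f s (proj y))
      (fderivWithin ℝ (fun z : ℝ × (Fin d → ℝ) => f z.1 (proj z.2)) (Icc 0 1 ×ˢ univ) (t, y)
        (1, 0)) (Icc 0 1) t := by
  have h2 : HasDerivAt (fun s : ℝ => (s, y)) ((1, 0) : ℝ × (Fin d → ℝ)) t :=
    (hasDerivAt_id t).prodMk (hasDerivAt_const t y)
  exact HasFDerivWithinAt.comp_hasDerivWithinAt (t := Icc 0 1 ×ˢ univ) (s := Icc (0 : ℝ) 1)
    t (hf.hasFDerivWithinAt_lift ht y) h2.hasDerivWithinAt (fun s hs => ⟨hs, mem_univ _⟩)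

lemma continuous_derivWithin_clamp (hf : SmoothOn (Icc 0 1) f) :
    Continuous fun z : ℝ × Torus d => derivWithin (fun s => f s z.2) (Icc 0 1) (clampTime z.1) := by
  refine continuous_uncurry_of_lift
    (f := fun t x => derivWithin (fun s => f s x) (Icc 0 1) (clampTime t)) ?_
  convert hf.continuous_fderivWithin_clamp (1, 0) using 2 with z
  exact (hf.hasDerivWithinAt_time_lift (clampTime_mem _) _).derivWithin
    (uniqueDiffOn_Icc zero_lt_one _ (clampTime_mem _))

lemma hasDerivAt_clamp (hf : SmoothOn (Icc 0 1) f) {t : ℝ} (ht : t ∈ Ioo (0 : ℝ) 1) (x : Torus d) :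
    HasDerivAt (fun s => f (clampTime s) x)
      (derivWithin (fun s => f s x) (Icc 0 1) (clampTime t)) t := by
  have ht' := Ioo_subset_Icc_self ht
  obtain ⟨y, rfl⟩ := proj_surjective x
  rw [clampTime_of_mem ht']
  have h := (hf.hasDerivWithinAt_time_lift ht' y).differentiableWithinAt.hasDerivWithinAt.hasDerivAt
    (Icc_mem_nhds ht.1 ht.2)
  refine h.congr_of_eventuallyEq ?_
  filter_upwards [Icc_mem_nhds ht.1 ht.2] with s hs
  rw [clampTime_of_mem hs]

lemma mul_Icc {f g : ℝ → Torus d → ℝ} (hf : SmoothOn (Icc 0 1) f) (hg : SmoothOn (Icc 0 1) g) :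
    SmoothOn (Icc 0 1) (fun t x => f t x * g t x) :=
  ContDiffOn.mul hf hg

lemma component {u : ℝ → Torus d → Vec d} (hu : SmoothOn (Icc 0 1) u) (k : Fin d) :
    SmoothOn (Icc 0 1) (fun t x => u t x k) :=
  (EuclideanSpace.proj (𝕜 := ℝ) k : Vec d →L[ℝ] ℝ).contDiff.comp_contDiffOn hu

end SmoothOn

/-! ### The initial defect -/

/-- The fundamental theorem of calculus in time, integrated over space-time. -/
lemma integral_spaceTime_deriv_eq_zero {h h' : ℝ → Torus d → ℝ}
    (ch : Continuous fun z : ℝ × Torus d => h z.1 z.2)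
    (ch' : Continuous fun z : ℝ × Torus d => h' z.1 z.2)
    (hd : ∀ t ∈ Ioo (0 : ℝ) 1, ∀ x, HasDerivAt (fun s => h s x) (h' t x) t)
    (h0 : ∀ x, h 0 x = 0) (h1 : ∀ x, h 1 x = 0) :
    ∫ z : ℝ × Torus d, h' z.1 z.2 ∂(spaceTime d) = 0 := by
  rw [spaceTime, integral_prod_symm _ (integrable_spaceTime ch')]
  refine integral_eq_zero_of_ae (Filter.Eventually.of_forall fun x => ?_)
  have c : Continuous fun t => h t x := ch.comp (Continuous.prodMk_left x)
  have c' : Continuous fun t => h' t x := ch'.comp (Continuous.prodMk_left x)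
  have := intervalIntegral.integral_eq_sub_of_hasDerivAt_of_le zero_le_one c.continuousOn
    (fun t ht => hd t ht x) (c'.intervalIntegrable 0 1)
  rw [intervalIntegral.integral_of_le zero_le_one, integral_Ioc_eq_integral_Ioo, h0, h1,
    sub_zero] at this
  exact this

lemma integral_sum_mul_dirDeriv {φ : ℝ → Torus d → ℝ} (hφ : IsTestFunction φ) (t : ℝ)
    {V V' : Fin d → Torus d → ℝ} (hV : ∀ k, HasPartial k (V k) (V' k)) (cV : ∀ k, Continuous (V k))
    (cV' : ∀ k, Continuous (V' k)) :
    ∫ x, ∑ k, V k x * dirDeriv (eDir k) φ t x = -∫ x, (∑ k, V' k x) * φ t x := by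
  have cφ := hφ.smooth.continuous_slice t
  have cφ' := fun k => (hφ.smooth.dirDeriv (eDir k)).continuous_slice t
  simp_rw [Finset.sum_mul]
  rw [integral_finsetSum (f := fun k x => V k x * dirDeriv (eDir k) φ t x) _
      fun k _ => integrable_of_continuous ((cV k).mul (cφ' k)),
    integral_finsetSum (f := fun k x => V' k x * φ t x) _
      fun k _ => integrable_of_continuous ((cV' k).mul cφ), ← Finset.sum_neg_distrib]
  refine Finset.sum_congr rfl fun k _ => ?_
  have := integral_mul_partial (hV k) (hφ.smooth.hasPartial k t) (cV k) (cV' k) cφ (cφ' k)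
  rw [this, neg_neg]
  rfl

/-- If the total mass is conserved then the time derivative has mean zero. -/
lemma integral_derivWithin_eq_zero {ρ : ℝ → Torus d → ℝ} (hρ : SmoothOn (Icc 0 1) ρ)
    (hmean : ∀ t ∈ Icc (0 : ℝ) 1, ∫ x, ρ 0 x = ∫ x, ρ t x) {t : ℝ} (ht : t ∈ Ioo (0 : ℝ) 1) :
    ∫ x, derivWithin (fun s => ρ s x) (Icc 0 1) (clampTime t) = 0 := by
  have c' := hρ.continuous_derivWithin_clamp
  obtain ⟨C, hC1, hC⟩ := exists_bound_Icc (fun _ : Unit => fun t x =>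
    derivWithin (fun s => ρ s x) (Icc 0 1) (clampTime t)) fun _ => c'
  have key := (hasDerivAt_integral_of_dominated_loc_of_deriv_le (𝕜 := ℝ)
    (μ := (volume : Measure (Torus d))) (F := fun s x => ρ (clampTime s) x)
    (F' := fun s x => derivWithin (fun s => ρ s x) (Icc 0 1) (clampTime s)) (x₀ := t)
    (bound := fun _ => C) (Ioo_mem_nhds ht.1 ht.2)
    (Filter.Eventually.of_forall fun s =>
      (hρ.continuous_clamp.comp (Continuous.prodMk_right s)).aestronglyMeasurable)
    (integrable_of_continuous (hρ.continuous_clamp.comp (Continuous.prodMk_right t)))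
    (c'.comp (Continuous.prodMk_right t)).aestronglyMeasurable
    (Filter.Eventually.of_forall fun x s hs => hC () s (Ioo_subset_Icc_self hs) x)
    (integrable_const C)
    (Filter.Eventually.of_forall fun x s hs => hρ.hasDerivAt_clamp hs x)).2
  have hc : (fun s => ∫ x, ρ (clampTime s) x) = fun _ => ∫ x, ρ 0 x := by
    ext s; exact (hmean _ (clampTime_mem s)).symm
  rw [hc] at key
  exact key.unique (hasDerivAt_const _ _)

/-- The given pair, extended to all times, with a defect that vanishes at the exact times. -/
theorem exists_initial {ρ₀ : ℝ → Torus d → ℝ} {u₀ : ℝ → Torus d → Vec d}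
    (hρ : SmoothOn (Icc 0 1) ρ₀) (hu : SmoothOn (Icc 0 1) u₀)
    (hmean : ∀ t ∈ Icc (0 : ℝ) 1, ∫ x, ρ₀ 0 x = ∫ x, ρ₀ t x)
    (hdiv : ∀ t ∈ Icc (0 : ℝ) 1, ∀ x, divergence (u₀ t) x = 0) :
    ∃ R, IsSub (fun t x => ρ₀ (clampTime t) x) (fun k t x => u₀ (clampTime t) x k) R ∧
      ∀ t ∈ exactTimes ρ₀ u₀, ∀ k x, R k t x = 0 := by
  have hρu : ∀ k, SmoothOn (Icc 0 1) fun t x => ρ₀ t x * u₀ t x k := fun k =>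
    hρ.mul_Icc (hu.component k)
  have cD := hρ.continuous_derivWithin_clamp
  have cP := fun k => (hρu k).continuous_pderiv_clamp k
  let f : ℝ → Torus d → ℝ := fun t x => derivWithin (fun s => ρ₀ s x) (Icc 0 1) (clampTime t) +
    ∑ k, pderiv k (fun x => ρ₀ (clampTime t) x * u₀ (clampTime t) x k) x
  have cf : Continuous fun z : ℝ × Torus d => f z.1 z.2 :=
    cD.add (continuous_finsetSum _ fun k _ => cP k)
  have cR : ∀ k, Continuous fun z : ℝ × Torus d => antidiv (f z.1) z.2 k := fun k =>
    continuous_antidivList _ cf k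
  refine ⟨fun k t x => antidiv (f t) x k, ⟨hρ.continuous_clamp,
    fun k => (hu.component k).continuous_clamp, cR, fun φ hφ => ?_, fun φ hφ => ?_⟩, ?_⟩
  · have cφ := hφ.smooth.continuous
    have cφt := (hφ.smooth.dirDeriv (1, 0)).continuous
    have cφ' := fun k => (hφ.smooth.dirDeriv (eDir k)).continuous
    have c0 := hρ.continuous_clamp
    have e0 := integral_spaceTime_deriv_eq_zero (h := fun t x => ρ₀ (clampTime t) x * φ t x)
      (h' := fun t x => derivWithin (fun s => ρ₀ s x) (Icc 0 1) (clampTime t) * φ t x +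
        ρ₀ (clampTime t) x * dirDeriv (1, 0) φ t x) (c0.mul cφ) ((cD.mul cφ).add (c0.mul cφt))
      (fun t ht x => (hρ.hasDerivAt_clamp ht x).mul (hφ.smooth.hasDerivAt_time t x))
      (fun x => by rw [hφ.eq_zero (by simp), mul_zero])
      (fun x => by rw [hφ.eq_zero (by simp), mul_zero])
    have cS : Continuous fun z : ℝ × Torus d => ∑ k, ρ₀ (clampTime z.1) z.2 *
        u₀ (clampTime z.1) z.2 k * dirDeriv (eDir k) φ z.1 z.2 :=
      continuous_finsetSum _ fun k _ => (c0.mul (hu.component k).continuous_clamp).mul (cφ' k)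
    have cSR : Continuous fun z : ℝ × Torus d => ∑ k, antidiv (f z.1) z.2 k *
        dirDeriv (eDir k) φ z.1 z.2 := continuous_finsetSum _ fun k _ => (cR k).mul (cφ' k)
    have e1 : ∀ z : ℝ × Torus d, ρ₀ (clampTime z.1) z.2 * dirDeriv (1, 0) φ z.1 z.2 +
        ∑ k, ρ₀ (clampTime z.1) z.2 * u₀ (clampTime z.1) z.2 k * dirDeriv (eDir k) φ z.1 z.2 =
        (derivWithin (fun s => ρ₀ s z.2) (Icc 0 1) (clampTime z.1) * φ z.1 z.2 +
          ρ₀ (clampTime z.1) z.2 * dirDeriv (1, 0) φ z.1 z.2) +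
        ((∑ k, ρ₀ (clampTime z.1) z.2 * u₀ (clampTime z.1) z.2 k * dirDeriv (eDir k) φ z.1 z.2) -
          derivWithin (fun s => ρ₀ s z.2) (Icc 0 1) (clampTime z.1) * φ z.1 z.2) := fun z => by ring
    simp only [e1]
    rw [integral_add, e0, zero_add]
    rotate_left
    · exact integrable_spaceTime ((cD.mul cφ).add (c0.mul cφt))
    · exact integrable_spaceTime (cS.sub (cD.mul cφ))
    refine integral_spaceTime_congr (integrable_spaceTime (cS.sub (cD.mul cφ)))
      (integrable_spaceTime cSR) fun t ht => ?_
    have sl : ∀ {F : ℝ × Torus d → ℝ}, Continuous F → Continuous fun x => F (t, x) :=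
      fun h => h.comp (Continuous.prodMk_right t)
    have i1 := integral_sum_mul_dirDeriv hφ t
      (fun k => (hρu k).hasPartial_Icc (clampTime_mem t) k)
      (fun k => (hρu k).continuous_slice_Icc (clampTime_mem t)) (fun k => sl (cP k))
    obtain ⟨g, cg, hg, sg⟩ := hasPartial_antidivList (List.finRange d) (f := f t) (sl cf)
    have i2 := integral_sum_mul_dirDeriv hφ t hg (fun k => sl (cR k)) cg
    have hf0 : ∫ x, f t x = 0 := by
      have i3 : ∫ x, f t x = _ := integral_add (integrable_of_continuous (sl cD))
        (integrable_of_continuous (continuous_finsetSum _ fun k _ => sl (cP k)))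
      rw [i3, integral_derivWithin_eq_zero hρ hmean ht,
        integral_finsetSum _ fun k _ => integrable_of_continuous (sl (cP k)), zero_add]
      exact Finset.sum_eq_zero fun k _ =>
        ((hρu k).hasPartial_Icc (clampTime_mem t) k).integral_eq_zero
        ((hρu k).continuous_slice_Icc (clampTime_mem t)) (sl (cP k))
    have i4 : ∫ x, (∑ k, g k x) * φ t x =
        (∫ x, derivWithin (fun s => ρ₀ s x) (Icc 0 1) (clampTime t) * φ t x) +
        ∫ x, (∑ k, pderiv k (fun x => ρ₀ (clampTime t) x * u₀ (clampTime t) x k) x) * φ t x := by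
      rw [← integral_add]
      · refine integral_congr_ae (Filter.Eventually.of_forall fun x => ?_)
        simp only [sg x, avgList_finRange (sl cf), hf0, sub_zero, f]
        ring
      · exact integrable_of_continuous ((sl cD).mul (sl cφ))
      · exact integrable_of_continuous ((continuous_finsetSum _ fun k _ => sl (cP k)).mul (sl cφ))
    have i5 : ∫ x, (∑ k, antidiv (f t) x k * dirDeriv (eDir k) φ t x) = _ := i2
    rw [i5, i4, integral_sub, i1]
    · ring
    · exact integrable_of_continuous (sl cS)
    · exact integrable_of_continuous ((sl cD).mul (sl cφ))
  · have cφ := hφ.smooth.continuous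
    have cφ' := fun k => (hφ.smooth.dirDeriv (eDir k)).continuous
    have cS : Continuous fun z : ℝ × Torus d => ∑ k,
        u₀ (clampTime z.1) z.2 k * dirDeriv (eDir k) φ z.1 z.2 :=
      continuous_finsetSum _ fun k _ => (hu.component k).continuous_clamp.mul (cφ' k)
    rw [integral_spaceTime_congr (integrable_spaceTime cS)
      (integrable_spaceTime (continuous_const (y := (0 : ℝ)))) fun t ht => ?_]
    · simp
    have i1 := integral_sum_mul_dirDeriv hφ t
      (fun k => (hu.component k).hasPartial_Icc (clampTime_mem t) k)
      (fun k => (hu.component k).continuous_slice_Icc (clampTime_mem t))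
      (fun k => ((hu.component k).continuous_pderiv_clamp k).comp (Continuous.prodMk_right t))
    have i2 : ∀ x, ∑ k, pderiv k (fun z => u₀ (clampTime t) z k) x = 0 :=
      hdiv _ (clampTime_mem t)
    simp only [i2, zero_mul, integral_zero, neg_zero] at i1
    simpa using i1
  · rintro t ⟨ht, hz⟩ k x
    have : f t = fun _ => 0 := by
      ext x
      simpa only [f, clampTime_of_mem ht, divergence, PiLp.smul_apply, smul_eq_mul] using hz x
    simp only [this, antidiv, antidivList_zero]

end ContinuityEq

namespace ContinuityEq

open Filter Topology

variable {d : ℕ} {E : Type*} [NormedAddCommGroup E] [NormedSpace ℝ E]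

/-! ### Series of functions with summable integrals -/

/-- A series whose `L¹` norms are summable converges absolutely almost everywhere, with integrable
sum of the absolute values. -/
lemma ae_summable_of_integral_le {α G : Type*} [MeasurableSpace α] {μ : Measure α}
    [NormedAddCommGroup G] {F : ℕ → α → G} (hF : ∀ n, Integrable (F n) μ) {a : ℕ → ℝ}
    (ha : Summable a) (h : ∀ n, ∫ x, ‖F n x‖ ∂μ ≤ a n) :
    (∀ᵐ x ∂μ, Summable fun n => ‖F n x‖) ∧ Integrable (fun x => ∑' n, ‖F n x‖) μ := by
  have hfin : ∫⁻ x, ∑' n, ‖F n x‖ₑ ∂μ ≠ ⊤ := by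
    rw [lintegral_tsum fun n => (hF n).1.enorm]
    refine ne_top_of_le_ne_top ha.tsum_ofReal_ne_top (ENNReal.tsum_le_tsum fun n => ?_)
    rw [← ofReal_integral_norm_eq_lintegral_enorm (hF n)]
    exact ENNReal.ofReal_le_ofReal (h n)
  have hs : ∀ᵐ x ∂μ, Summable fun n => ‖F n x‖ := by
    filter_upwards [ae_lt_top' (AEMeasurable.tsum fun n => (hF n).1.enorm) hfin] with x hx
    have := ENNReal.tsum_coe_ne_top_iff_summable.1 hx.ne
    exact NNReal.summable_coe.2 this
  refine ⟨hs, ?_, ?_⟩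
  · refine aestronglyMeasurable_of_tendsto_ae atTop
      (f := fun N x => ∑ n ∈ Finset.range N, ‖F n x‖)
      (fun N => Finset.aestronglyMeasurable_fun_sum _ fun n _ => (hF n).1.norm) ?_
    filter_upwards [hs] with x hx using hx.hasSum.tendsto_sum_nat
  · rw [hasFiniteIntegral_iff_enorm]
    refine (lintegral_mono_ae ?_).trans_lt hfin.lt_top
    filter_upwards [hs] with x hx
    rw [Real.enorm_of_nonneg (tsum_nonneg fun n => norm_nonneg _),
      ENNReal.ofReal_tsum_of_nonneg (fun n => norm_nonneg _) hx]
    exact ENNReal.tsum_le_tsum fun n => (ofReal_norm _).le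

/-- A series of continuous functions with summable `L^p` norms defines an element of
`C([0,1]; L^p)`. -/
lemma continuousInLp_tsum [CompleteSpace E] {p : ℝ≥0∞} [Fact (1 ≤ p)] {f : ℕ → ℝ → Torus d → E}
    (cf : ∀ n, Continuous fun z : ℝ × Torus d => f n z.1 z.2) {a : ℕ → ℝ} (ha : Summable a)
    (ha0 : ∀ n, 0 ≤ a n)
    (h : ∀ᶠ n in atTop, ∀ t, eLpNorm (f n t) p volume ≤ ENNReal.ofReal (a n))
    {g : ℝ → Torus d → E} (hg : ∀ t, ∀ᵐ x, Tendsto (fun N => ∑ n ∈ Finset.range N, f n t x) atTop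
      (𝓝 (g t x))) : ContinuousInLp p g := by
  let c : ℕ → ℝ → C(Torus d, E) := fun n => (ContinuousMap.mk _ (cf n)).curry
  let T : ℕ → ℝ → Lp E p (volume : Measure (Torus d)) :=
    fun n t => ContinuousMap.toLp p volume ℝ (c n t)
  have cT : ∀ n, Continuous (T n) := fun n =>
    (ContinuousMap.toLp p volume ℝ).continuous.comp (ContinuousMap.mk _ (cf n)).curry.continuous
  have hT : ∀ n t, T n t =ᵐ[volume] f n t := fun n t => ContinuousMap.coeFn_toLp volume (c n t)
  have hb : ∀ᶠ n in cofinite, ∀ t, ‖T n t‖ ≤ a n := by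
    rw [Nat.cofinite_eq_atTop]
    filter_upwards [h] with n hn t
    rw [Lp.norm_def, eLpNorm_congr_ae (hT n t)]
    exact ENNReal.toReal_le_of_le_ofReal (ha0 n) (hn t)
  refine ⟨fun t => ∑' n, T n t, ?_, fun t _ => ?_⟩
  · exact ((tendstoUniformly_tsum_of_cofinite_eventually ha hb).continuous
      (Frequently.of_forall fun s => continuous_finsetSum _ fun n _ => cT n)).continuousOn
  · have hs : Summable fun n => T n t :=
      Summable.of_norm_bounded_eventually ha (hb.mono fun n hn => hn t)
    have h1 := tendstoInMeasure_of_tendsto_Lp hs.hasSum.tendsto_sum_nat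
    obtain ⟨ns, hns, h2⟩ := h1.exists_seq_tendsto_ae
    have h3 : ∀ᵐ x, ∀ N, (∑ n ∈ Finset.range N, T n t : Lp E p (volume : Measure (Torus d))) x =
        ∑ n ∈ Finset.range N, f n t x := by
      refine ae_all_iff.2 fun N => ?_
      have : ∑ n ∈ Finset.range N, T n t =
          ContinuousMap.toLp p volume ℝ (∑ n ∈ Finset.range N, c n t) := by
        rw [map_sum]
      rw [this]
      filter_upwards [ContinuousMap.coeFn_toLp (p := p) (𝕜 := ℝ) volume
        (∑ n ∈ Finset.range N, c n t)] with x hx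
      rw [hx, ContinuousMap.sum_apply]
      rfl
    filter_upwards [h2, h3, hg t] with x x2 x3 x4
    simp only [x3] at x2
    exact tendsto_nhds_unique x2 (x4.comp hns.tendsto_atTop)

/-! ### Weak derivatives of series -/

lemma integral_smul_partial {i : Fin d} {φ φ' : Torus d → ℝ} {f f' : Torus d → E}
    (hφ : HasPartial i φ φ') (hf : HasPartial i f f') (cφ : Continuous φ) (cφ' : Continuous φ')
    (cf : Continuous f) (cf' : Continuous f') : ∫ x, φ' x • f x = -∫ x, φ x • f' x := by
  have h := (hφ.smul hf).integral_eq_zero (cφ.smul cf) ((cφ.smul cf').add (cφ'.smul cf))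
  rw [integral_add (f := fun x => φ x • f' x) (g := fun x => φ' x • f x)
    (integrable_of_continuous (cφ.smul cf')) (integrable_of_continuous (cφ'.smul cf))] at h
  exact eq_neg_of_add_eq_zero_right h

lemma exists_bound_torus {φ : Torus d → ℝ} (hφ : Continuous φ) :
    ∃ C : ℝ, 0 ≤ C ∧ ∀ x, ‖φ x‖ ≤ C := by
  obtain ⟨C, hC⟩ := isCompact_univ.exists_bound_of_continuousOn hφ.continuousOn
  exact ⟨C, (norm_nonneg _).trans (hC 0 (mem_univ _)), fun x => hC x (mem_univ _)⟩

/-- Series may be differentiated termwise in the weak sense if they and the series of the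
derivatives converge absolutely in `L¹`. -/
lemma isWeakPartial_tsum [CompleteSpace E] {i : Fin d} {f f' : ℕ → Torus d → E}
    (hf : ∀ n, HasPartial i (f n) (f' n)) (cf : ∀ n, Continuous (f n))
    (cf' : ∀ n, Continuous (f' n)) {a : ℕ → ℝ} (ha : Summable a) (h : ∀ n, ∫ x, ‖f n x‖ ≤ a n)
    (h' : ∀ n, ∫ x, ‖f' n x‖ ≤ a n) :
    IsWeakPartial i (fun x => ∑' n, f n x) (fun x => ∑' n, f' n x) := by
  have int : ∀ {f : ℕ → Torus d → E}, (∀ n, Continuous (f n)) → (∀ n, ∫ x, ‖f n x‖ ≤ a n) →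
      Integrable fun x => ∑' n, f n x := by
    intro f cf h
    obtain ⟨h1, h2⟩ := ae_summable_of_integral_le
      (fun n => integrable_of_continuous (cf n)) ha h
    refine h2.mono' ?_ ?_
    · refine aestronglyMeasurable_of_tendsto_ae atTop
        (f := fun N x => ∑ n ∈ Finset.range N, f n x)
        (fun N => (continuous_finsetSum _ fun n _ => cf n).aestronglyMeasurable) ?_
      filter_upwards [h1] with x hx using hx.of_norm.hasSum.tendsto_sum_nat
    · filter_upwards [h1] with x hx using norm_tsum_le_tsum_norm hx
  have ser : ∀ {φ : Torus d → ℝ} {f : ℕ → Torus d → E}, Continuous φ → (∀ n, Continuous (f n)) →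
      (∀ n, ∫ x, ‖f n x‖ ≤ a n) →
      HasSum (fun n => ∫ x, φ x • f n x) (∫ x, φ x • ∑' n, f n x) := by
    intro φ f cφ cf h
    obtain ⟨C, hC0, hC⟩ := exists_bound_torus cφ
    have := hasSum_integral_of_summable_integral_norm (F := fun n x => φ x • f n x)
      (fun n => integrable_of_continuous (cφ.smul (cf n))) (by
        refine Summable.of_nonneg_of_le (fun n => integral_nonneg fun x => norm_nonneg _)
          (fun n => ?_) (ha.mul_left C)
        have : ∫ x, ‖φ x • f n x‖ ≤ ∫ x, C * ‖f n x‖ := by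
          refine integral_mono (integrable_of_continuous (cφ.smul (cf n)).norm)
            (integrable_of_continuous (continuous_const.mul (cf n).norm)) fun x => ?_
          simp only [norm_smul]
          exact mul_le_mul_of_nonneg_right (hC x) (norm_nonneg _)
        rw [integral_const_mul] at this
        exact this.trans (mul_le_mul_of_nonneg_left (h n) hC0))
    simpa only [tsum_const_smul''] using this
  refine ⟨int cf h, int cf' h', fun φ hφ => ?_⟩
  have e1 := ser (hφ.pderiv i).continuous cf h
  have e2 := (ser hφ.continuous cf' h').neg
  refine e1.unique ?_
  convert e2 using 2 with n
  exact integral_smul_partial (hφ.hasPartial i) (hf n) hφ.continuous (hφ.pderiv i).continuous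
    (cf n) (cf' n)

end ContinuityEq

namespace ContinuityEq

open Filter Topology

variable {d : ℕ}

/-! ### Passage to the limit -/

/-- `∑ ϑ n` and `∑ W n` are series, with gradients `DW n`, whose partial sums solve the equations
up to defects `R n` which tend to zero. The gradients are small in `L^(p n)`. -/
structure IsSeries (a : ℕ → ℝ) (p : ℕ → ℝ≥0∞) (ϑ : ℕ → ℝ → Torus d → ℝ)
    (W : ℕ → ℝ → Torus d → Vec d) (DW : ℕ → Fin d → ℝ → Torus d → Vec d)
    (R : ℕ → Fin d → ℝ → Torus d → ℝ) : Prop where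
  nonneg : ∀ n, 0 ≤ a n
  summable : Summable a
  one_le : ∀ n, 1 ≤ p n
  cont_density : ∀ n, Continuous fun z : ℝ × Torus d => ϑ n z.1 z.2
  cont_velocity : ∀ n, Continuous fun z : ℝ × Torus d => W n z.1 z.2
  cont_gradient : ∀ n i, Continuous fun z : ℝ × Torus d => DW n i z.1 z.2
  hasPartial : ∀ n i t, HasPartial i (W n t) (DW n i t)
  density_le : ∀ n t, ∫ x, |ϑ n t x| ≤ a n
  velocity_le : ∀ n t x, ‖W n t x‖ ≤ a n
  gradient_Lp : ∀ n i t, eLpNorm (DW n i t) (p n) volume ≤ ENNReal.ofReal (a n)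
  isSub : ∀ n, IsSub (fun t x => ∑ m ∈ Finset.range (n + 1), ϑ m t x)
    (fun k t x => (∑ m ∈ Finset.range (n + 1), W m t x) k) (R n)
  defect_le : ∀ n k, ∀ t ∈ Ioo (0 : ℝ) 1, ∫ x, |R n k t x| ≤ a n

lemma eLpNorm_le_of_forall_norm_le {G : Type*} [NormedAddCommGroup G] {f : Torus d → G}
    {p : ℝ≥0∞} {C : ℝ} (h : ∀ x, ‖f x‖ ≤ C) : eLpNorm f p volume ≤ ENNReal.ofReal C := by
  refine (eLpNorm_le_of_ae_bound (Eventually.of_forall h)).trans ?_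
  simp

lemma IsTestFunction.exists_bound {φ : ℝ → Torus d → ℝ} (hφ : IsTestFunction φ) :
    ∃ C : ℝ, 0 ≤ C ∧ ∀ z : ℝ × Torus d, ‖φ z.1 z.2‖ ≤ C := by
  obtain ⟨C, hC⟩ := hφ.compact.exists_bound_of_continuous hφ.smooth.continuous
  exact ⟨C, (norm_nonneg _).trans (hC (0, 0)), hC⟩

lemma integral_spaceTime_norm_le {G : Type*} [NormedAddCommGroup G] {F : ℝ → Torus d → G}
    (hF : Continuous fun z : ℝ × Torus d => F z.1 z.2) {C : ℝ}
    (h : ∀ t ∈ Ioo (0 : ℝ) 1, ∫ x, ‖F t x‖ ≤ C) :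
    ∫ z : ℝ × Torus d, ‖F z.1 z.2‖ ∂(spaceTime d) ≤ C := by
  have hi := integrable_spaceTime hF.norm
  rw [integral_spaceTime hi]
  have h1 : ∫ t in Ioo (0 : ℝ) 1, ∫ x, ‖F t x‖ ≤ ∫ _ in Ioo (0 : ℝ) 1, C := by
    refine setIntegral_mono_on ?_ (integrableOn_const (by simp)) measurableSet_Ioo h
    exact Integrable.integral_prod_left hi
  simpa using h1

namespace IsSeries

variable {a : ℕ → ℝ} {p : ℕ → ℝ≥0∞} {ϑ : ℕ → ℝ → Torus d → ℝ}
  {W : ℕ → ℝ → Torus d → Vec d} {DW : ℕ → Fin d → ℝ → Torus d → Vec d}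
  {R : ℕ → Fin d → ℝ → Torus d → ℝ}

lemma hasSum_velocity (h : IsSeries a p ϑ W DW R) (t : ℝ) (x : Torus d) :
    HasSum (fun n => W n t x) (∑' n, W n t x) :=
  (Summable.of_norm_bounded h.summable fun n => h.velocity_le n t x).hasSum

lemma continuous_velocity (h : IsSeries a p ϑ W DW R) :
    Continuous fun z : ℝ × Torus d => ∑' n, W n z.1 z.2 :=
  continuous_tsum h.cont_velocity h.summable fun n z => h.velocity_le n z.1 z.2

lemma integral_gradient_le (h : IsSeries a p ϑ W DW R) (n : ℕ) (i : Fin d) (t : ℝ) :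
    ∫ x, ‖DW n i t x‖ ≤ a n :=
  integral_norm_le_of_eLpNorm_le ((h.cont_gradient n i).comp (Continuous.prodMk_right t))
    (h.one_le n) (h.nonneg n) (h.gradient_Lp n i t)

lemma integral_velocity_le (h : IsSeries a p ϑ W DW R) (n : ℕ) (t : ℝ) :
    ∫ x, ‖W n t x‖ ≤ a n :=
  integral_norm_le_of_eLpNorm_le ((h.cont_velocity n).comp (Continuous.prodMk_right t))
    le_rfl (h.nonneg n) (eLpNorm_le_of_forall_norm_le (h.velocity_le n t))

lemma hasRegularity (h : IsSeries a p ϑ W DW R)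
    (hp : ∀ q : ℝ≥0∞, q < (d : ℝ≥0∞) - 1 → ∀ᶠ n in atTop, q ≤ p n) :
    HasRegularity (fun t x => ∑' n, ϑ n t x) (fun t x => ∑' n, W n t x) where
  density := by
    refine continuousInLp_tsum h.cont_density h.summable h.nonneg
      (Eventually.of_forall fun n t => ?_) fun t => ?_
    · have c : Continuous (ϑ n t) := (h.cont_density n).comp (Continuous.prodMk_right t)
      rw [eLpNorm_one_eq_lintegral_enorm,
        ← ofReal_integral_norm_eq_lintegral_enorm (integrable_of_continuous c)]
      exact ENNReal.ofReal_le_ofReal (h.density_le n t)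
    · filter_upwards [(ae_summable_of_integral_le (fun n => integrable_of_continuous
        ((h.cont_density n).comp (Continuous.prodMk_right t))) h.summable
        fun n => h.density_le n t).1] with x hx using hx.of_norm.hasSum.tendsto_sum_nat
  velocity := h.continuous_velocity.continuousOn
  sobolev q _ hq := by
    refine ⟨continuousInLp_tsum h.cont_velocity h.summable h.nonneg
      (Eventually.of_forall fun n t => eLpNorm_le_of_forall_norm_le (h.velocity_le n t))
      fun t => Eventually.of_forall fun x => (h.hasSum_velocity t x).tendsto_sum_nat, fun i =>
      ⟨fun t x => ∑' n, DW n i t x, continuousInLp_tsum (fun n => h.cont_gradient n i) h.summable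
        h.nonneg ?_ fun t => ?_, fun t _ => ?_⟩⟩
    · filter_upwards [hp q hq] with n hn t
      exact (eLpNorm_le_eLpNorm_of_exponent_le hn ((h.cont_gradient n i).comp
        (Continuous.prodMk_right t)).aestronglyMeasurable).trans (h.gradient_Lp n i t)
    · filter_upwards [(ae_summable_of_integral_le (fun n => integrable_of_continuous
        ((h.cont_gradient n i).comp (Continuous.prodMk_right t))) h.summable
        fun n => h.integral_gradient_le n i t).1] with x hx using hx.of_norm.hasSum.tendsto_sum_nat
    · exact isWeakPartial_tsum (fun n => h.hasPartial n i t)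
        (fun n => (h.cont_velocity n).comp (Continuous.prodMk_right t))
        (fun n => (h.cont_gradient n i).comp (Continuous.prodMk_right t)) h.summable
        (fun n => h.integral_velocity_le n t) (fun n => h.integral_gradient_le n i t)

lemma norm_sum_velocity_le (h : IsSeries a p ϑ W DW R) (N : ℕ) (t : ℝ) (x : Torus d) :
    ‖∑ m ∈ Finset.range N, W m t x‖ ≤ ∑' n, a n :=
  (norm_sum_le _ _).trans ((Finset.sum_le_sum fun m _ => h.velocity_le m t x).trans
    (h.summable.sum_le_tsum _ fun m _ => h.nonneg m))

lemma norm_tsum_velocity_le (h : IsSeries a p ϑ W DW R) (t : ℝ) (x : Torus d) :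
    ‖∑' n, W n t x‖ ≤ ∑' n, a n :=
  tsum_of_norm_bounded h.summable.hasSum fun n => h.velocity_le n t x

/-- The partial sums of the densities are dominated by an integrable function, those of the
velocities are bounded, and the defects tend to zero in `L¹`: all terms pass to the limit. -/
lemma isWeakSolution (h : IsSeries a p ϑ W DW R) :
    IsWeakSolution (fun t x => ∑' n, ϑ n t x) (fun t x => ∑' n, W n t x) := by
  obtain ⟨A, hA⟩ : ∃ A, A = ∑' n, a n := ⟨_, rfl⟩
  have hA0 : 0 ≤ A := by rw [hA]; exact tsum_nonneg h.nonneg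
  obtain ⟨hs, hi⟩ := ae_summable_of_integral_le (μ := spaceTime d)
    (F := fun n (z : ℝ × Torus d) => ϑ n z.1 z.2)
    (fun n => integrable_spaceTime (h.cont_density n)) h.summable
    fun n => integral_spaceTime_norm_le (h.cont_density n) fun t _ => h.density_le n t
  have hlim : ∀ᵐ z ∂(spaceTime d), Tendsto (fun N => ∑ n ∈ Finset.range (N + 1), ϑ n z.1 z.2) atTop
      (𝓝 (∑' n, ϑ n z.1 z.2)) := by
    filter_upwards [hs] with z hz
    exact hz.of_norm.hasSum.tendsto_sum_nat.comp (tendsto_add_atTop_nat 1)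
  have hlimW : ∀ (z : ℝ × Torus d) k, Tendsto
      (fun N => (∑ n ∈ Finset.range (N + 1), W n z.1 z.2) k) atTop
      (𝓝 ((∑' n, W n z.1 z.2) k)) := fun z k =>
    ((EuclideanSpace.proj (𝕜 := ℝ) k : Vec d →L[ℝ] ℝ).continuous.tendsto _).comp
      ((h.hasSum_velocity z.1 z.2).tendsto_sum_nat.comp (tendsto_add_atTop_nat 1))
  have hbd : ∀ᵐ z ∂(spaceTime d), ∀ N, |∑ n ∈ Finset.range N, ϑ n z.1 z.2| ≤
      ∑' n, ‖ϑ n z.1 z.2‖ := by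
    filter_upwards [hs] with z hz N
    exact (Finset.abs_sum_le_sum_abs _ _).trans (hz.sum_le_tsum _ fun m _ => abs_nonneg _)
  have hmeas : AEStronglyMeasurable (fun z : ℝ × Torus d => ∑' n, ϑ n z.1 z.2) (spaceTime d) := by
    refine aestronglyMeasurable_of_tendsto_ae atTop
      (fun N => (integrable_spaceTime (continuous_finsetSum _ fun n _ => h.cont_density n)).1) hlim
  have hbd' : ∀ᵐ z ∂(spaceTime d), ‖∑' n, ϑ n z.1 z.2‖ ≤ ∑' n, ‖ϑ n z.1 z.2‖ := by
    filter_upwards [hs] with z hz using norm_tsum_le_tsum_norm hz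
  have hk : ∀ (v : Vec d) k, ‖v‖ ≤ A → |v k| ≤ A := fun v k hv =>
    (PiLp.norm_apply_le v k).trans hv
  have cW : ∀ N, Continuous fun z : ℝ × Torus d => ∑ n ∈ Finset.range N, W n z.1 z.2 := fun N =>
    continuous_finsetSum _ fun n _ => h.cont_velocity n
  have cWk : ∀ N k, Continuous fun z : ℝ × Torus d => (∑ n ∈ Finset.range N, W n z.1 z.2) k :=
    fun N k => (EuclideanSpace.proj (𝕜 := ℝ) k : Vec d →L[ℝ] ℝ).continuous.comp (cW N)
  have cϑ : ∀ N, Continuous fun z : ℝ × Torus d => ∑ n ∈ Finset.range N, ϑ n z.1 z.2 := fun N =>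
    continuous_finsetSum _ fun n _ => h.cont_density n
  refine ⟨hi.mono' hmeas hbd', integrable_spaceTime h.continuous_velocity, ?_, ?_, ?_⟩
  · refine (hi.mul_const A).mono'
      (hmeas.smul (integrable_spaceTime h.continuous_velocity).1) ?_
    filter_upwards [hbd'] with z hz
    rw [norm_smul]
    exact mul_le_mul hz (hA ▸ h.norm_tsum_velocity_le z.1 z.2) (norm_nonneg _)
      ((norm_nonneg _).trans hz)
  · intro φ hφ
    have e1 : ∀ z : ℝ × Torus d, deriv (fun s => φ s z.2) z.1 = dirDeriv (1, 0) φ z.1 z.2 :=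
      fun z => (hφ.smooth.hasDerivAt_time z.1 z.2).deriv
    have e2 : ∀ (z : ℝ × Torus d) i, pderiv i (φ z.1) z.2 = dirDeriv (eDir i) φ z.1 z.2 :=
      fun z i => congrFun (hφ.smooth.pderiv_eq i z.1) z.2
    simp only [e1, e2]
    have cφt := (hφ.smooth.dirDeriv (1, 0)).continuous
    have cφ := fun k => (hφ.smooth.dirDeriv (eDir k)).continuous
    obtain ⟨C₀, hC₀0, hC₀⟩ := (hφ.dirDeriv (1, 0)).exists_bound
    choose C hC0 hC using fun k => (hφ.dirDeriv (eDir k)).exists_bound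
    have lim1 := tendsto_integral_of_dominated_convergence (μ := spaceTime d)
      (F := fun N z => (∑ m ∈ Finset.range (N + 1), ϑ m z.1 z.2) * dirDeriv (1, 0) φ z.1 z.2 +
        ∑ k, (∑ m ∈ Finset.range (N + 1), ϑ m z.1 z.2) *
          (∑ m ∈ Finset.range (N + 1), W m z.1 z.2) k * dirDeriv (eDir k) φ z.1 z.2)
      (f := fun z => (∑' n, ϑ n z.1 z.2) * dirDeriv (1, 0) φ z.1 z.2 +
        ∑ k, (∑' n, ϑ n z.1 z.2) * (∑' n, W n z.1 z.2) k * dirDeriv (eDir k) φ z.1 z.2)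
      (fun z => (∑' n, ‖ϑ n z.1 z.2‖) * (C₀ + ∑ k, A * C k))
      (fun N => (integrable_spaceTime (((cϑ _).mul cφt).add (continuous_finsetSum _ fun k _ =>
        ((cϑ _).mul (cWk _ k)).mul (cφ k)))).1)
      (hi.mul_const _) (fun N => ?_) ?_
    · have lim2 : Tendsto (fun N => ∫ z : ℝ × Torus d, (∑ k, R N k z.1 z.2 *
          dirDeriv (eDir k) φ z.1 z.2) ∂(spaceTime d)) atTop (𝓝 0) := by
        refine squeeze_zero_norm (a := fun N => (∑ k, C k) * a N) (fun N => ?_) ?_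
        · have cR := (h.isSub N).cont_defect
          rw [integral_finsetSum (f := fun k (z : ℝ × Torus d) =>
            R N k z.1 z.2 * dirDeriv (eDir k) φ z.1 z.2) _
            fun k _ => integrable_spaceTime ((cR k).mul (cφ k)), Finset.sum_mul]
          refine (norm_sum_le _ _).trans (Finset.sum_le_sum fun k _ => ?_)
          refine (norm_integral_le_integral_norm _).trans ?_
          have := integral_spaceTime_norm_le (cR k) (h.defect_le N k)
          calc ∫ z : ℝ × Torus d, ‖R N k z.1 z.2 * dirDeriv (eDir k) φ z.1 z.2‖ ∂(spaceTime d)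
              ≤ ∫ z : ℝ × Torus d, C k * ‖R N k z.1 z.2‖ ∂(spaceTime d) := by
                refine integral_mono (integrable_spaceTime ((cR k).mul (cφ k)).norm)
                  (integrable_spaceTime (continuous_const.mul (cR k).norm)) fun z => ?_
                simp only [norm_mul]
                rw [mul_comm]
                exact mul_le_mul_of_nonneg_right (hC k z) (norm_nonneg _)
            _ ≤ C k * a N := by
                rw [integral_const_mul]
                exact mul_le_mul_of_nonneg_left this (hC0 k)
        · simpa using h.summable.tendsto_atTop_zero.const_mul (∑ k, C k)
      refine tendsto_nhds_unique lim1 ?_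
      convert lim2 using 2 with N
      exact (h.isSub N).continuity φ hφ
    · filter_upwards [hbd] with z hz
      have hz' := hz (N + 1)
      have hg0 := (abs_nonneg _).trans hz'
      rw [Real.norm_eq_abs, mul_add, Finset.mul_sum]
      refine (abs_add_le _ _).trans (add_le_add (abs_mul_le_mul hz' (hC₀ z))
        ((Finset.abs_sum_le_sum_abs _ _).trans (Finset.sum_le_sum fun k _ => ?_)))
      rw [← mul_assoc]
      exact abs_mul_le_mul (abs_mul_le_mul hz' (hk _ k (hA ▸ h.norm_sum_velocity_le _ _ _)))
        (hC k z)
    · filter_upwards [hlim] with z hz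
      exact (hz.mul_const _).add (tendsto_finsetSum _ fun k _ => (hz.mul (hlimW z k)).mul_const _)
  · intro φ hφ
    have e2 : ∀ (z : ℝ × Torus d) i, pderiv i (φ z.1) z.2 = dirDeriv (eDir i) φ z.1 z.2 :=
      fun z i => congrFun (hφ.smooth.pderiv_eq i z.1) z.2
    simp only [e2]
    have cφ := fun k => (hφ.smooth.dirDeriv (eDir k)).continuous
    choose C hC0 hC using fun k => (hφ.dirDeriv (eDir k)).exists_bound
    have lim1 := tendsto_integral_of_dominated_convergence (μ := spaceTime d)
      (F := fun N z => ∑ k, (∑ m ∈ Finset.range (N + 1), W m z.1 z.2) k *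
        dirDeriv (eDir k) φ z.1 z.2)
      (f := fun z => ∑ k, (∑' n, W n z.1 z.2) k * dirDeriv (eDir k) φ z.1 z.2)
      (fun z => ∑ k, A * C k)
      (fun N => (integrable_spaceTime (continuous_finsetSum _ fun k _ =>
        (cWk _ k).mul (cφ k))).1)
      (integrable_const _) (fun N => Eventually.of_forall fun z => ?_)
      (Eventually.of_forall fun z => tendsto_finsetSum _ fun k _ => (hlimW z k).mul_const _)
    · refine tendsto_nhds_unique lim1 ?_
      convert tendsto_const_nhds (x := (0 : ℝ)) (f := atTop (α := ℕ)) using 2 with N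
      exact (h.isSub N).incompressible φ hφ
    · refine (Finset.abs_sum_le_sum_abs _ _).trans (Finset.sum_le_sum fun k _ => ?_)
      exact abs_mul_le_mul (hk _ k (hA ▸ h.norm_sum_velocity_le _ _ _)) (hC k z)

end IsSeries

end ContinuityEq

namespace ContinuityEq

open Filter Topology

variable {d : ℕ}

/-! ### Iteration -/

/-- The equations only see the times in `(0,1)`. -/
lemma IsSub.congr {ρ ρ' : ℝ → Torus d → ℝ} {u u' R R' : Fin d → ℝ → Torus d → ℝ} (h : IsSub ρ u R)
    (cρ : Continuous fun z : ℝ × Torus d => ρ' z.1 z.2)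
    (cu : ∀ k, Continuous fun z : ℝ × Torus d => u' k z.1 z.2)
    (cR : ∀ k, Continuous fun z : ℝ × Torus d => R' k z.1 z.2)
    (eρ : ∀ t ∈ Icc (0 : ℝ) 1, ∀ x, ρ' t x = ρ t x)
    (eu : ∀ t ∈ Icc (0 : ℝ) 1, ∀ k x, u' k t x = u k t x)
    (eR : ∀ t ∈ Icc (0 : ℝ) 1, ∀ k x, R' k t x = R k t x) : IsSub ρ' u' R' := by
  refine ⟨cρ, cu, cR, fun φ hφ => ?_, fun φ hφ => ?_⟩
  · convert h.continuity φ hφ using 1 <;> refine integral_congr_ae ?_ <;>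
      filter_upwards [ae_spaceTime_mem] with z hz
    · simp only [eρ _ (Ioo_subset_Icc_self hz), eu _ (Ioo_subset_Icc_self hz)]
    · simp only [eR _ (Ioo_subset_Icc_self hz)]
  · rw [← h.incompressible φ hφ]
    refine integral_congr_ae ?_
    filter_upwards [ae_spaceTime_mem] with z hz
    simp only [eu _ (Ioo_subset_Icc_self hz)]

/-- The iteration of the perturbation step, with defects decaying like `4⁻ⁿ` and parameters
`η = σ 2ⁿ`. -/
theorem exists_sequence (hd : 3 ≤ d) : ∃ M : ℝ, 0 < M ∧ ∀ (ρ : ℝ → Torus d → ℝ)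
    (u R : Fin d → ℝ → Torus d → ℝ), IsSub ρ u R → ∀ r : ℝ, 0 < r →
    (∀ t ∈ Icc (0 : ℝ) 1, ∀ k, ∫ x, |R k t x| ≤ r) → ∀ σ : ℝ, 0 < σ →
    ∀ p : ℕ → ℝ≥0∞, (∀ n, 1 ≤ p n ∧ p n < (d : ℝ≥0∞) - 1) →
    ∃ (ϑ : ℕ → ℝ → Torus d → ℝ) (w S : ℕ → Fin d → ℝ → Torus d → ℝ), S 0 = R ∧
      ∀ n, IsStep M (r / 4 ^ n) (σ * 2 ^ n) (r / 4 ^ (n + 1)) (p n)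
        (fun t x => ρ t x + ∑ m ∈ Finset.range n, ϑ m t x)
        (fun k t x => u k t x + ∑ m ∈ Finset.range n, w m k t x) (S n) (ϑ n) (w n) (S (n + 1)) := by
  obtain ⟨M, hM, step⟩ := exists_step hd
  refine ⟨M, hM, fun ρ u R hsub r hr hR σ hσ p hp => ?_⟩
  let State : ℕ → Type := fun n => {s : (ℝ → Torus d → ℝ) × (Fin d → ℝ → Torus d → ℝ) ×
    (Fin d → ℝ → Torus d → ℝ) // IsSub s.1 s.2.1 s.2.2 ∧
      ∀ t ∈ Icc (0 : ℝ) 1, ∀ k, ∫ x, |s.2.2 k t x| ≤ r / 4 ^ n}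
  choose ϑ w S h using fun (n : ℕ) (s : State n) => step s.1.1 s.1.2.1 s.1.2.2 s.2.1 (r / 4 ^ n)
    (by positivity) s.2.2 (σ * 2 ^ n) (by positivity) (p n) (hp n).1 (hp n).2 (r / 4 ^ (n + 1))
    (by positivity)
  let s : ∀ n, State n := fun n => Nat.rec (motive := State)
    ⟨(ρ, u, R), hsub, by simpa using hR⟩
    (fun n s => ⟨(_, _, S n s), (h n s).isSub, (h n s).defect_le⟩) n
  refine ⟨fun n => ϑ n (s n), fun n => w n (s n), fun n => (s n).1.2.2, rfl, fun n => ?_⟩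
  have e1 : ∀ n, (s n).1.1 = fun t x => ρ t x + ∑ m ∈ Finset.range n, ϑ m (s m) t x := by
    intro n
    induction n with
    | zero => ext t x; simp [s]
    | succ n ih =>
      ext t x
      rw [Finset.sum_range_succ, ← add_assoc]
      exact congrArg (· + ϑ n (s n) t x) (congrFun (congrFun ih t) x)
  have e2 : ∀ n, (s n).1.2.1 = fun k t x => u k t x + ∑ m ∈ Finset.range n, w m (s m) k t x := by
    intro n
    induction n with
    | zero => ext k t x; simp [s]
    | succ n ih =>
      ext k t x
      rw [Finset.sum_range_succ, ← add_assoc]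
      exact congrArg (· + w n (s n) k t x) (congrFun (congrFun (congrFun ih k) t) x)
  rw [← e1, ← e2]
  exact h n (s n)

/-- The sequence `x, f 0, f 1, …`. -/
def consSeq {α : Type*} (x : α) (f : ℕ → α) : ℕ → α
  | 0 => x
  | n + 1 => f n

/-- The vector field with given components. -/
def vecField (v : Fin d → ℝ → Torus d → ℝ) (t : ℝ) (x : Torus d) : Vec d :=
  WithLp.toLp 2 fun k => v k t x

lemma norm_vec_le_sum (v : Vec d) : ‖v‖ ≤ ∑ k, |v k| := by
  rw [EuclideanSpace.norm_eq]
  refine Real.sqrt_le_iff.2 ⟨Finset.sum_nonneg fun k _ => abs_nonneg _, ?_⟩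
  exact Finset.sum_sq_le_sq_sum_of_nonneg fun k _ => abs_nonneg _

lemma continuous_vecField {v : Fin d → ℝ → Torus d → ℝ}
    (h : ∀ k, Continuous fun z : ℝ × Torus d => v k z.1 z.2) :
    Continuous fun z : ℝ × Torus d => vecField v z.1 z.2 :=
  (PiLp.continuous_toLp 2 _).comp (continuous_pi h)

lemma hasPartial_vecField {v v' : Fin d → ℝ → Torus d → ℝ} {i : Fin d} {t : ℝ}
    (h : ∀ k, HasPartial i (v k t) (v' k t)) : HasPartial i (vecField v t) (vecField v' t) :=
  fun x => by
    have h1 := hasDerivAt_pi.2 fun k => h k x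
    exact (PiLp.continuousLinearEquiv 2 ℝ (fun _ : Fin d => ℝ)).symm.toContinuousLinearMap
      |>.hasFDerivAt.comp_hasDerivAt (0 : ℝ) h1

lemma eLpNorm_vecField_le {v : Fin d → ℝ → Torus d → ℝ} {t : ℝ} (c : ∀ k, Continuous (v k t))
    {p : ℝ≥0∞} (hp : 1 ≤ p) {δ : ℝ}
    (h : ∀ k, eLpNorm (v k t) p volume ≤ ENNReal.ofReal δ) :
    eLpNorm (vecField v t) p volume ≤ ENNReal.ofReal (d * δ) := by
  have h1 : eLpNorm (vecField v t) p volume ≤ eLpNorm (∑ k, fun x => |v k t x|) p volume :=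
    eLpNorm_mono_real fun x => by
      rw [Finset.sum_apply]
      exact norm_vec_le_sum _
  refine h1.trans ((eLpNorm_sum_le (fun k _ => (c k).abs.aestronglyMeasurable) hp).trans ?_)
  refine (Finset.sum_le_sum (g := fun _ => ENNReal.ofReal δ) fun k _ => ?_).trans ?_
  · exact (eLpNorm_norm (v k t)).le.trans (h k)
  · rw [Finset.sum_const, Finset.card_univ, Fintype.card_fin, nsmul_eq_mul,
      ENNReal.ofReal_mul (by positivity), ENNReal.ofReal_natCast]

lemma eLpNorm_one_tsum_le {F : ℕ → Torus d → ℝ} (cF : ∀ n, Continuous (F n)) {a : ℕ → ℝ} {A : ℝ}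
    (ha : HasSum a A) (h : ∀ n, ∫ x, |F n x| ≤ a n) :
    eLpNorm (fun x => ∑' n, F n x) 1 volume ≤ ENNReal.ofReal A := by
  obtain ⟨h1, h2⟩ := ae_summable_of_integral_le (fun n => integrable_of_continuous (cF n))
    ha.summable h
  have h3 : eLpNorm (fun x => ∑' n, F n x) 1 volume ≤
      eLpNorm (fun x => ∑' n, ‖F n x‖) 1 volume := by
    refine eLpNorm_mono_ae_real ?_
    filter_upwards [h1] with x hx using norm_tsum_le_tsum_norm hx
  refine h3.trans ?_
  rw [eLpNorm_one_eq_lintegral_enorm, ← ofReal_integral_norm_eq_lintegral_enorm h2]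
  refine ENNReal.ofReal_le_ofReal ?_
  have h4 : ∀ x, ‖∑' n, ‖F n x‖‖ = ∑' n, ‖F n x‖ := fun x =>
    Real.norm_of_nonneg (tsum_nonneg fun n => norm_nonneg _)
  simp only [h4]
  have h5 : Summable fun n => ∫ x, ‖F n x‖ :=
    ha.summable.of_nonneg_of_le (fun n => integral_nonneg fun x => norm_nonneg _) h
  have h6 := hasSum_integral_of_summable_integral_norm (F := fun n x => ‖F n x‖)
    (fun n => (integrable_of_continuous (cF n)).norm) (by simpa only [norm_norm] using h5)
  exact hasSum_le h h6 ha

lemma exists_norm_bound_clamp {G : Type*} [NormedAddCommGroup G] {f : ℝ → Torus d → G}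
    (h : Continuous fun z : ℝ × Torus d => f (clampTime z.1) z.2) :
    ∃ C : ℝ, 1 ≤ C ∧ ∀ t x, ‖f (clampTime t) x‖ ≤ C := by
  obtain ⟨C, hC1, hC⟩ := exists_bound_Icc (fun _ : Unit => fun t x => ‖f (clampTime t) x‖)
    fun _ => h.norm
  refine ⟨C, hC1, fun t x => ?_⟩
  have := hC () _ (clampTime_mem t) x
  rwa [clampTime_of_mem (clampTime_mem t), abs_norm] at this

/-- A family of exact solutions depending on `σ`, the distance to the given pair being `O(σ)` for
the density in `L¹` and `O(σ⁻¹)` for the velocity in `C⁰`. -/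
theorem exists_solution (hd : 3 ≤ d) {ρ₀ : ℝ → Torus d → ℝ} {u₀ : ℝ → Torus d → Vec d}
    (hρ : SmoothOn (Icc 0 1) ρ₀) (hu : SmoothOn (Icc 0 1) u₀)
    (hmean : ∀ t ∈ Icc (0 : ℝ) 1, ∫ x, ρ₀ 0 x = ∫ x, ρ₀ t x)
    (hdiv : ∀ t ∈ Icc (0 : ℝ) 1, ∀ x, divergence (u₀ t) x = 0) :
    ∃ C : ℝ, 0 < C ∧ ∀ σ : ℝ, 0 < σ → ∃ (ρ : ℝ → Torus d → ℝ) (u : ℝ → Torus d → Vec d),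
      HasRegularity ρ u ∧ IsWeakSolution ρ u ∧
      (∀ t ∈ exactTimes ρ₀ u₀, ρ t = ρ₀ t ∧ u t = u₀ t) ∧
      (∀ t ∈ Icc (0 : ℝ) 1, eLpNorm (fun x => ρ t x - ρ₀ t x) 1 volume ≤ ENNReal.ofReal (C * σ)) ∧
      ∀ t ∈ Icc (0 : ℝ) 1, ∀ x, ‖u t x - u₀ t x‖ ≤ C * σ⁻¹ := by
  obtain ⟨M, hM, hseq⟩ := exists_sequence hd
  obtain ⟨R, hsub, hR0⟩ := exists_initial hρ hu hmean hdiv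
  obtain ⟨r, hr1, hr⟩ := exists_bound_Icc R hsub.cont_defect
  have hr0 : 0 < r := by linarith
  have hRr : ∀ t ∈ Icc (0 : ℝ) 1, ∀ k, ∫ x, |R k t x| ≤ r := fun t ht k => by
    have := integral_mono (integrable_of_continuous
      ((hsub.cont_defect k).comp (Continuous.prodMk_right t)).abs)
      (integrable_const r) fun x => hr k t ht x
    simpa using this
  have hp1 : (1 : ℝ≥0∞) < (d : ℝ≥0∞) - 1 := by
    obtain ⟨e, rfl⟩ := Nat.exists_eq_add_of_le' hd
    have : ((e + 3 : ℕ) : ℝ≥0∞) - 1 = ((e + 2 : ℕ) : ℝ≥0∞) := by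
      rw [← Nat.cast_one, ← ENNReal.natCast_sub]; rfl
    rw [this, ← Nat.cast_one, Nat.cast_lt]
    omega
  -- every exponent below `d - 1` is eventually exceeded
  obtain ⟨p, -, hp, hplim⟩ := exists_seq_strictMono_tendsto' hp1
  -- the geometric series contribute the factors `2`
  refine ⟨2 * (M * r) + 2 * (d * M), by positivity, fun σ hσ => ?_⟩
  obtain ⟨ϑ, w, S, hS0, hst⟩ := hseq _ _ R hsub r hr0 hRr σ hσ p fun n => ⟨(hp n).1.le, (hp n).2⟩
  -- with `η = σ 2ⁿ` and defects `r / 4ⁿ` both series are dominated by geometric ones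
  have bϑ : ∀ n t, ∫ x, |ϑ n (clampTime t) x| ≤ M * r * σ * (1 / 2) ^ n := fun n t => by
    refine ((hst n).density_le _ (clampTime_mem t)).trans (le_of_eq ?_)
    have : (4 : ℝ) ^ n = 2 ^ n * 2 ^ n := by rw [← mul_pow]; norm_num
    rw [this, one_div, inv_pow]
    field_simp
  have bw : ∀ n t x, ‖vecField (w n) (clampTime t) x‖ ≤ d * M * σ⁻¹ * (1 / 2) ^ n := fun n t x => by
    refine (norm_vec_le_sum _).trans ((Finset.sum_le_sum fun k _ =>
      (hst n).velocity_le _ (clampTime_mem t) x k).trans (le_of_eq ?_))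
    rw [Finset.sum_const, Finset.card_univ, Fintype.card_fin, nsmul_eq_mul, one_div, inv_pow,
      mul_inv]
    ring
  have hpow : ∀ n : ℕ, r / 4 ^ n ≤ r * (1 / 2) ^ n := fun n => by
    rw [div_eq_mul_inv, one_div, inv_pow]
    gcongr
    norm_num
  obtain ⟨C₁, hC₁, b₁⟩ := exists_norm_bound_clamp hρ.continuous_clamp
  obtain ⟨C₂, hC₂, b₂⟩ := exists_norm_bound_clamp hu.continuous_clamp
  choose C₃ hC₃ b₃ using fun i => exists_norm_bound_clamp (f := fun t => pderiv i (u₀ t))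
    (hu.continuous_pderiv_clamp i)
  obtain ⟨B, hB⟩ : ∃ B, B = M * r * σ + d * M * σ⁻¹ + d * r + r := ⟨_, rfl⟩
  obtain ⟨D, hD⟩ : ∃ D, D = C₁ + C₂ + ∑ i, C₃ i + 2 * B := ⟨_, rfl⟩
  have k1 : 0 ≤ M * r * σ := by positivity
  have k2 : 0 ≤ d * M * σ⁻¹ := by positivity
  have k3 : 0 ≤ d * r := by positivity
  have k4 : ∀ i, C₃ i ≤ ∑ i, C₃ i := fun i =>
    Finset.single_le_sum (fun i _ => zero_le_one.trans (hC₃ i)) (Finset.mem_univ i)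
  have k5 : 0 ≤ ∑ i, C₃ i := Finset.sum_nonneg fun i _ => zero_le_one.trans (hC₃ i)
  have hB0 : 0 ≤ B := by linarith
  have hD0 : 0 ≤ D := by linarith
  have hDB : ∀ {b : ℝ} (n : ℕ), b ≤ B → b * (1 / 2) ^ n ≤ D * (1 / 2) ^ (n + 1) :=
      fun {b} n hb => by
    have : D * (1 / 2) ^ (n + 1) = (D / 2) * (1 / 2) ^ n := by rw [pow_succ]; ring
    rw [this]
    gcongr
    linarith
  have cϑ : ∀ n, Continuous fun z : ℝ × Torus d => ϑ n (clampTime z.1) z.2 := fun n =>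
    (hst n).smooth_density.continuous.comp
      ((continuous_clampTime.comp continuous_fst).prodMk continuous_snd)
  have cw : ∀ n k, Continuous fun z : ℝ × Torus d => w n k (clampTime z.1) z.2 := fun n k =>
    ((hst n).smooth_velocity k).continuous.comp
      ((continuous_clampTime.comp continuous_fst).prodMk continuous_snd)
  have cDw : ∀ n i k, Continuous fun z : ℝ × Torus d =>
      dirDeriv (eDir i) (w n k) (clampTime z.1) z.2 := fun n i k =>
    (((hst n).smooth_velocity k).dirDeriv _).continuous.comp
      ((continuous_clampTime.comp continuous_fst).prodMk continuous_snd)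
  have cS : ∀ n k, Continuous fun z : ℝ × Torus d => S n k z.1 z.2 := fun n k => by
    cases n with
    | zero => rw [hS0]; exact hsub.cont_defect k
    | succ n => exact (hst n).isSub.cont_defect k
  have eS : ∀ n t, t ∈ Icc (0 : ℝ) 1 → ∀ k, ∫ x, |S n k t x| ≤ r / 4 ^ n := fun n t ht k => by
    cases n with
    | zero => rw [hS0]; simpa using hRr t ht k
    | succ n => exact (hst n).defect_le t ht k
  let Θ : ℕ → ℝ → Torus d → ℝ := consSeq (fun t => ρ₀ (clampTime t)) fun n t => ϑ n (clampTime t)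
  let W : ℕ → ℝ → Torus d → Vec d :=
    consSeq (fun t => u₀ (clampTime t)) fun n t => vecField (w n) (clampTime t)
  let DW : ℕ → Fin d → ℝ → Torus d → Vec d :=
    consSeq (fun i t => pderiv i (u₀ (clampTime t)))
      fun n i t => vecField (fun k => dirDeriv (eDir i) (w n k)) (clampTime t)
  have key : IsSeries (fun n => D * (1 / 2) ^ n) (consSeq 1 p) Θ W DW S := by
    refine ⟨fun n => by positivity, summable_geometric_two.mul_left D, ?_, ?_, ?_, ?_, ?_, ?_, ?_,
      ?_, ?_, ?_⟩
    · rintro (_ | n)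
      · exact le_rfl
      · exact (hp n).1.le
    · rintro (_ | n)
      · exact hρ.continuous_clamp
      · exact cϑ n
    · rintro (_ | n)
      · exact hu.continuous_clamp
      · exact continuous_vecField (v := fun k t => w n k (clampTime t)) (cw n)
    · rintro (_ | n) i
      · exact hu.continuous_pderiv_clamp i
      · exact continuous_vecField
          (v := fun k t => dirDeriv (eDir i) (w n k) (clampTime t)) (cDw n i)
    · rintro (_ | n) i t
      · exact hu.hasPartial_Icc (clampTime_mem t) i
      · exact hasPartial_vecField fun k => ((hst n).smooth_velocity k).hasPartial i _
    · rintro (_ | n) t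
      · have := integral_mono (integrable_of_continuous
          (hρ.continuous_clamp.comp (Continuous.prodMk_right t)).norm)
          (integrable_const C₁) fun x => b₁ t x
        simp only [integral_const, probReal_univ, one_smul] at this
        refine this.trans ?_
        simp only [pow_zero, mul_one]
        linarith
      · exact (bϑ n t).trans (hDB n (by linarith))
    · rintro (_ | n) t x
      · refine (b₂ t x).trans ?_
        simp only [pow_zero, mul_one]
        linarith
      · exact (bw n t x).trans (hDB n (by linarith))
    · rintro (_ | n) i t
      · refine eLpNorm_le_of_forall_norm_le fun x => (b₃ i t x).trans ?_
        simp only [pow_zero, mul_one]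
        linarith [k4 i]
      · refine (eLpNorm_vecField_le (fun k => (cDw n i k).comp (Continuous.prodMk_right t))
          (hp n).1.le
          fun k => (hst n).gradient_Lp _ (clampTime_mem t) k i).trans
          (ENNReal.ofReal_le_ofReal ?_)
        have e1 : d * (r / 4 ^ (n + 1)) ≤ d * r * (1 / 2) ^ (n + 1) := by
          rw [mul_assoc]
          exact mul_le_mul_of_nonneg_left (hpow (n + 1)) (by positivity)
        have e2 : d * r * (1 / 2) ^ (n + 1) ≤ D * (1 / 2) ^ (n + 1) := by gcongr; linarith
        exact e1.trans e2
    · intro n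
      have eW : ∀ t ∈ Icc (0 : ℝ) 1, ∀ k x, (∑ m ∈ Finset.range (n + 1), W m t x) k =
          u₀ (clampTime t) x k + ∑ m ∈ Finset.range n, w m k t x := fun t ht k x => by
        rw [Finset.sum_range_succ', WithLp.ofLp_add, WithLp.ofLp_sum, Pi.add_apply,
          Finset.sum_apply, add_comm]
        simp only [W, consSeq, vecField, clampTime_of_mem ht]
      have hsubn : IsSub (fun t x => ρ₀ (clampTime t) x + ∑ m ∈ Finset.range n, ϑ m t x)
          (fun k t x => u₀ (clampTime t) x k + ∑ m ∈ Finset.range n, w m k t x) (S n) := by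
        cases n with
        | zero => rw [hS0]; simpa using hsub
        | succ n =>
          have := (hst n).isSub
          simp only [Finset.sum_range_succ, ← add_assoc] at this ⊢
          exact this
      refine hsubn.congr ?_ ?_ (cS n) ?_ eW fun _ _ _ _ => rfl
      · refine continuous_finsetSum _ fun m _ => ?_
        rcases m with _ | m
        · exact hρ.continuous_clamp
        · exact cϑ m
      · refine fun k => (EuclideanSpace.proj (𝕜 := ℝ) k : Vec d →L[ℝ] ℝ).continuous.comp
          (continuous_finsetSum _ fun m _ => ?_)
        rcases m with _ | m
        · exact hu.continuous_clamp
        · exact continuous_vecField (v := fun k t => w m k (clampTime t)) (cw m)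
      · intro t ht x
        rw [Finset.sum_range_succ', add_comm]
        simp only [Θ, consSeq, clampTime_of_mem ht]
    · intro n k t ht
      refine (eS n t (Ioo_subset_Icc_self ht) k).trans ((hpow n).trans ?_)
      gcongr
      linarith
  have hsumΘ : ∀ t ∈ Icc (0 : ℝ) 1, ∀ᵐ x, ∑' n, Θ n t x - ρ₀ t x = ∑' n, ϑ n (clampTime t) x := by
    intro t ht
    filter_upwards [(ae_summable_of_integral_le (fun n => integrable_of_continuous
      ((key.cont_density n).comp (Continuous.prodMk_right t))) key.summable
      fun n => key.density_le n t).1] with x hx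
    have : ∑' n, Θ n t x = Θ 0 t x + ∑' n, Θ (n + 1) t x := hx.of_norm.tsum_eq_zero_add
    rw [this]
    simp only [Θ, consSeq, clampTime_of_mem ht, add_sub_cancel_left]
  refine ⟨_, _, key.hasRegularity fun q hq => ?_, key.isWeakSolution, ?_, ?_, ?_⟩
  · have := (tendsto_order.1 hplim).1 q hq
    have h2 := (tendsto_sub_atTop_nat 1).eventually this
    filter_upwards [h2, eventually_ge_atTop 1] with n hn h1
    obtain ⟨m, rfl⟩ := Nat.exists_eq_add_of_le' h1
    exact hn.le
  · intro t ht
    have hz : ∀ n k x, S n k t x = 0 := by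
      intro n
      induction n with
      | zero => rw [hS0]; exact hR0 t ht
      | succ n ih => exact ((hst n).vanish t ht.1 ih).2.2
    have hv := fun n => (hst n).vanish t ht.1 (hz n)
    constructor
    · ext x
      rw [tsum_eq_single 0]
      · simp only [Θ, consSeq, clampTime_of_mem ht.1]
      · rintro (_ | n) hn
        · exact absurd rfl hn
        · simp only [Θ, consSeq, clampTime_of_mem ht.1]
          exact (hv n).1 x
    · funext x
      rw [tsum_eq_single 0]
      · simp only [W, consSeq, clampTime_of_mem ht.1]
      · rintro (_ | n) hn
        · exact absurd rfl hn
        · simp only [W, consSeq, clampTime_of_mem ht.1, vecField]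
          ext k
          exact (hv n).2.1 k x
  · intro t ht
    rw [eLpNorm_congr_ae (hsumΘ t ht)]
    refine (eLpNorm_one_tsum_le (fun n => (cϑ n).comp (Continuous.prodMk_right t))
      (hasSum_geometric_two.mul_left (M * r * σ)) fun n => bϑ n t).trans
      (ENNReal.ofReal_le_ofReal ?_)
    have : 0 ≤ 2 * (d * M) * σ := by positivity
    linarith
  · intro t ht x
    have h1 : ∑' n, W n t x = W 0 t x + ∑' n, W (n + 1) t x :=
      (key.hasSum_velocity t x).summable.tsum_eq_zero_add
    have h2 : ∑' n, W n t x - u₀ t x = ∑' n, vecField (w n) (clampTime t) x := by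
      rw [h1]
      simp only [W, consSeq, clampTime_of_mem ht, add_sub_cancel_left]
    rw [h2]
    refine (tsum_of_norm_bounded (hasSum_geometric_two.mul_left (d * M * σ⁻¹))
      fun n => bw n t x).trans ?_
    have : 0 ≤ 2 * (M * r) * σ⁻¹ := by positivity
    linarith

end ContinuityEq

theorem theorem2 (d : ℕ) (hd : 3 ≤ d) (ε : ℝ) (hε : 0 < ε)
    (ρ₀ : ℝ → ContinuityEq.Torus d → ℝ)
    (u₀ : ℝ → ContinuityEq.Torus d → ContinuityEq.Vec d)
    (hρ₀ : ContinuityEq.SmoothOn (Icc 0 1) ρ₀)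
    (hu₀ : ContinuityEq.SmoothOn (Icc 0 1) u₀)
    (hmean : ∀ t ∈ Icc (0 : ℝ) 1, ∫ x, ρ₀ 0 x = ∫ x, ρ₀ t x)
    (hdiv : ∀ t ∈ Icc (0 : ℝ) 1, ∀ x, ContinuityEq.divergence (u₀ t) x = 0) :
    (∃ (ρ : ℝ → ContinuityEq.Torus d → ℝ)
        (u : ℝ → ContinuityEq.Torus d → ContinuityEq.Vec d),
      ContinuityEq.HasRegularity ρ u ∧ ContinuityEq.IsWeakSolution ρ u ∧
      (∀ t ∈ ContinuityEq.exactTimes ρ₀ u₀, ρ t =ᵐ[volume] ρ₀ t ∧ u t = u₀ t) ∧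
      ∀ t ∈ Icc (0 : ℝ) 1,
        eLpNorm (fun x => ρ t x - ρ₀ t x) 1 volume ≤ ENNReal.ofReal ε) ∧
    (∃ (ρ : ℝ → ContinuityEq.Torus d → ℝ)
        (u : ℝ → ContinuityEq.Torus d → ContinuityEq.Vec d),
      ContinuityEq.HasRegularity ρ u ∧ ContinuityEq.IsWeakSolution ρ u ∧
      (∀ t ∈ ContinuityEq.exactTimes ρ₀ u₀, ρ t =ᵐ[volume] ρ₀ t ∧ u t = u₀ t) ∧
      ∀ t ∈ Icc (0 : ℝ) 1, ∀ x, ‖u t x - u₀ t x‖ ≤ ε) := by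
  obtain ⟨C, hC, h⟩ := ContinuityEq.exists_solution hd hρ₀ hu₀ hmean hdiv
  constructor
  · obtain ⟨ρ, u, h1, h2, h3, h4, -⟩ := h (ε / C) (by positivity)
    refine ⟨ρ, u, h1, h2, fun t ht => ⟨.of_eq (h3 t ht).1, (h3 t ht).2⟩, ?_⟩
    rwa [mul_div_cancel₀ _ hC.ne'] at h4
  · obtain ⟨ρ, u, h1, h2, h3, -, h5⟩ := h (C / ε) (by positivity)
    refine ⟨ρ, u, h1, h2, fun t ht => ⟨.of_eq (h3 t ht).1, (h3 t ht).2⟩, ?_⟩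
    rwa [inv_div, mul_div_cancel₀ _ hC.ne'] at h5
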